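/- For real parameters $a,b$ with $0\le b\le 1$ and $1-b<a\le 1+b$, let $L_{a,b}(x,y)=(1+y-a|x|,\,bx)$ be the Lozi map, let $$Z=\left(\frac{2+a+\sqrt{a^2+4b}}{2(1+a-b)},\,0\right),$$ and let $x_n=x_n(a,b)$ denote the $x$-coordinate of $Z^n=L_{a,b}^n(Z)$, $n\ge 0$. For $n\ge 2$ put $$C_n=\{(a,b): 0\le b\le 1,\ 1-b<a\le 1+b,\ x_j\ge 0 \text{ for all even } j<n,\ x_j\le 0 \text{ for all odd } j<n,\ x_n=0\}.$$ Lemma. For every $k\ge 4$ the set $C_k$ contains exactly one point at which the coordinate $b$ is minimal on $C_k$; denote it by $(a_k,b_k)=\min C_k$. Then $b_{k+2}\ge b_k$ and $a_{k+2}\le a_k$ for every $k\ge 4$. Moreover, $\lim_{k\to\infty}(a_k,b_k)=(0,1)$. -/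

import Mathlib

namespace Lozi

/-- The Lozi map `L_{a,b}(x, y) = (1 + y - a|x|, b x)` of the plane. -/
def loziMap (a b : ℝ) (p : ℝ × ℝ) : ℝ × ℝ :=
  (1 + p.2 - a * |p.1|, b * p.1)

/-- The point `Z` at which the right half of the unstable manifold of the fixed point of
`L_{a,b}` in the first quadrant meets the horizontal axis for the first time. -/
noncomputable def pointZ (a b : ℝ) : ℝ × ℝ :=
  ((2 + a + √(a ^ 2 + 4 * b)) / (2 * (1 + a - b)), 0)

/-- The `x`-coordinate of `Z^n = L_{a,b}^n(Z)`. -/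
noncomputable def xCoord (a b : ℝ) (n : ℕ) : ℝ :=
  ((loziMap a b)^[n] (pointZ a b)).1

/-- The curve `C_n` in the parameter plane: the points `Z^j` with `j < n` lie in the closed
right half-plane for even `j` and in the closed left half-plane for odd `j`, while `Z^n` lies
on the `y`-axis. Points of the plane are pairs `(a, b)`. -/
def curveC (n : ℕ) : Set (ℝ × ℝ) :=
  {p | 0 ≤ p.2 ∧ p.2 ≤ 1 ∧ 1 - p.2 < p.1 ∧ p.1 ≤ 1 + p.2 ∧
    (∀ j < n, Even j → 0 ≤ xCoord p.1 p.2 j) ∧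
    (∀ j < n, Odd j → xCoord p.1 p.2 j ≤ 0) ∧
    xCoord p.1 p.2 n = 0}

/-- `p = (a, b)` is a lowest point of the set `S`, i.e. a point of `S` at which the second
coordinate `b` is minimal. -/
def IsLowestPoint (S : Set (ℝ × ℝ)) (p : ℝ × ℝ) : Prop :=
  p ∈ S ∧ IsMinOn Prod.snd S p

end Lozi

namespace Lozi

open Real Filter Topology

/-! On `C_k` the orbit of `Z` alternates between the half-planes, so it follows two affine maps in
turn. Where `a^2 < 4b`, put `b = exp (-2l)` and `a = 2 exp (-l) sin h`. The two-step linear part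
then has eigenvalues `exp (-2l) exp (±2ih)`, so the orbit spirals around an orbit of period two.
Solving the recurrence turns the sign condition at time `j` into `lob ≤ exp (n l)` with `n = j + 1`,
where `lob` is, for each parity of `n`, a sinusoid in `n h` with weight `gw`, and the condition `x_k
= 0` becomes equality at `n = k + 1` (`vseq_eq`, `mem_curveC_iff`). The remaining parameters `4b ≤
a^2` are excluded by a sign argument on a recurrence (`not_mem_curveC_of_le`).

Minimal `b` means maximal `l`. The infinitely many turns and the `k` sign conditions reduce to one
lobe and one constraint: equality at `n`, `n h` within the first lobe, and the inequality at `n - 2`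
(`LobePt`). Points of `C_k` with `l > 0` satisfy these by `first_lobe`. Conversely, a lobe point
with maximal `l` (`IsTop`) lies in `C_k`: earlier times of the same parity follow by downward
propagation (`LobePt.same_parity`), times of the other parity from phase considerations when `n` is
odd (`LobePt.lob_zero_le`) and from a quantitative estimate when `n` is even (`IsTop.lob_one_le`).
That estimate compares cosines with Gaussians and rests on stationarity of the lobe function at a
top (`IsTop.slope_bound`).

A top exists by compactness. It is unique because two tops at the same `l` would be zeros of a
strictly concave function of `h` that is nowhere positive between them (`isTop_le`).

For the monotonicity of `b_k`, a lobe point for `n + 2` yields one for `n` with the same `l`: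
increasing `h` until the phase agrees increases the amplitude (`exists_lobePt_of_add_two`). For
`a_k`, the top for `n` is moved along the curve of constant `a` to the smaller `l` of the next top.
Relative to `exp (n l)` the lobe does not decrease on the way, whereas a larger `a` at the next top
would force it strictly below (`IsTop.exp_mul_sin_le`). The times `n = 5, 6` are settled by explicit
estimates. The limit holds because `n h` stays below `2π` while `sinh l < sin h`. -/

/-- The hyperbolic cosine of the real number with hyperbolic sine `sin h`. -/
noncomputable def rC (h : ℝ) : ℝ := √(1 + sin h ^ 2)

/-- The hyperbolic sine of `arsinh (sin h) + l`. -/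
noncomputable def rW (h l : ℝ) : ℝ := sin h * cosh l + rC h * sinh l

/-- The numerator of `rQ`. -/
noncomputable def rN (h l : ℝ) : ℝ := rC h - 2 * sinh l / rW h l

/-- The cotangent of the phase of the orbit of `Z` around the orbit of period two. -/
noncomputable def rQ (h l : ℝ) : ℝ := rN h l / cos h

/-- The weight of a lobe; `t = 0` for odd times and `t = 1` for even times. -/
noncomputable def gw (t h l : ℝ) : ℝ := (sin h - t * sinh l) / (sin h + t * sinh l)

/-- The right end of the range of `n * h` for the first lobe. -/
noncomputable def cc (t : ℝ) : ℝ := 2 * π - t * (π / 2)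

/-- The lobe function. -/
noncomputable def lob (t n h l : ℝ) : ℝ :=
  gw t h l * (cos (cc t - n * h) + rQ h l * sin (cc t - n * h))

/-! ### Parameter domain, amplitude identity and monotonicity in the angle. -/

/-- The parameters `(h, l)` that correspond to the points `(a, b)` of the triangle
`1 - b < a ≤ 1 + b` with `b = exp (-2 l)` and `a = 2 exp (-l) sin h`. -/
structure Dom (h l : ℝ) : Prop where
  l0 : 0 ≤ l
  h0 : 0 < h
  h1 : h < π / 2
  lt : sinh l < sin h

lemma one_le_rC (h : ℝ) : 1 ≤ rC h := by
  unfold rC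
  rw [Real.one_le_sqrt]
  nlinarith [sq_nonneg (sin h)]

lemma rC_sq (h : ℝ) : rC h ^ 2 = 1 + sin h ^ 2 := by
  unfold rC
  exact Real.sq_sqrt (by positivity)

lemma cosh_sq_eq (l : ℝ) : cosh l ^ 2 = 1 + sinh l ^ 2 := by
  rw [Real.cosh_sq]; ring

lemma sin_lt_rC (h : ℝ) : sin h < rC h := by
  have := one_le_rC h
  nlinarith [rC_sq h, sq_nonneg (sin h)]

lemma exp_neg_eq (l : ℝ) : exp (-l) = cosh l - sinh l := by
  rw [Real.cosh_sub_sinh]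

lemma exp_neg_two (l : ℝ) : exp (-2 * l) = 1 - 2 * sinh l * (cosh l - sinh l) := by
  rw [show -2 * l = -l + -l by ring, exp_add, exp_neg_eq]
  nlinarith [cosh_sq_eq l]

namespace Dom

variable {h l : ℝ}

lemma x0 (d : Dom h l) : 0 < sin h := sin_pos_of_pos_of_lt_pi d.h0 (by linarith [d.h1, pi_pos])

lemma y0 (d : Dom h l) : 0 < cos h := cos_pos_of_mem_Ioo ⟨by linarith [d.h0, pi_pos], d.h1⟩

lemma p0 (d : Dom h l) : 0 ≤ sinh l := Real.sinh_nonneg_iff.2 d.l0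

lemma x1 (d : Dom h l) : sin h < 1 := by
  nlinarith [sin_sq_add_cos_sq h, d.y0, d.x0]

lemma W0 (d : Dom h l) : 0 < rW h l := by
  have := one_le_rC h
  have := Real.one_le_cosh l
  have := mul_pos d.x0 (cosh_pos l)
  have := mul_nonneg (show 0 ≤ rC h by linarith) d.p0
  unfold rW; linarith

lemma le_W (d : Dom h l) : sin h + sinh l ≤ rW h l := by
  unfold rW
  nlinarith [one_le_rC h, Real.one_le_cosh l, d.x0, d.p0]

/-- After clearing `rW`, the bound reduces to `rC * cosh ≥ 1` and `sinh l < sin h`: `rC * rW ≥ sin h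
+ sinh l > 2 sinh l`. -/
lemma N0 (d : Dom h l) : 0 < rN h l := by
  have hW := d.W0
  have h1 := one_le_rC h
  have h2 := Real.one_le_cosh l
  have h3 := rC_sq h
  unfold rN
  rw [sub_pos, div_lt_iff₀ hW]
  unfold rW
  have h4 : 1 ≤ rC h * cosh l := by nlinarith
  have h5 : sin h ≤ rC h * cosh l * sin h := by nlinarith [d.x0]
  have h6 : 0 ≤ sin h ^ 2 * sinh l := mul_nonneg (sq_nonneg _) d.p0
  have h7 : rC h * (sin h * cosh l + rC h * sinh l) =
      rC h * cosh l * sin h + (1 + sin h ^ 2) * sinh l := by rw [← h3]; ring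
  linarith [d.lt]

lemma N_le (d : Dom h l) : rN h l ≤ rC h := by
  unfold rN
  have := div_nonneg (mul_nonneg zero_le_two d.p0) d.W0.le
  linarith

lemma Q0 (d : Dom h l) : 0 < rQ h l := div_pos d.N0 d.y0

/-- The subtracted term of `rN` is split evenly: `sinh l / rW < rC - sin h` and `sin h / rW ≤ exp
(-l)`, each obtained by multiplying with the conjugate factor. -/
lemma phi_lt_N (d : Dom h l) : exp (-2 * l) - 1 + 2 * sin h ^ 2 < 2 * sin h * rN h l := by
  have hW := d.W0
  have hx := d.x0
  have hp := d.p0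
  have hC := rC_sq h
  have hr := cosh_sq_eq l
  have hCx := sin_lt_rC h
  have hrp := Real.sinh_lt_cosh l
  rw [exp_neg_two]
  have e1 : sinh l < (rC h - sin h) * rW h l := by
    have : sinh l * (rC h + sin h) < rW h l := by unfold rW; nlinarith
    have h2 : (rC h - sin h) * (rC h + sin h) = 1 := by nlinarith
    have h3 : 0 < rC h - sin h := by linarith
    nlinarith
  have e2 : sin h ≤ (cosh l - sinh l) * rW h l := by
    have : sin h * (cosh l + sinh l) ≤ rW h l := by unfold rW; nlinarith
    have h2 : (cosh l - sinh l) * (cosh l + sinh l) = 1 := by nlinarith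
    have h3 : 0 < cosh l - sinh l := by linarith
    nlinarith
  have e3 : 2 * sin h * sinh l / rW h l <
      sin h * (rC h - sin h) + sinh l * (cosh l - sinh l) := by
    rw [div_lt_iff₀ hW]
    nlinarith
  have e4 : 2 * sin h * rN h l = 2 * (sin h * rC h) - 2 * (2 * sin h * sinh l / rW h l) := by
    unfold rN; field_simp
  rw [e4]
  nlinarith

/-- The even lobe, extended backwards to time `-2`, lies above the exponential there. This is what
contradicts a full turn in `first_lobe`. -/
lemma phi_lt_Q (d : Dom h l) : exp (-2 * l) - cos (2 * h) < rQ h l * sin (2 * h) := by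
  have hy := d.y0
  have : rQ h l * sin (2 * h) = 2 * sin h * rN h l := by
    unfold rQ; rw [sin_two_mul]; field_simp
  rw [this, cos_two_mul]
  nlinarith [d.phi_lt_N, sin_sq_add_cos_sq h]

/-- Closed form of the squared amplitude, obtained from `rN * rW = rC * rW - 2 sinh l` and the two
Pythagorean relations. All later amplitude bounds come from it. -/
lemma S_sq (d : Dom h l) :
    cos h ^ 2 * (1 + rQ h l ^ 2) = 2 * (sin h ^ 2 + sinh l ^ 2) / rW h l ^ 2 := by
  have hy := d.y0
  have hW := d.W0
  have e : cos h ^ 2 * (1 + rQ h l ^ 2) = cos h ^ 2 + rN h l ^ 2 := by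
    unfold rQ; field_simp
  rw [e, eq_div_iff (by positivity)]
  have e2 : rN h l * rW h l = rC h * rW h l - 2 * sinh l := by
    unfold rN; field_simp
  have e3 : (cos h ^ 2 + rN h l ^ 2) * rW h l ^ 2 =
      cos h ^ 2 * rW h l ^ 2 + (rN h l * rW h l) ^ 2 := by ring
  rw [e3, e2, cos_sq']
  have hC := rC_sq h
  have hr := cosh_sq_eq l
  have e4 : (1 - sin h ^ 2) * rW h l ^ 2 + (rC h * rW h l - 2 * sinh l) ^ 2 =
      (1 - sin h ^ 2 + rC h ^ 2) * rW h l ^ 2 - 4 * rC h * sinh l * rW h l + 4 * sinh l ^ 2 := by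
    ring
  rw [e4, hC]
  unfold rW
  linear_combination (2 * sin h ^ 2) * hr - 2 * sinh l ^ 2 * hC

lemma S_sq_le (d : Dom h l) : cos h ^ 2 * (1 + rQ h l ^ 2) ≤ 2 := by
  rw [d.S_sq, div_le_iff₀ (pow_pos d.W0 2)]
  have := d.le_W
  have h1 := d.x0
  have h2 := d.p0
  nlinarith [mul_nonneg h1.le h2, d.W0, mul_self_le_mul_self (by linarith : 0 ≤ sin h + sinh l) this]

lemma gw_pos (d : Dom h l) {t : ℝ} (ht : 0 ≤ t) (ht1 : t ≤ 1) : 0 < gw t h l := by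
  have := d.x0
  have := d.p0
  have := d.lt
  unfold gw
  apply div_pos <;> nlinarith

lemma gw_le_one (d : Dom h l) {t : ℝ} (ht : 0 ≤ t) : gw t h l ≤ 1 := by
  have := d.x0
  have := mul_nonneg ht d.p0
  unfold gw
  rw [div_le_one (by linarith)]
  linarith

lemma mono (d : Dom h l) {h' : ℝ} (hh : h ≤ h') (h1 : h' < π / 2) : Dom h' l := by
  refine ⟨d.l0, d.h0.trans_le hh, h1, d.lt.trans_le ?_⟩
  exact sin_le_sin_of_le_of_le_pi_div_two (by linarith [d.h0, pi_pos]) h1.le hh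

lemma sin_lt (d : Dom h l) {h' : ℝ} (hh : h < h') (h1 : h' < π / 2) : sin h < sin h' :=
  sin_lt_sin_of_lt_of_le_pi_div_two (by linarith [d.h0, pi_pos]) h1.le hh

lemma rC_lt (d : Dom h l) {h' : ℝ} (hh : h < h') (h1 : h' < π / 2) : rC h < rC h' := by
  have := d.sin_lt hh h1
  have := d.x0
  unfold rC
  exact Real.sqrt_lt_sqrt (by positivity) (by nlinarith)

lemma gw_le_gw (d : Dom h l) {t h' : ℝ} (ht : 0 ≤ t) (hh : h ≤ h') (h1 : h' < π / 2) :
    gw t h l ≤ gw t h' l := by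
  rcases hh.eq_or_lt with rfl | hh
  · rfl
  have e := d.sin_lt hh h1
  have := d.x0
  have := mul_nonneg ht d.p0
  unfold gw
  rw [div_le_div_iff₀ (by linarith) (by linarith)]
  nlinarith

lemma rN_lt (d : Dom h l) {h' : ℝ} (hh : h < h') (h1 : h' < π / 2) : rN h l < rN h' l := by
  have d' := d.mono hh.le h1
  have e1 := d.rC_lt hh h1
  have e2 := d.sin_lt hh h1
  have hp := d.p0
  have : 2 * sinh l / rW h' l ≤ 2 * sinh l / rW h l := by
    apply div_le_div_of_nonneg_left (by linarith) d.W0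
    unfold rW
    nlinarith [cosh_pos l]
  unfold rN
  linarith

lemma rQ_lt (d : Dom h l) {h' : ℝ} (hh : h < h') (h1 : h' < π / 2) : rQ h l < rQ h' l := by
  have d' := d.mono hh.le h1
  have e1 := d.rN_lt hh h1
  have e2 : cos h' < cos h := cos_lt_cos_of_nonneg_of_le_pi_div_two d.h0.le h1.le hh
  unfold rQ
  exact div_lt_div₀ e1 e2.le d'.N0.le d'.y0

lemma rQ_le (d : Dom h l) {h' : ℝ} (hh : h ≤ h') (h1 : h' < π / 2) : rQ h l ≤ rQ h' l := by
  rcases hh.eq_or_lt with rfl | hh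
  · rfl
  exact (d.rQ_lt hh h1).le

end Dom

/-! ### The orbit as a linear recurrence and its closed form. -/

/-- The sequence that satisfies the linear recurrence of the `x`-coordinates of an orbit that
alternates between the right and the left half-plane. -/
noncomputable def vseq (a b : ℝ) : ℕ → ℝ
  | 0 => 0
  | 1 => (pointZ a b).1
  | n + 2 => 1 + b * vseq a b n - (-1) ^ n * a * vseq a b (n + 1)

lemma vseq_add_two (a b : ℝ) (n : ℕ) :
    vseq a b (n + 2) = 1 + b * vseq a b n - (-1) ^ n * a * vseq a b (n + 1) := by
  rw [vseq]

lemma neg_one_pow_mul_abs {n : ℕ} {x : ℝ} (hx : 0 ≤ (-1) ^ n * x) : |x| = (-1) ^ n * x := by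
  rcases Nat.even_or_odd n with hn | hn
  · rw [hn.neg_one_pow, one_mul] at *
    exact abs_of_nonneg hx
  · rw [hn.neg_one_pow] at *
    rw [abs_of_nonpos (by linarith)]; ring

/-- The index is shifted by one so that the zeroth term encodes the vanishing height of `Z`. The
hypothesis is a disjunction so that the sign information may come from the orbit or from the
sequence; both directions of `mem_curveC_iff_vseq` need it. -/
lemma iterate_eq_vseq (a b : ℝ) (j : ℕ)
    (hj : ∀ i < j, 0 ≤ (-1) ^ i * xCoord a b i ∨ 0 ≤ (-1) ^ i * vseq a b (i + 1)) :
    (loziMap a b)^[j] (pointZ a b) = (vseq a b (j + 1), b * vseq a b j) := by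
  induction j with
  | zero => simp [vseq, pointZ]
  | succ j ih =>
    have ih := ih fun i hi => hj i (by omega)
    have hx : xCoord a b j = vseq a b (j + 1) := by rw [xCoord, ih]
    have hs : 0 ≤ (-1) ^ j * vseq a b (j + 1) := by
      have := hj j (by omega)
      rwa [hx, or_self] at this
    rw [Function.iterate_succ_apply', ih, loziMap, vseq_add_two]
    simp only [neg_one_pow_mul_abs hs]
    ext <;> ring

lemma mem_curveC_iff_vseq (a b : ℝ) (k : ℕ) :
    (a, b) ∈ curveC k ↔ 0 ≤ b ∧ b ≤ 1 ∧ 1 - b < a ∧ a ≤ 1 + b ∧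
      (∀ j < k, 0 ≤ (-1) ^ j * vseq a b (j + 1)) ∧ vseq a b (k + 1) = 0 := by
  have sgn : ((∀ j < k, Even j → 0 ≤ xCoord a b j) ∧ (∀ j < k, Odd j → xCoord a b j ≤ 0)) ↔
      ∀ j < k, 0 ≤ (-1) ^ j * xCoord a b j := by
    constructor
    · rintro ⟨h1, h2⟩ j hj
      rcases Nat.even_or_odd j with hn | hn
      · rw [hn.neg_one_pow, one_mul]; exact h1 j hj hn
      · rw [hn.neg_one_pow]; linarith [h2 j hj hn]
    · intro h
      refine ⟨fun j hj hn => ?_, fun j hj hn => ?_⟩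
      · have := h j hj
        rwa [hn.neg_one_pow, one_mul] at this
      · have := h j hj
        rw [hn.neg_one_pow] at this; linarith
  have key : ((∀ j < k, 0 ≤ (-1) ^ j * xCoord a b j) ∧ xCoord a b k = 0) ↔
      ((∀ j < k, 0 ≤ (-1) ^ j * vseq a b (j + 1)) ∧ vseq a b (k + 1) = 0) := by
    constructor
    · rintro ⟨h1, h2⟩
      have e : ∀ j ≤ k, xCoord a b j = vseq a b (j + 1) := fun j hj => by
        rw [xCoord, iterate_eq_vseq a b j fun i hi => Or.inl (h1 i (by omega))]
      exact ⟨fun j hj => by rw [← e j hj.le]; exact h1 j hj, by rw [← e k le_rfl]; exact h2⟩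
    · rintro ⟨h1, h2⟩
      have e : ∀ j ≤ k, xCoord a b j = vseq a b (j + 1) := fun j hj => by
        rw [xCoord, iterate_eq_vseq a b j fun i hi => Or.inr (h1 i (by omega))]
      exact ⟨fun j hj => by rw [e j hj.le]; exact h1 j hj, by rw [e k le_rfl]; exact h2⟩
  unfold curveC
  simp only [Set.mem_ofPred_eq]
  rw [← key, ← sgn]
  tauto

/-- The parity of `n` as a real number. -/
noncomputable def par (n : ℕ) : ℝ := if Even n then 0 else 1

lemma par_of_even {n : ℕ} (h : Even n) : par n = 0 := by simp [par, h]

lemma par_of_odd {n : ℕ} (h : Odd n) : par n = 1 := by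
  simp [par, Nat.not_even_iff_odd.2 h]

lemma par_add_two (n : ℕ) : par (n + 2) = par n := by
  simp [par, Nat.even_add]

lemma par_nonneg (n : ℕ) : 0 ≤ par n := by unfold par; split_ifs <;> norm_num

lemma par_le_one (n : ℕ) : par n ≤ 1 := by unfold par; split_ifs <;> norm_num

lemma lob_zero (n h l : ℝ) (hx : sin h ≠ 0) :
    lob 0 n h l = cos (n * h) - rQ h l * sin (n * h) := by
  unfold lob gw cc
  rw [zero_mul, zero_mul, sub_zero, sub_zero, add_zero, div_self hx, cos_two_pi_sub,
    sin_two_pi_sub]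
  ring

lemma lob_one (n h l : ℝ) :
    lob 1 n h l = -gw 1 h l * (sin (n * h) + rQ h l * cos (n * h)) := by
  unfold lob cc
  rw [show 2 * π - 1 * (π / 2) - n * h = π / 2 - n * h + π by ring, cos_add_pi, sin_add_pi,
    cos_pi_div_two_sub, sin_pi_div_two_sub]
  ring

/-- The first coordinate of the right point of the orbit of period two. -/
noncomputable def pX (h l : ℝ) : ℝ := exp l * (sin h + sinh l) / (2 * (sin h ^ 2 + sinh l ^ 2))

lemma Dom.pX_pos {h l : ℝ} (d : Dom h l) : 0 < pX h l := by
  have := d.x0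
  have := d.p0
  unfold pX
  positivity

lemma exp_eq (l : ℝ) : exp l = cosh l + sinh l := (Real.cosh_add_sinh l).symm

lemma exp_two_neg (l : ℝ) : exp (-2 * l) = exp (-l) ^ 2 := by
  rw [← Real.exp_nat_mul]; norm_num

lemma pointZ_eq {h l : ℝ} (d : Dom h l) :
    (pointZ (2 * exp (-l) * sin h) (exp (-2 * l))).1 =
      (exp l + sin h + rC h) / (2 * (sin h + sinh l)) := by
  have e1 : √((2 * exp (-l) * sin h) ^ 2 + 4 * exp (-2 * l)) = 2 * exp (-l) * rC h := by
    rw [Real.sqrt_eq_iff_mul_self_eq_of_pos]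
    · rw [exp_two_neg]
      linear_combination (4 * exp (-l) ^ 2) * rC_sq h
    · have := one_le_rC h
      positivity
  have hp := d.p0
  have hx := d.x0
  have e2 : exp (-l) * exp l = 1 := by rw [← exp_add]; simp
  have e3 : exp (-l) = exp l - 2 * sinh l := by rw [exp_neg_eq, exp_eq]; ring
  have e0 := exp_pos (-l)
  simp only [pointZ, e1]
  have h1 : 1 + 2 * exp (-l) * sin h - exp (-2 * l) = 2 * exp (-l) * (sin h + sinh l) := by
    rw [exp_two_neg]
    linear_combination -e2 - exp (-l) * e3
  rw [h1, div_eq_div_iff (by positivity) (by positivity)]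
  linear_combination -4 * (sin h + sinh l) * e2

/-- The constants `pX` and `-gw * pX` form the orbit of period two (`f1`, `f2`). The deviation from
it is multiplied by `exp (-l)` at each step while its phase advances by `h`. The value of `rQ` is
the one that makes the formula correct at `Z`. -/
lemma vseq_eq {h l : ℝ} (d : Dom h l) (n : ℕ) :
    (Even n → vseq (2 * exp (-l) * sin h) (exp (-2 * l)) n =
      -(gw 1 h l * pX h l * (1 - exp (-l) ^ n * (cos (n * h) - rQ h l * sin (n * h))))) ∧
    (Odd n → vseq (2 * exp (-l) * sin h) (exp (-2 * l)) n =
      pX h l * (1 + gw 1 h l * exp (-l) ^ n * (sin (n * h) + rQ h l * cos (n * h)))) := by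
  have hp := d.p0
  have hx := d.x0
  have hy := d.y0
  have hW := d.W0
  have hl := d.lt
  have hC := rC_sq h
  have hr := cosh_sq_eq l
  have hD : 0 < sin h ^ 2 + sinh l ^ 2 := by positivity
  have hs : 0 < sin h + sinh l := by positivity
  have e2 : exp (-l) * exp l = 1 := by rw [← exp_add]; simp
  have e3 : exp (-l) = exp l - 2 * sinh l := by rw [exp_neg_eq, exp_eq]; ring
  have gX : gw 1 h l * pX h l = exp l * (sin h - sinh l) / (2 * (sin h ^ 2 + sinh l ^ 2)) := by
    unfold gw pX
    rw [one_mul]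
    field_simp
  have f1 : -(gw 1 h l * pX h l) = 1 - exp (-2 * l) * (gw 1 h l * pX h l) -
      2 * exp (-l) * sin h * pX h l := by
    rw [gX, exp_two_neg]
    unfold pX
    field_simp
    linear_combination ((sin h - sinh l) * exp (-l) + 2 * sin h * (sin h + sinh l)) * e2 +
      (sin h - sinh l) * e3
  have f2 : pX h l = 1 + exp (-2 * l) * pX h l -
      2 * exp (-l) * sin h * (gw 1 h l * pX h l) := by
    rw [gX, exp_two_neg]
    unfold pX
    field_simp
    linear_combination (-(sin h + sinh l) * exp (-l) + 2 * sin h * (sin h - sinh l)) * e2 -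
      (sin h + sinh l) * e3
  induction n using Nat.twoStepInduction with
  | zero => simp [vseq]
  | one =>
    refine ⟨fun h => by simp at h, fun _ => ?_⟩
    rw [vseq, pointZ_eq d, pow_one, Nat.cast_one, one_mul]
    have hN : rQ h l * cos h = rN h l := by unfold rQ; field_simp
    have hNW : rN h l * rW h l = rC h * rW h l - 2 * sinh l := by unfold rN; field_simp
    rw [hN]
    have : pX h l * (1 + gw 1 h l * exp (-l) * (sin h + rN h l)) =
        pX h l + gw 1 h l * pX h l * exp (-l) * (sin h + rN h l) := by ring
    rw [this, gX]
    unfold pX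
    field_simp
    apply mul_right_cancel₀ hW.ne'
    -- `rN` is eliminated through `hNW` while `rW` is still opaque; with `rW` unfolded, what remains
    -- follows from the Pythagorean relations and `exp l = cosh l + sinh l`.
    linear_combination (norm := skip) -(sin h ^ 2 - sinh l ^ 2) * (sin h + rN h l) * rW h l * e2 -
      (sin h ^ 2 - sinh l ^ 2) * hNW
    unfold rW
    linear_combination 2 * sinh l * (sinh l ^ 2 * hC - sin h ^ 2 * hr) -
      2 * sin h * sinh l * (sin h * cosh l + rC h * sinh l) * exp_eq l
  | more n ih1 ih2 =>
    rw [vseq_add_two]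
    have c1 : cos (((n + 2 : ℕ) : ℝ) * h) =
        cos (n * h) - 2 * sin h * sin (((n + 1 : ℕ) : ℝ) * h) := by
      push_cast
      rw [show (n + 2 : ℝ) * h = (n + 1) * h + h by ring,
        show (n : ℝ) * h = (n + 1) * h - h by ring, cos_add, cos_sub]
      ring
    have c2 : sin (((n + 2 : ℕ) : ℝ) * h) =
        sin (n * h) + 2 * sin h * cos (((n + 1 : ℕ) : ℝ) * h) := by
      push_cast
      rw [show (n + 2 : ℝ) * h = (n + 1) * h + h by ring,
        show (n : ℝ) * h = (n + 1) * h - h by ring, sin_add, sin_sub]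
      ring
    rw [c1, c2, pow_add, pow_succ]
    generalize sin (((n + 1 : ℕ) : ℝ) * h) = s1 at *
    generalize cos (((n + 1 : ℕ) : ℝ) * h) = c1 at *
    rw [exp_two_neg] at *
    constructor
    · intro hn
      have hn' : Even n := by simpa [Nat.even_add] using hn
      rw [ih1.1 hn', ih2.2 (by simpa using hn'.add_one), hn'.neg_one_pow]
      linear_combination -f1
    · intro hn
      have hn' : Odd n := by
        rw [← Nat.not_even_iff_odd] at *
        simpa [Nat.even_add] using hn
      rw [ih1.2 hn', ih2.1 (by simpa using hn'.add_one), hn'.neg_one_pow]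
      linear_combination -f2

lemma exp_neg_pow (n : ℕ) (l : ℝ) : exp (-l) ^ n = (exp (n * l))⁻¹ := by
  rw [← Real.exp_nat_mul, ← Real.exp_neg]; ring_nf

/-- The weight `gw` and the offset `cc` are arranged so that both parities give the same form: a
positive factor times exponential minus lobe. -/
lemma neg_one_pow_mul_vseq {h l : ℝ} (d : Dom h l) (j : ℕ) : ∃ K > 0,
    (-1) ^ j * vseq (2 * exp (-l) * sin h) (exp (-2 * l)) (j + 1) =
      K * (exp (((j + 1 : ℕ) : ℝ) * l) - lob (par (j + 1)) ((j + 1 : ℕ) : ℝ) h l) := by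
  have hX := d.pX_pos
  have hg := d.gw_pos zero_le_one le_rfl
  have he := exp_pos (((j + 1 : ℕ) : ℝ) * l)
  rcases Nat.even_or_odd j with hn | hn
  · refine ⟨pX h l * (exp (((j + 1 : ℕ) : ℝ) * l))⁻¹, by positivity, ?_⟩
    rw [(vseq_eq d (j + 1)).2 hn.add_one, par_of_odd hn.add_one, lob_one, hn.neg_one_pow,
      exp_neg_pow]
    field_simp
    ring
  · refine ⟨gw 1 h l * pX h l * (exp (((j + 1 : ℕ) : ℝ) * l))⁻¹, by positivity, ?_⟩
    rw [(vseq_eq d (j + 1)).1 hn.add_one, par_of_even hn.add_one, lob_zero _ _ _ d.x0.ne',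
      hn.neg_one_pow, exp_neg_pow]
    field_simp

lemma Dom.le_one_add {h l : ℝ} (d : Dom h l) : 2 * exp (-l) * sin h ≤ 1 + exp (-2 * l) := by
  have := exp_pos (-l)
  rw [exp_two_neg]
  nlinarith [d.x1, sq_nonneg (1 - exp (-l))]

lemma one_sub_lt_iff (h l : ℝ) :
    1 - exp (-2 * l) < 2 * exp (-l) * sin h ↔ sinh l < sin h := by
  have e2 : exp (-l) * exp l = 1 := by rw [← exp_add]; simp
  have e3 : exp (-l) = exp l - 2 * sinh l := by rw [exp_neg_eq, exp_eq]; ring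
  have : 1 - exp (-2 * l) = 2 * exp (-l) * sinh l := by
    rw [exp_two_neg]
    linear_combination -e2 - exp (-l) * e3
  rw [this]
  have := exp_pos (-l)
  exact mul_lt_mul_iff_right₀ (by positivity)

lemma mem_curveC_iff {h l : ℝ} (d : Dom h l) (k : ℕ) :
    (2 * exp (-l) * sin h, exp (-2 * l)) ∈ curveC k ↔
      (∀ m : ℕ, 1 ≤ m → m ≤ k → lob (par m) m h l ≤ exp (m * l)) ∧
        lob (par (k + 1)) ((k + 1 : ℕ) : ℝ) h l = exp (((k + 1 : ℕ) : ℝ) * l) := by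
  rw [mem_curveC_iff_vseq]
  have hb1 : exp (-2 * l) ≤ 1 := by rw [Real.exp_le_one_iff]; linarith [d.l0]
  simp only [(exp_pos _).le, hb1, (one_sub_lt_iff h l).2 d.lt, d.le_one_add, true_and]
  refine and_congr ⟨fun H m h1 h2 => ?_, fun H j hj => ?_⟩ ?_
  · obtain ⟨j, rfl⟩ : ∃ j, m = j + 1 := ⟨m - 1, by omega⟩
    obtain ⟨K, hK, e⟩ := neg_one_pow_mul_vseq d j
    have := H j (by omega)
    rw [e, mul_nonneg_iff_of_pos_left hK] at this
    linarith
  · obtain ⟨K, hK, e⟩ := neg_one_pow_mul_vseq d j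
    rw [e, mul_nonneg_iff_of_pos_left hK]
    linarith [H (j + 1) (by omega) (by omega)]
  · obtain ⟨K, hK, e⟩ := neg_one_pow_mul_vseq d k
    have h1 : ((-1 : ℝ)) ^ k ≠ 0 := pow_ne_zero _ (by norm_num)
    constructor
    · intro H
      rw [H, mul_zero] at e
      rcases mul_eq_zero.1 e.symm with h2 | h2
      · exact absurd h2 hK.ne'
      · linarith
    · intro H
      rw [H, sub_self, mul_zero] at e
      exact (mul_eq_zero.1 e).resolve_left h1

/-! ### Excluding the parameters with `4b ≤ a^2`. -/

/-- Two applications of the two-step recurrence with the middle term `n + 4` eliminated. When `a^2 -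
2b` lies in `[b, 1)`, the coefficients of the remaining two terms are nonnegative, so signs can be
compared. -/
lemma vseq_add_six (a b : ℝ) (n : ℕ) :
    vseq a b (n + 6) = (a ^ 2 - 2 * b) * b ^ 2 * vseq a b n +
      ((a ^ 2 - 2 * b) ^ 2 - b ^ 2) * vseq a b (n + 2) +
      (1 - (a ^ 2 - 2 * b)) * (1 - b - (-1) ^ n * a) := by
  have h2 := vseq_add_two a b n
  have h3 := vseq_add_two a b (n + 1)
  have h4 := vseq_add_two a b (n + 2)
  have h5 := vseq_add_two a b (n + 3)
  have h6 := vseq_add_two a b (n + 4)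
  simp only [pow_add, add_assoc, Nat.reduceAdd] at *
  rw [h6, h5, h4, h3, h2]
  rcases neg_one_pow_eq_or ℝ n with h | h <;> rw [h] <;> ring

/-- Here `a (L - 1) ≤ b (1 + L)` and the cubic's other factor is at most `1 - 2b`. Then `b (1 - 2b)
≤ 1/8`, together with `L < 2` and `m < 1/2`, leaves room. -/
lemma hyperbolic_bound {a b L m : ℝ} (ea : a = L - m) (eb : b = L * m) (h2 : a ≤ 1 + b)
    (hab : 4 * b ≤ a ^ 2) (hr : a ^ 2 - 2 * b < 1) (hL1 : 1 < L) (hm0 : 0 ≤ m)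
    (c4 : 0 ≤ 1 + 4 * L * m - L ^ 2 - 2 * m ^ 2) :
    a * ((L - 1) * (1 + 4 * L * m - L ^ 2 - 2 * m ^ 2)) < 1 - m := by
  have hL0 : 0 < L := by linarith
  have hLa : a ≤ L := by linarith
  have hb0 : 0 ≤ b := by rw [eb]; positivity
  have c1 : 1 + 4 * L * m - L ^ 2 - 2 * m ^ 2 ≤ 1 - 2 * b := by
    have : 1 + 4 * L * m - L ^ 2 - 2 * m ^ 2 = 1 - (a ^ 2 - 2 * b) - m ^ 2 := by
      rw [ea, eb]; ring
    rw [this]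
    linarith [sq_nonneg m]
  have c2 : a * (L - 1) ≤ b * (1 + L) := by
    have : L - 1 ≤ m * (1 + L) := by rw [ea, eb] at h2; linarith
    calc a * (L - 1) ≤ L * (m * (1 + L)) := mul_le_mul hLa this (by linarith) hL0.le
      _ = b * (1 + L) := by rw [eb]; ring
  have hb2 : b < 1 / 2 := by linarith
  have hL2 : L < 2 := by
    by_contra hc
    push Not at hc
    have : a < 3 / 2 := by nlinarith
    nlinarith
  have hm2 : m < 1 / 2 := by
    rw [eb] at hb2
    by_contra hc
    push Not at hc
    nlinarith
  calc a * ((L - 1) * (1 + 4 * L * m - L ^ 2 - 2 * m ^ 2))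
      = a * (L - 1) * (1 + 4 * L * m - L ^ 2 - 2 * m ^ 2) := by ring
    _ ≤ b * (1 + L) * (1 - 2 * b) :=
        mul_le_mul c2 c1 c4 (mul_nonneg hb0 (by linarith))
    _ = b * (1 - 2 * b) * (1 + L) := by ring
    _ ≤ 1 / 8 * (1 + L) := by
        apply mul_le_mul_of_nonneg_right _ (by linarith)
        linarith [sq_nonneg (b - 1 / 4)]
    _ < 1 - m := by linarith

set_option maxHeartbeats 400000 in
-- The sign condition at time 3 gives `a^2 - 2b < 1`. Then all three contributions in `vseq_add_six`
-- have the same sign, the constant one strictly, so the orbit cannot reach the axis at time `k ≥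
-- 5`; time 4 is treated directly.
lemma not_mem_curveC_of_le {a b : ℝ} {k : ℕ} (hk : 4 ≤ k) (hab : 4 * b ≤ a ^ 2) :
    (a, b) ∉ curveC k := by
  rw [mem_curveC_iff_vseq]
  rintro ⟨hb0, hb1, h1, h2, hs, hv⟩
  have ha : 0 < a := by linarith
  have z1 : vseq a b 1 = (2 + a + √(a ^ 2 + 4 * b)) / (2 * (1 + a - b)) := rfl
  have z0 : vseq a b 0 = 0 := rfl
  have z2 := vseq_add_two a b 0
  have z3 := vseq_add_two a b 1
  have z4 := vseq_add_two a b 2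
  have z5 := vseq_add_two a b 3
  have s3 := hs 3 (by omega)
  have s2 := hs 2 (by omega)
  norm_num at z2 z3 z4 z5 s3 s2
  -- `L` is the positive root of `L^2 - a L - b` and `m = b / L`; in these terms the first
  -- coordinate of `Z` is `1 / (1 - m)`.
  obtain ⟨L, hL⟩ : ∃ L, L = (a + √(a ^ 2 + 4 * b)) / 2 := ⟨_, rfl⟩
  have hsq : √(a ^ 2 + 4 * b) ^ 2 = a ^ 2 + 4 * b := Real.sq_sqrt (by positivity)
  have hsq0 := Real.sqrt_nonneg (a ^ 2 + 4 * b)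
  have hLb : L * (L - a) = b := by rw [hL]; nlinarith
  obtain ⟨m, hm⟩ : ∃ m, m = L - a := ⟨_, rfl⟩
  have hLa : a ≤ L := by
    rw [hL]
    have : a ≤ √(a ^ 2 + 4 * b) := Real.le_sqrt_of_sq_le (by linarith)
    linarith
  have hL0 : 0 < L := ha.trans_le hLa
  have hm0 : 0 ≤ m := by linarith
  have ea : a = L - m := by linarith
  have eb : b = L * m := by rw [hm]; exact hLb.symm
  have hL1 : 1 < L := by
    rw [ea, eb] at h1
    nlinarith
  have hm1 : m < 1 := by
    rw [eb] at hb1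
    by_contra hc
    push Not at hc
    nlinarith
  have hz : vseq a b 1 * (1 - m) = 1 := by
    rw [z1, div_mul_eq_mul_div, div_eq_one_iff_eq (by linarith)]
    have : √(a ^ 2 + 4 * b) = 2 * L - a := by rw [hL]; ring
    rw [this, eb, ea]; ring
  have s4 : vseq a b 4 * (1 - m) = -((L - 1) * (1 + 4 * L * m - L ^ 2 - 2 * m ^ 2)) := by
    rw [z4, z3, z2, z0, ← sub_eq_zero, ea, eb]
    rw [ea, eb] at hz
    linear_combination (L - m) * ((L - m) ^ 2 - 2 * (L * m)) * hz
  have c4 : 0 ≤ 1 + 4 * L * m - L ^ 2 - 2 * m ^ 2 := by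
    by_contra hc
    push Not at hc
    have h4 : vseq a b 4 * (1 - m) ≤ 0 := mul_nonpos_of_nonpos_of_nonneg s3 (by linarith)
    have h5 := mul_pos_of_neg_of_neg (by linarith : 1 - L < 0) hc
    linarith
  have hr : a ^ 2 - 2 * b < 1 := by
    have : 0 ≤ 1 - (a ^ 2 - 2 * b) - m ^ 2 := by rw [ea, eb]; linarith
    rcases hm0.eq_or_lt with h0 | h0
    · rw [← h0, mul_zero] at eb
      linarith
    · have := pow_pos h0 2
      linarith
  have p5 : 0 < vseq a b 5 := by
    have e5 : vseq a b 5 * (1 - m) = 1 - m + b * vseq a b 3 * (1 - m) -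
        a * ((L - 1) * (1 + 4 * L * m - L ^ 2 - 2 * m ^ 2)) := by
      rw [z5]
      linear_combination a * s4
    have h3 : 0 ≤ b * vseq a b 3 * (1 - m) :=
      mul_nonneg (mul_nonneg hb0 s2) (by linarith)
    have : a * ((L - 1) * (1 + 4 * L * m - L ^ 2 - 2 * m ^ 2)) < 1 - m := by
      exact hyperbolic_bound ea eb h2 hab hr hL1 hm0 c4
    have : 0 < vseq a b 5 * (1 - m) := by linarith
    exact pos_of_mul_pos_left this (by linarith)
  rcases hk.eq_or_lt with rfl | hk
  · exact p5.ne' hv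
  obtain ⟨n, rfl⟩ : ∃ n, k = n + 5 := ⟨k - 5, by omega⟩
  have hnn : ∀ j ≤ n + 5, 0 ≤ -((-1) ^ j * vseq a b j) := by
    rintro (_ | j) hj
    · rw [z0]; simp
    · have := hs j (by omega)
      rw [pow_succ]; linarith
  have e0 := hnn n (by omega)
  have e2 := hnn (n + 2) (by omega)
  have e6 := vseq_add_six a b n
  rw [show n + 6 = n + 5 + 1 by ring, hv] at e6
  have e1 : ((-1 : ℝ) ^ n) ^ 2 = 1 := by rw [← pow_mul, mul_comm, pow_mul]; norm_num
  -- From here on only signs matter: `p1`, `p2`, `p3` are the coefficient signs in the six-step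
  -- recurrence.
  rw [pow_add] at e2
  norm_num at e2
  have p1 : 0 ≤ (a ^ 2 - 2 * b) * b ^ 2 := mul_nonneg (by linarith) (sq_nonneg _)
  have p2 : 0 ≤ (a ^ 2 - 2 * b) ^ 2 - b ^ 2 := by
    rw [sq_sub_sq]
    exact mul_nonneg (by linarith) (by linarith)
  have p3 : 0 < (1 - (a ^ 2 - 2 * b)) * (a - (-1) ^ n * (1 - b)) := by
    refine mul_pos (by linarith) ?_
    rcases neg_one_pow_eq_or ℝ n with h | h <;> rw [h] <;> linarith
  have q1 := mul_nonneg p1 e0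
  have q2 := mul_nonneg p2 (by linarith : 0 ≤ -((-1) ^ n * vseq a b (n + 2)))
  have := congrArg (fun t => -(-1) ^ n * t) e6
  generalize a ^ 2 - 2 * b = r at *
  have e7 : (-1) ^ n * ((1 - r) * (1 - b - (-1) ^ n * a)) =
      -((1 - r) * (a - (-1) ^ n * (1 - b))) := by linear_combination -(1 - r) * a * e1
  linarith

/-- Every point of `curveC k` is described by the angle `h` and the contraction rate `l`. -/
lemma exists_of_mem_curveC {a b : ℝ} {k : ℕ} (hk : 4 ≤ k) (hab : (a, b) ∈ curveC k) :
    ∃ h l, Dom h l ∧ a = 2 * exp (-l) * sin h ∧ b = exp (-2 * l) := by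
  have h4 : a ^ 2 < 4 * b := by
    by_contra hc
    exact not_mem_curveC_of_le hk (not_lt.1 hc) hab
  obtain ⟨hb0, hb1, h1, h2, -⟩ := (mem_curveC_iff_vseq a b k).1 hab
  have hb : 0 < b := by nlinarith [sq_nonneg a]
  have hs := Real.sqrt_pos.2 hb
  have hss := Real.sq_sqrt hb0
  have ha : 0 < a := by linarith
  have e1 : exp (-(-(log b / 2))) = √b := by
    rw [Real.sqrt_eq_rpow, Real.rpow_def_of_pos hb]; ring_nf
  have e2 : exp (-2 * -(log b / 2)) = b := by
    rw [show -2 * -(log b / 2) = log b by ring, exp_log hb]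
  have a1 : a / (2 * √b) < 1 := by
    rw [div_lt_one (by positivity)]
    nlinarith
  have a0 : 0 < a / (2 * √b) := by positivity
  have e3 : sin (arcsin (a / (2 * √b))) = a / (2 * √b) := sin_arcsin (by linarith) a1.le
  have e4 : a = 2 * exp (-(-(log b / 2))) * sin (arcsin (a / (2 * √b))) := by
    rw [e1, e3]; field_simp
  refine ⟨arcsin (a / (2 * √b)), -(log b / 2), ⟨?_, arcsin_pos.2 a0, arcsin_lt_pi_div_two.2 a1, ?_⟩,
    e4, e2.symm⟩
  · linarith [Real.log_nonpos hb0 hb1]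
  · rw [← one_sub_lt_iff, ← e4, e2]; exact h1

/-! ### The orbit makes less than one full turn. -/

lemma sin_two_mul_pos {h : ℝ} (h0 : 0 < h) (h1 : h < π / 2) : 0 < sin (2 * h) :=
  sin_pos_of_pos_of_lt_pi (by linarith) (by linarith)

/-- For fixed parameters a lobe is a sinusoid in the time, so its value after a rotation is a
combination of two values two steps apart; whole turns drop out. -/
lemma lob_add_rotation (t n N h l : ℝ) :
    lob t (n + 2 * N) h l * sin (2 * h) =
      lob t n h l * sin (2 * h - (2 * N * h - 2 * π)) +
        lob t (n + 2) h l * sin (2 * N * h - 2 * π) := by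
  unfold lob
  have e1 : cc t - (n + 2 * N) * h = (cc t - n * h) - (2 * N * h - 2 * π) - 2 * π := by ring
  have e2 : cc t - (n + 2) * h = (cc t - n * h) - 2 * h := by ring
  rw [e1, e2, cos_sub_two_pi, sin_sub_two_pi]
  generalize cc t - n * h = u
  generalize 2 * N * h - 2 * π = α
  rw [cos_sub, sin_sub, sin_sub (2 * h), cos_sub, sin_sub]
  generalize 2 * h = v
  ring

/-- With a nonpositive sine the phase term only lowers the value, which is then at most `gw ≤ 1`,
below the exponential. -/
lemma lob_lt_of_nonpos {h l t n : ℝ} (d : Dom h l) (ht : 0 ≤ t) (ht1 : t ≤ 1) (hn : 0 < n * l)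
    (hs : sin (cc t - n * h) ≤ 0) : lob t n h l < exp (n * l) := by
  have h1 := d.gw_le_one ht
  have h0 := d.gw_pos ht ht1
  have h2 : cos (cc t - n * h) + rQ h l * sin (cc t - n * h) ≤ 1 := by
    have := cos_le_one (cc t - n * h)
    have := mul_nonpos_of_nonneg_of_nonpos d.Q0.le hs
    linarith
  have h3 : 1 < exp (n * l) := Real.one_lt_exp_iff.2 hn
  unfold lob
  nlinarith

/-- If the points `Z^j` alternate between the half-planes for `j < k` and `Z^k` lies on the
`y`-axis, then the orbit has not yet made a full turn around the orbit of period two. -/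
lemma first_lobe {h l : ℝ} (d : Dom h l) (hl : 0 < l) {n : ℕ} (hn : 1 ≤ n)
    (H : ∀ m : ℕ, m < n → lob (par m) m h l ≤ exp (m * l))
    (hz : lob (par n) n h l = exp (n * l)) : n * h < cc (par n) := by
  have h0 := d.h0
  have hh := d.h1
  have hs2 := sin_two_mul_pos h0 hh
  -- `2N` is the least even time at which `n h` reaches `2π`; the overshoot `2 N h - 2π` is in `[0,
  -- 2h)`.
  obtain ⟨N, hN⟩ : ∃ N, N = ⌈π / h⌉₊ := ⟨_, rfl⟩
  have hN1 : π ≤ N * h := by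
    rw [← div_le_iff₀ h0, hN]; exact Nat.le_ceil _
  have hN2 : (N - 1) * h < π := by
    rw [← lt_div_iff₀ h0, sub_lt_iff_lt_add, hN]
    exact Nat.ceil_lt_add_one (by positivity)
  have hN3 : 2 < N := by
    have : (2 : ℝ) < N := by
      by_contra hc
      push Not at hc
      nlinarith
    exact_mod_cast this
  by_cases hnN : n < 2 * N
  · rcases Nat.even_or_odd n with he | he
    · have h2 : n ≤ 2 * N - 2 := by
        obtain ⟨j, rfl⟩ := he; omega
      have h3 : (n : ℝ) ≤ 2 * N - 2 := by
        have : n + 2 ≤ 2 * N := by omega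
        have : ((n + 2 : ℕ) : ℝ) ≤ (2 * N : ℕ) := by exact_mod_cast this
        push_cast at this
        linarith
      rw [par_of_even he, cc]
      nlinarith
    · by_contra hc
      push Not at hc
      refine (lob_lt_of_nonpos d (par_nonneg n) (par_le_one n) ?_ ?_).ne hz
      · have : (0 : ℝ) < n := by exact_mod_cast hn
        positivity
      · have h3 : (n : ℝ) ≤ 2 * N - 1 := by
          have : n + 1 ≤ 2 * N := by omega
          have : ((n + 1 : ℕ) : ℝ) ≤ (2 * N : ℕ) := by exact_mod_cast this
          push_cast at this
          linarith
        rw [par_of_odd he, cc] at *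
        apply sin_nonpos_of_nonpos_of_neg_pi_le
        · linarith
        · nlinarith
  · exfalso
    push Not at hnN
    obtain ⟨m, rfl⟩ : ∃ m, n = m + 2 * N := ⟨n - 2 * N, by omega⟩
    obtain ⟨M, rfl⟩ : ∃ M, N = M + 1 := ⟨N - 1, by omega⟩
    push_cast at hN1 hN2 hz
    have hpar : par (m + 2 * (M + 1)) = par m := by simp [par, Nat.even_add]
    have hα0 : 0 ≤ 2 * (M + 1) * h - 2 * π := by linarith
    have hα1 : 0 < 2 * h - (2 * (M + 1) * h - 2 * π) := by linarith
    have hsα : 0 ≤ sin (2 * (M + 1) * h - 2 * π) :=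
      sin_nonneg_of_nonneg_of_le_pi hα0 (by linarith)
    have hsα' : 0 < sin (2 * h - (2 * (M + 1) * h - 2 * π)) :=
      sin_pos_of_pos_of_lt_pi hα1 (by linarith)
    -- Since the overshoot is less than `2h`, both coefficients are nonnegative, and the sign
    -- conditions at `m` and `m + 2` bound the lobe at `n` from above. The condition at time `2M =
    -- 2N - 2`, the last even time before the turn closes, then contradicts `phi_lt_Q`.
    have r := lob_add_rotation (par m) m (M + 1) h l
    have a1 := H m (by omega)
    have a2 := H (m + 2) (by omega)
    rw [par_add_two] at a2
    push_cast at a2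
    rw [hpar] at hz
    rw [hz] at r
    have a3 : exp ((m + 2 * (M + 1)) * l) * sin (2 * h) ≤
        exp (m * l) * sin (2 * h - (2 * (M + 1) * h - 2 * π)) +
          exp ((m + 2) * l) * sin (2 * (M + 1) * h - 2 * π) := by
      rw [r]
      exact add_le_add (mul_le_mul_of_nonneg_right a1 hsα'.le)
        (mul_le_mul_of_nonneg_right a2 hsα)
    have a4 := H (2 * M) (by omega)
    rw [par_of_even (even_two_mul M), lob_zero _ _ _ d.x0.ne'] at a4
    push_cast at a4
    have e1 : exp ((m + 2 * (M + 1)) * l) = exp ((m + 2) * l) * exp (2 * M * l) := by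
      rw [← exp_add]; ring_nf
    have e2 : exp (m * l) = exp ((m + 2) * l) * exp (-2 * l) := by
      rw [← exp_add]; ring_nf
    rw [e1, e2, mul_assoc, mul_assoc (exp ((m + 2) * l)) (exp (-2 * l)), ← mul_add, mul_le_mul_iff_right₀ (exp_pos _)] at a3
    have hφ := d.phi_lt_Q
    obtain ⟨γ, hγ⟩ : ∃ γ, γ = 2 * h - (2 * (M + 1) * h - 2 * π) := ⟨_, rfl⟩
    have e3 : 2 * (M : ℝ) * h = 2 * π - γ := by rw [hγ]; ring
    have e4 : 2 * ((M : ℝ) + 1) * h - 2 * π = 2 * h - γ := by rw [hγ]; ring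
    rw [← hγ] at hsα'
    rw [← hγ, e4, sin_sub (2 * h)] at a3
    rw [e3, cos_two_pi_sub, sin_two_pi_sub] at a4
    nlinarith

/-! ### Phase and amplitude of a lobe. -/

/-- The phase of a lobe. -/
noncomputable def th (h l : ℝ) : ℝ := arctan (rQ h l)

/-- The distance of the argument `cc t - n * h` of a lobe from its top. -/
noncomputable def be (t n h l : ℝ) : ℝ := cc t - n * h - th h l

/-- The amplitude of a lobe. -/
noncomputable def rR (h l : ℝ) : ℝ := √(1 + rQ h l ^ 2)

lemma rR_pos (h l : ℝ) : 0 < rR h l := Real.sqrt_pos.2 (by positivity)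

lemma rR_sq (h l : ℝ) : rR h l ^ 2 = 1 + rQ h l ^ 2 := Real.sq_sqrt (by positivity)

lemma cos_th (h l : ℝ) : rR h l * cos (th h l) = 1 := by
  rw [th, cos_arctan, ← rR]
  field_simp [(rR_pos h l).ne']

lemma sin_th (h l : ℝ) : rR h l * sin (th h l) = rQ h l := by
  rw [th, sin_arctan, ← rR]
  field_simp [(rR_pos h l).ne']

lemma rR_mul_cos_sub_th (h l u : ℝ) : rR h l * cos (u - th h l) = cos u + rQ h l * sin u := by
  rw [cos_sub, mul_add]
  linear_combination cos u * cos_th h l + sin u * sin_th h l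

lemma lob_eq (t n h l : ℝ) : lob t n h l = gw t h l * rR h l * cos (be t n h l) := by
  rw [be, mul_assoc, rR_mul_cos_sub_th, lob]

lemma be_sub_two (t n h l : ℝ) : be t (n - 2) h l = be t n h l + 2 * h := by unfold be; ring

lemma lob_sub_two (t n h l : ℝ) :
    lob t (n - 2) h l = gw t h l * rR h l * cos (be t n h l + 2 * h) := by
  rw [lob_eq, be_sub_two]

lemma th_lt (h l : ℝ) : th h l < π / 2 := arctan_lt_pi_div_two _

namespace Dom

variable {h l t n : ℝ}

lemma th_pos (d : Dom h l) : 0 < th h l := arctan_pos.2 d.Q0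

lemma th_le (d : Dom h l) {h' : ℝ} (hh : h ≤ h') (h1 : h' < π / 2) : th h l ≤ th h' l :=
  arctan_strictMono.monotone (d.rQ_le hh h1)

lemma th_mono (d : Dom h l) {h' : ℝ} (hh : h < h') (h1 : h' < π / 2) : th h l < th h' l :=
  arctan_strictMono (d.rQ_lt hh h1)

lemma rR_lt (d : Dom h l) {h' : ℝ} (hh : h < h') (h1 : h' < π / 2) : rR h l < rR h' l := by
  have := d.rQ_lt hh h1
  have := d.Q0
  unfold rR
  exact Real.sqrt_lt_sqrt (by positivity) (by nlinarith)

lemma be_lt (d : Dom h l) (hn : 0 ≤ n) {h' : ℝ} (hh : h < h') (h1 : h' < π / 2) :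
    be t n h' l < be t n h l := by
  have := d.th_mono hh h1
  unfold be
  nlinarith

lemma gR_pos (d : Dom h l) (ht : 0 ≤ t) (ht1 : t ≤ 1) : 0 < gw t h l * rR h l :=
  mul_pos (d.gw_pos ht ht1) (rR_pos h l)

lemma gR_lt (d : Dom h l) (ht : 0 ≤ t) (ht1 : t ≤ 1) {h' : ℝ} (hh : h < h') (h1 : h' < π / 2) :
    gw t h l * rR h l < gw t h' l * rR h' l :=
  mul_lt_mul' (d.gw_le_gw ht hh.le h1) (d.rR_lt hh h1) (rR_pos h l).le
    ((d.mono hh.le h1).gw_pos ht ht1)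

end Dom

lemma sin_nonpos_of_mem {u : ℝ} (h1 : π ≤ u) (h2 : u ≤ 2 * π) : sin u ≤ 0 := by
  have := sin_nonneg_of_nonneg_of_le_pi (x := u - π) (by linarith) (by linarith)
  rw [sin_sub_pi] at this
  linarith

lemma cc_le {t : ℝ} (ht : 0 ≤ t) : cc t ≤ 2 * π := by
  unfold cc
  have := mul_nonneg ht (pi_pos.le)
  linarith

/-- A lobe increases as long as its argument has not reached its top. -/
lemma lob_lt_lob {t n h h' l : ℝ} (d : Dom h l) (ht : 0 ≤ t) (ht1 : t ≤ 1) (hn : 0 ≤ n)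
    (hh : h < h') (h1 : h' < π / 2) (hu : cc t - n * h < π) (hb : 0 ≤ be t n h' l)
    (hp : 0 < lob t n h' l) : lob t n h l < lob t n h' l := by
  have d' := d.mono hh.le h1
  have hlt := d.be_lt (t := t) hn hh h1
  have h3 := d.gR_lt ht ht1 hh h1
  have h4 := d.gR_pos ht ht1
  rw [lob_eq] at hp
  rw [lob_eq, lob_eq]
  have hc' : 0 < cos (be t n h' l) := pos_of_mul_pos_right hp (d'.gR_pos ht ht1).le
  have hle : cos (be t n h l) ≤ cos (be t n h' l) := by
    apply cos_le_cos_of_nonneg_of_le_pi hb _ hlt.le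
    have := d.th_pos
    unfold be; linarith
  calc gw t h l * rR h l * cos (be t n h l) ≤ gw t h l * rR h l * cos (be t n h' l) :=
        mul_le_mul_of_nonneg_left hle h4.le
    _ < _ := mul_lt_mul_of_pos_right h3 hc'

/-- If the bound holds at an angle not beyond the crest, it holds strictly at all smaller angles:
within the half turn the lobe is smaller there or not positive, and outside it the sine is
nonpositive. -/
lemma lob_lt_exp_of_lt {t n h h' l : ℝ} (d : Dom h l) (hl : 0 < l) (ht : 0 ≤ t) (ht1 : t ≤ 1)
    (hn : 0 < n) (hh : h < h') (h1 : h' < π / 2) (hb : 0 ≤ be t n h' l)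
    (hp : lob t n h' l ≤ exp (n * l)) : lob t n h l < exp (n * l) := by
  have hu2 : cc t - n * h ≤ 2 * π := by
    have := mul_pos hn d.h0
    have := cc_le ht
    linarith
  by_cases hu : cc t - n * h < π
  · by_cases hp0 : 0 < lob t n h' l
    · exact (lob_lt_lob d ht ht1 hn.le hh h1 hu hb hp0).trans_le hp
    · by_contra hc
      push Not at hc
      have d' := d.mono hh.le h1
      have hpos : 0 < lob t n h l := (exp_pos _).trans_le hc
      rw [lob_eq] at hpos hp0
      have hc1 : 0 < cos (be t n h l) := pos_of_mul_pos_right hpos (d.gR_pos ht ht1).le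
      have hc2 : cos (be t n h' l) ≤ 0 := by
        by_contra hc3
        push Not at hc3
        exact hp0 (mul_pos (d'.gR_pos ht ht1) hc3)
      have hlt := d.be_lt (t := t) hn.le hh h1
      have : cos (be t n h l) ≤ cos (be t n h' l) := by
        apply cos_le_cos_of_nonneg_of_le_pi hb _ hlt.le
        have := d.th_pos
        unfold be; linarith
      linarith
  · exact lob_lt_of_nonpos d ht ht1 (by positivity) (sin_nonpos_of_mem (not_lt.1 hu) hu2)

/-- The admissible pairs of a weight and a time. -/
def Adm (t n : ℝ) : Prop := (t = 0 ∧ 6 ≤ n) ∨ (t = 1 ∧ 5 ≤ n)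

namespace Adm

variable {t n : ℝ}

lemma t0 (a : Adm t n) : 0 ≤ t := by rcases a with ⟨rfl, _⟩ | ⟨rfl, _⟩ <;> norm_num

lemma t1 (a : Adm t n) : t ≤ 1 := by rcases a with ⟨rfl, _⟩ | ⟨rfl, _⟩ <;> norm_num

lemma five_le (a : Adm t n) : 5 ≤ n := by rcases a with ⟨_, h⟩ | ⟨_, h⟩ <;> linarith

lemma n0 (a : Adm t n) : 0 < n := by linarith [a.five_le]

lemma le_cc (a : Adm t n) : 3 * π / 2 ≤ cc t := by
  have := mul_le_mul_of_nonneg_right a.t1 pi_pos.le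
  unfold cc; linarith

/-- This is where the thresholds 6 and 5 of `Adm` enter: angles in the first lobe stay below `π /
3`, so `cos h > 1/2`. -/
lemma cc_le_mul (a : Adm t n) : cc t ≤ n * (π / 3) := by
  have := pi_pos
  rcases a with ⟨rfl, h⟩ | ⟨rfl, h⟩ <;> unfold cc <;> nlinarith

lemma h_lt (a : Adm t n) {h : ℝ} (hh : n * h < cc t) : h < π / 3 := by
  have := a.cc_le_mul
  have := a.n0
  by_contra hc
  push Not at hc
  nlinarith

end Adm

lemma half_lt_cos {h : ℝ} (h0 : 0 ≤ h) (h1 : h < π / 3) : 1 / 2 < cos h := by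
  rw [← cos_pi_div_three]
  exact cos_lt_cos_of_nonneg_of_le_pi h0 (by linarith [pi_pos]) h1

lemma sin_pos_of_exp_le_lob {t n h l : ℝ} (d : Dom h l) (hl : 0 < l) (a : Adm t n)
    (he : exp (n * l) ≤ lob t n h l) : 0 < sin (cc t - n * h) := by
  by_contra hc
  push Not at hc
  have := a.n0
  exact (lob_lt_of_nonpos d a.t0 a.t1 (by positivity) hc).not_ge he

lemma arg_lt_pi {t n h l : ℝ} (d : Dom h l) (hl : 0 < l) (a : Adm t n)
    (he : exp (n * l) ≤ lob t n h l) : cc t - n * h < π := by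
  by_contra hc
  push Not at hc
  have h1 := sin_pos_of_exp_le_lob d hl a he
  have := mul_pos a.n0 d.h0
  exact (sin_nonpos_of_mem hc (by linarith [cc_le a.t0])).not_gt h1

lemma sinh_le_of_le {l : ℝ} (h0 : 0 ≤ l) (h1 : l ≤ 1 / 3) : sinh l ≤ 5 / 4 * l := by
  have e1 := Real.add_one_le_exp (-l)
  have e2 : exp l ≤ 1 / (1 - l) := by
    rw [le_div_iff₀ (by linarith)]
    have : exp l * exp (-l) = 1 := by rw [← exp_add]; simp
    nlinarith [exp_pos l]
  have e3 : 1 / (1 - l) ≤ 1 - l + 5 / 2 * l := by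
    rw [div_le_iff₀ (by linarith)]; nlinarith
  rw [Real.sinh_eq]
  linarith

/-- A large value of a lobe forces the contraction to be weak. -/
lemma two_mul_sinh_lt {t n h l : ℝ} (d : Dom h l) (a : Adm t n) (hh : n * h < cc t)
    (he : exp (n * l) ≤ lob t n h l) : 2 * sinh l < sin h := by
  rcases d.l0.eq_or_lt with rfl | hl
  · simpa using d.x0
  by_contra hc
  push Not at hc
  have hx := d.x0
  have hy := half_lt_cos d.h0.le (a.h_lt hh)
  -- For `sin h / 2 ≤ sinh l < sin h` the ratio in `S_sq` is at most `10/9`, and `cos h > 1/2`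
  -- contributes the factor 4. Hence `rR < 2.12`, which the even case contradicts by `exp (4/5) ≥
  -- 2.12` and the odd case by `gw ≤ 1/3`.
  have hR : rR h l ^ 2 < 40 / 9 := by
    have e := d.S_sq
    have hW := d.W0
    have h1 := d.le_W
    have h2 : 2 * (sin h ^ 2 + sinh l ^ 2) / rW h l ^ 2 ≤ 10 / 9 := by
      rw [div_le_iff₀ (by positivity)]
      have : (sin h + sinh l) ^ 2 ≤ rW h l ^ 2 := by
        apply pow_le_pow_left₀ (by linarith [d.p0]) h1
      nlinarith [d.lt]
    rw [← e, ← rR_sq] at h2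
    nlinarith [rR_pos h l, sq_pos_of_pos (rR_pos h l)]
  have hR' : rR h l < 212 / 100 := by nlinarith [rR_pos h l]
  have hlob : lob t n h l ≤ gw t h l * rR h l := by
    rw [lob_eq]
    have := d.gR_pos a.t0 a.t1
    nlinarith [cos_le_one (be t n h l)]
  have hnl : 0 < n * l := mul_pos a.n0 hl
  have hh3 := a.h_lt hh
  rcases a with ⟨rfl, hn⟩ | ⟨rfl, hn⟩
  · have hu := arg_lt_pi d hl (Or.inl ⟨rfl, hn⟩) he
    have hnh : π < n * h := by unfold cc at hu; linarith
    have h1 : 2 / π * h ≤ sin h := mul_le_sin d.h0.le d.h1.le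
    have hg := d.gw_le_one le_rfl
    have h8 : 4 / 5 ≤ n * l := by
      have hl2 : 4 / 5 * h ≤ π * l := by
        rcases le_total l (1 / 3) with h3 | h3
        · have h5 := sinh_le_of_le hl.le h3
          rw [div_mul_eq_mul_div, div_le_iff₀ pi_pos] at h1
          nlinarith [pi_pos]
        · nlinarith [pi_pos]
      have : π * (4 / 5) ≤ π * (n * l) := by nlinarith
      exact le_of_mul_le_mul_left this pi_pos
    have h9 : 212 / 100 ≤ exp (n * l) := by
      have := Real.quadratic_le_exp_of_nonneg hnl.le
      nlinarith
    have := rR_pos h l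
    nlinarith
  · have hg : gw 1 h l ≤ 1 / 3 := by
      unfold gw
      have := d.p0
      rw [one_mul, div_le_iff₀ (by linarith)]
      linarith
    have := Real.one_lt_exp_iff.2 hnl
    have := rR_pos h l
    nlinarith

lemma cos_be_pos {t n h l : ℝ} (d : Dom h l) (a : Adm t n)
    (he : exp (n * l) ≤ lob t n h l) : 0 < cos (be t n h l) := by
  have := (exp_pos _).trans_le he
  rw [lob_eq] at this
  exact pos_of_mul_pos_right this (d.gR_pos a.t0 a.t1).le

lemma be_lt_pi_div_two {t n h l : ℝ} (d : Dom h l) (hl : 0 < l) (a : Adm t n)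
    (he : exp (n * l) ≤ lob t n h l) : be t n h l < π / 2 := by
  have h1 := cos_be_pos d a he
  have h2 := arg_lt_pi d hl a he
  by_contra hc
  push Not at hc
  have : cos (be t n h l) ≤ 0 := cos_nonpos_of_pi_div_two_le_of_le hc (by
    have := d.th_pos
    unfold be; linarith [pi_pos])
  linarith

lemma neg_pi_div_two_lt_be {t n h l : ℝ} (hh : n * h < cc t) : -(π / 2) < be t n h l := by
  have := th_lt h l
  unfold be; linarith

/-- Dividing the inequality at `n - 2` by the one at `n` removes the amplitude. This ratio form is
what propagates to other times and angles. -/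
lemma cos_be_add_le {t n h l : ℝ} (d : Dom h l) (a : Adm t n)
    (he : exp (n * l) ≤ lob t n h l) (he2 : lob t (n - 2) h l ≤ exp ((n - 2) * l)) :
    cos (be t n h l + 2 * h) ≤ exp (-2 * l) * cos (be t n h l) := by
  have hg := d.gR_pos a.t0 a.t1
  rw [lob_eq] at he
  rw [lob_sub_two] at he2
  have e : exp ((n - 2) * l) = exp (-2 * l) * exp (n * l) := by rw [← exp_add]; ring_nf
  rw [e] at he2
  have := mul_le_mul_of_nonneg_left he (exp_pos (-2 * l)).le
  have : gw t h l * rR h l * cos (be t n h l + 2 * h) ≤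
      gw t h l * rR h l * (exp (-2 * l) * cos (be t n h l)) := by linarith
  exact le_of_mul_le_mul_left this hg

/-- If the lobe were more than `h` past its crest, time `n - 2` would be closer to the crest, and
the cosine would be larger there, against the ratio inequality. -/
lemma neg_le_be {t n h l : ℝ} (d : Dom h l) (a : Adm t n) (hh : n * h < cc t)
    (he : exp (n * l) ≤ lob t n h l) (he2 : lob t (n - 2) h l ≤ exp ((n - 2) * l)) :
    -h ≤ be t n h l := by
  have h1 := cos_be_add_le d a he he2
  have h2 := cos_be_pos d a he
  have h3 := neg_pi_div_two_lt_be (l := l) hh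
  have h4 : exp (-2 * l) ≤ 1 := by rw [Real.exp_le_one_iff]; linarith [d.l0]
  by_contra hc
  push Not at hc
  have h5 : cos (be t n h l + 2 * h) ≤ cos (be t n h l) := by nlinarith
  rw [← sub_nonpos, cos_sub_cos] at h5
  have h6 : sin ((be t n h l + 2 * h + be t n h l) / 2) < 0 := by
    apply sin_neg_of_neg_of_neg_pi_lt
    · linarith
    · linarith [d.h0, pi_pos]
  have h7 : 0 < sin ((be t n h l + 2 * h - be t n h l) / 2) := by
    have := d.x0
    rwa [show (be t n h l + 2 * h - be t n h l) / 2 = h by ring]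
  nlinarith

/-! ### Lobe points and the existence of tops. -/

/-- Points at which the lobe function meets `exp (n * l)` in the first lobe while its
predecessor of the same parity does not exceed `exp ((n - 2) * l)`. -/
structure LobePt (t n h l : ℝ) : Prop where
  dom : Dom h l
  lt_cc : n * h < cc t
  eq : lob t n h l = exp (n * l)
  le : lob t (n - 2) h l ≤ exp ((n - 2) * l)

lemma Dom.continuousAt_lob {h l t : ℝ} (d : Dom h l) (ht : 0 ≤ t) (n : ℝ) :
    ContinuousAt (fun q : ℝ × ℝ => lob t n q.1 q.2) (h, l) := by
  have h1 := d.W0.ne'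
  have h2 := d.y0.ne'
  have h3 : sin h + t * sinh l ≠ 0 := by
    have := d.x0
    have := mul_nonneg ht d.p0
    linarith
  unfold rW rC at h1
  unfold lob gw rQ rN rW rC
  have c1 : ContinuousAt (fun q : ℝ × ℝ => sinh q.2) (h, l) :=
    (Real.continuous_sinh.comp continuous_snd).continuousAt
  have c2 : ContinuousAt (fun q : ℝ × ℝ => cosh q.2) (h, l) :=
    (Real.continuous_cosh.comp continuous_snd).continuousAt
  have c3 : ContinuousAt (fun q : ℝ × ℝ => sin q.1) (h, l) := by fun_prop
  have c4 : ContinuousAt (fun q : ℝ × ℝ => cos q.1) (h, l) := by fun_prop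
  have c5 : ContinuousAt (fun q : ℝ × ℝ => √(1 + sin q.1 ^ 2)) (h, l) := by fun_prop
  have c6 : ContinuousAt (fun q : ℝ × ℝ => cos (cc t - n * q.1)) (h, l) := by fun_prop
  have c7 : ContinuousAt (fun q : ℝ × ℝ => sin (cc t - n * q.1)) (h, l) := by fun_prop
  exact ((c3.sub (c1.const_mul t)).div (c3.add (c1.const_mul t)) h3).mul
    (c6.add (((c5.sub ((c1.const_mul 2).div ((c3.mul c2).add (c5.mul c1)) h1)).div c4 h2).mul c7))

lemma Dom.continuousAt_lob_left {h l t : ℝ} (d : Dom h l) (ht : 0 ≤ t) (n : ℝ) :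
    ContinuousAt (fun x => lob t n x l) h :=
  ContinuousAt.comp (f := fun x : ℝ => (x, l)) (d.continuousAt_lob ht n) (by fun_prop)

lemma Dom.continuousAt_lob_right {h l t : ℝ} (d : Dom h l) (ht : 0 ≤ t) (n : ℝ) :
    ContinuousAt (fun y => lob t n h y) l :=
  ContinuousAt.comp (f := fun y : ℝ => (h, y)) (d.continuousAt_lob ht n) (by fun_prop)

/-- Decreasing the angle at fixed `l` must cross equality, since `two_mul_sinh_lt` forbids a large
lobe at `sin h = 2 sinh l`; the constraint at `n - 2` survives by `lob_lt_exp_of_lt`. -/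
lemma exists_lobePt_of_le {t n h l : ℝ} (a : Adm t n) (d : Dom h l) (hl : 0 < l)
    (hh : n * h < cc t) (he : exp (n * l) ≤ lob t n h l)
    (he2 : lob t (n - 2) h l ≤ exp ((n - 2) * l)) : ∃ h' ≤ h, LobePt t n h' l := by
  have hp : 0 < sinh l := Real.sinh_pos_iff.2 hl
  have h2 := two_mul_sinh_lt d a hh he
  have hx1 := d.x1
  obtain ⟨h0, e0⟩ : ∃ h0, h0 = arcsin (2 * sinh l) := ⟨_, rfl⟩
  have s0 : sin h0 = 2 * sinh l := by
    rw [e0]; exact sin_arcsin (by linarith) (by linarith)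
  have p0 : 0 < h0 := by rw [e0]; exact arcsin_pos.2 (by linarith)
  have p1 : h0 < π / 2 := by rw [e0]; exact arcsin_lt_pi_div_two.2 (by linarith)
  have d0 : Dom h0 l := ⟨hl.le, p0, p1, by rw [s0]; linarith⟩
  have hh0 : h0 < h := by
    by_contra hc
    push Not at hc
    have := sin_le_sin_of_le_of_le_pi_div_two (by linarith [d.h0, pi_pos]) p1.le hc
    linarith
  have hn := a.n0
  have hlow : lob t n h0 l < exp (n * l) := by
    by_contra hc
    push Not at hc
    have := two_mul_sinh_lt d0 a (by nlinarith) hc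
    linarith
  have cont : ContinuousOn (fun x => lob t n x l) (Set.Icc h0 h) := fun x hx =>
    ((d0.mono hx.1 (hx.2.trans_lt d.h1)).continuousAt_lob_left a.t0 n).continuousWithinAt
  obtain ⟨x, hx, ex⟩ := intermediate_value_Icc hh0.le cont ⟨hlow.le, he⟩
  have dx := d0.mono hx.1 (hx.2.trans_lt d.h1)
  refine ⟨x, hx.2, dx, by nlinarith [hx.2], ex, ?_⟩
  rcases hx.2.eq_or_lt with rfl | hlt
  · exact he2
  · refine (lob_lt_exp_of_lt dx hl a.t0 a.t1 (by linarith [a.five_le]) hlt d.h1 ?_ he2).le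
    rw [be_sub_two]
    have := neg_le_be d a hh he he2
    linarith [d.h0]

/-- Strict inequalities persist for slightly larger `l`. This is the perturbation used against
maximality of a top. -/
lemma exists_lobePt_gt {t n h l : ℝ} (a : Adm t n) (d : Dom h l)
    (hh : n * h < cc t) (he : exp (n * l) < lob t n h l)
    (he2 : lob t (n - 2) h l < exp ((n - 2) * l)) : ∃ l' > l, ∃ h', LobePt t n h' l' := by
  have c0 := d.l0
  have e1 : ∀ᶠ y in 𝓝 l, exp (n * y) < lob t n h y :=
    ContinuousAt.eventually_lt (by fun_prop) (d.continuousAt_lob_right a.t0 n) he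
  have e2 : ∀ᶠ y in 𝓝 l, lob t (n - 2) h y < exp ((n - 2) * y) :=
    ContinuousAt.eventually_lt (d.continuousAt_lob_right a.t0 (n - 2)) (by fun_prop) he2
  have e3 : ∀ᶠ y in 𝓝 l, sinh y < sin h :=
    ContinuousAt.eventually_lt Real.continuous_sinh.continuousAt (by fun_prop) d.lt
  have e4 := (e1.and (e2.and e3)).filter_mono (nhdsWithin_le_nhds (s := Set.Ioi l))
  obtain ⟨y, ⟨y1, y2, y3⟩, hy⟩ := (e4.and self_mem_nhdsWithin).exists
  have hy : l < y := hy
  have dy : Dom h y := ⟨by linarith, d.h0, d.h1, y3⟩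
  obtain ⟨h', -, p⟩ := exists_lobePt_of_le a dy (by linarith) hh y1.le y2.le
  exact ⟨y, hy, h', p⟩

lemma pi_div_four_lt_th_zero {h : ℝ} (h0 : 0 < h) (h1 : h < π / 2) : π / 4 < th h 0 := by
  have d : Dom h 0 := ⟨le_rfl, h0, h1, by
    rw [sinh_zero]; exact sin_pos_of_pos_of_lt_pi h0 (by linarith)⟩
  rw [← arctan_one]
  apply arctan_strictMono
  unfold rQ rN
  rw [sinh_zero, mul_zero, zero_div, sub_zero, lt_div_iff₀ d.y0, one_mul]
  have h2 := one_le_rC h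
  have : cos h < 1 := by nlinarith [sin_sq_add_cos_sq h, d.x0, d.y0]
  linarith

lemma continuousAt_rQ_left {h l : ℝ} (d : Dom h l) : ContinuousAt (fun x => rQ x l) h := by
  have h1 := d.W0.ne'
  have h2 := d.y0.ne'
  unfold rW rC at h1
  unfold rQ rN rW rC
  refine ContinuousAt.div ?_ (by fun_prop) h2
  refine ContinuousAt.sub (by fun_prop) (ContinuousAt.div (by fun_prop) (by fun_prop) h1)

lemma continuousAt_th_left {h l : ℝ} (d : Dom h l) : ContinuousAt (fun x => th x l) h :=
  Real.continuous_arctan.continuousAt.comp (continuousAt_rQ_left d)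

lemma exists_lobePt_pos {t n : ℝ} (a : Adm t n) : ∃ l > 0, ∃ h, LobePt t n h l := by
  have hpi := pi_pos
  have hn := a.n0
  have h5 := a.five_le
  have hc1 := a.le_cc
  have hc2 := a.cc_le_mul
  have hb : cc t / n ≤ π / 3 := by rw [div_le_iff₀ hn]; linarith
  have ha0 : 0 < cc t / n := div_pos (by linarith) hn
  have hd : ∀ x, 0 < x → x ≤ cc t / n → Dom x 0 := fun x x0 x1 => ⟨le_rfl, x0, by linarith, by
    rw [sinh_zero]; exact sin_pos_of_pos_of_lt_pi x0 (by linarith)⟩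
  have hs : π / (2 * n) ≤ cc t / n := by
    rw [div_le_div_iff₀ (by positivity) hn]; nlinarith
  have hs0 : 0 < π / (2 * n) := by positivity
  -- At `l = 0` the angle is chosen with `be = th - x`. Times `n` and `n - 2` then sit at `th - x`
  -- and `th + x`, on either side of the threshold `th`, where `rR * cos` equals 1.
  have cont : ContinuousOn (fun x => (n - 1) * x + 2 * th x 0) (Set.Icc (π / (2 * n)) (cc t / n)) :=
    fun x hx => ContinuousAt.continuousWithinAt (ContinuousAt.add (by fun_prop)
      ((continuousAt_th_left (hd x (by linarith [hx.1]) hx.2)).const_mul 2))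
  have lo : (n - 1) * (π / (2 * n)) + 2 * th (π / (2 * n)) 0 ≤ cc t := by
    have := th_lt (π / (2 * n)) 0
    have e : n * (π / (2 * n)) = π / 2 := by field_simp
    linarith
  have hi : cc t ≤ (n - 1) * (cc t / n) + 2 * th (cc t / n) 0 := by
    have := pi_div_four_lt_th_zero ha0 (by linarith)
    have e : n * (cc t / n) = cc t := by field_simp
    linarith
  obtain ⟨x, hx, ex⟩ := intermediate_value_Icc hs cont ⟨lo, hi⟩
  simp only at ex
  have x0 : 0 < x := by linarith [hx.1]
  have d := hd x x0 hx.2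
  have hθ := pi_div_four_lt_th_zero x0 d.h1
  have hθ2 := th_lt x 0
  have hbe : be t n x 0 = th x 0 - x := by unfold be; linarith
  have hx3 : x ≤ π / 3 := hx.2.trans hb
  have hg : gw t x 0 = 1 := by
    unfold gw; rw [sinh_zero, mul_zero, sub_zero, add_zero, div_self d.x0.ne']
  have hR := rR_pos x 0
  have hc := cos_th x 0
  obtain ⟨l, hl, h, p⟩ := exists_lobePt_gt a d (by linarith) (l := 0) (by
    rw [mul_zero, exp_zero, lob_eq, hbe, hg, one_mul, ← hc]
    apply mul_lt_mul_of_pos_left _ hR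
    rw [← cos_abs (th x 0 - x)]
    refine cos_lt_cos_of_nonneg_of_le_pi (abs_nonneg _) (by linarith) ?_
    rw [abs_lt]; constructor <;> linarith) (by
    rw [mul_zero, exp_zero, lob_sub_two, hbe, hg, one_mul, ← hc]
    apply mul_lt_mul_of_pos_left _ hR
    exact cos_lt_cos_of_nonneg_of_le_pi (by linarith) (by linarith) (by linarith))
  exact ⟨l, hl, h, p⟩

/-- The lobe points with the largest contraction rate. -/
structure IsTop (t n h l : ℝ) : Prop where
  pt : LobePt t n h l
  pos : 0 < l
  max : ∀ h' l', LobePt t n h' l' → l' ≤ l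

lemma exists_isTop {t n : ℝ} (a : Adm t n) : ∃ h l, IsTop t n h l := by
  obtain ⟨l0, hl0, h0, p0⟩ := exists_lobePt_pos a
  have hpi := pi_pos
  have hn := a.n0
  -- The closed condition `2 sinh l ≤ sin h`, implied at lobe points, together with `l ≥ l0 > 0`
  -- keeps `B` inside the non-closed domain `Dom`.
  let B : Set (ℝ × ℝ) := (Set.Icc 0 (π / 3) ×ˢ Set.Icc l0 1) ∩
    ({q | n * q.1 ≤ cc t} ∩ {q | 2 * sinh q.2 ≤ sin q.1})
  have hB : IsCompact B := by
    refine (isCompact_Icc.prod isCompact_Icc).inter_right (IsClosed.inter ?_ ?_)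
    · exact isClosed_le (by fun_prop) continuous_const
    · exact isClosed_le (continuous_const.mul (Real.continuous_sinh.comp continuous_snd))
        (by fun_prop)
  have hD : ∀ q ∈ B, Dom q.1 q.2 := by
    rintro ⟨h, l⟩ ⟨⟨⟨q1, q2⟩, q3, q4⟩, q5, q6⟩
    simp only [Set.mem_ofPred_eq] at q1 q2 q3 q4 q5 q6 ⊢
    have : 0 < sinh l := Real.sinh_pos_iff.2 (by linarith)
    refine ⟨by linarith, ?_, by linarith, by linarith⟩
    rcases q1.eq_or_lt with rfl | h1
    · rw [sin_zero] at q6; linarith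
    · exact h1
  have hc : ∀ m, ContinuousOn (fun q : ℝ × ℝ => lob t m q.1 q.2 - exp (m * q.2)) B :=
    fun m q hq => (((hD q hq).continuousAt_lob a.t0 m).sub (by fun_prop)).continuousWithinAt
  let K : Set (ℝ × ℝ) := (B ∩ (fun q : ℝ × ℝ => lob t n q.1 q.2 - exp (n * q.2)) ⁻¹' {0}) ∩
    (B ∩ (fun q : ℝ × ℝ => lob t (n - 2) q.1 q.2 - exp ((n - 2) * q.2)) ⁻¹' Set.Iic 0)
  have hK : IsCompact K := by
    refine (hB.of_isClosed_subset ((hc n).preimage_isClosed_of_isClosed hB.isClosed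
      isClosed_singleton) Set.inter_subset_left).inter_right
      ((hc (n - 2)).preimage_isClosed_of_isClosed hB.isClosed isClosed_Iic)
  have hmem : ∀ h l, l0 ≤ l → LobePt t n h l → (h, l) ∈ K := by
    intro h l hl p
    have h3 := a.h_lt p.lt_cc
    have h2 := two_mul_sinh_lt p.dom a p.lt_cc p.eq.ge
    have hb : (h, l) ∈ B := by
      refine ⟨⟨⟨p.dom.h0.le, h3.le⟩, hl, ?_⟩, p.lt_cc.le, h2.le⟩
      have := Real.self_le_sinh_iff.2 p.dom.l0
      have := p.dom.x1
      linarith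
    exact ⟨⟨hb, sub_eq_zero.2 p.eq⟩, hb, sub_nonpos.2 p.le⟩
  obtain ⟨⟨h, l⟩, hq, hmax⟩ := hK.exists_isMaxOn ⟨_, hmem h0 l0 le_rfl p0⟩
    continuous_snd.continuousOn
  have d := hD _ hq.1.1
  have hl : l0 ≤ l := hq.1.1.1.2.1
  have e1 : lob t n h l = exp (n * l) := sub_eq_zero.1 hq.1.2
  refine ⟨h, l, ⟨d, lt_of_le_of_ne hq.1.1.2.1 ?_, e1, sub_nonpos.1 hq.2.2⟩, by linarith, ?_⟩
  · intro e
    have e : n * h = cc t := e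
    have := lob_lt_of_nonpos (n := n) d a.t0 a.t1 (mul_pos hn (by linarith)) (by
      simp only
      rw [e, sub_self, sin_zero])
    exact this.ne e1
  · intro h' l' p
    rcases le_total l' l0 with h1 | h1
    · linarith
    · exact hmax (hmem h' l' h1 p)

/-! ### Derivatives in the angle and concavity. -/

/-- The derivative of `rW` with respect to the angle. -/
noncomputable def rWd (h l : ℝ) : ℝ := cos h * cosh l + sin h * cos h / rC h * sinh l

/-- The derivative of `rQ` with respect to the angle. -/
noncomputable def rQd (h l : ℝ) : ℝ :=
  (sin h * cos h / rC h + 2 * sinh l * rWd h l / rW h l ^ 2) / cos h +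
    rN h l * sin h / cos h ^ 2

/-- The derivative of `rW * cos` with respect to the angle. -/
noncomputable def rMd (h l : ℝ) : ℝ := cosh l * cos (2 * h) - 2 * sinh l * sin h ^ 3 / rC h

lemma rC_pos (h : ℝ) : 0 < rC h := by linarith [one_le_rC h]

lemma hasDerivAt_rC (h : ℝ) : HasDerivAt rC (sin h * cos h / rC h) h := by
  have h1 := rC_pos h
  have : HasDerivAt (fun x => 1 + sin x ^ 2) (2 * sin h * cos h) h := by
    have := ((hasDerivAt_sin h).pow 2).const_add 1
    simpa using this
  have h2 := this.sqrt (by positivity)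
  refine h2.congr_deriv ?_
  rw [show √(1 + sin h ^ 2) = rC h from rfl]
  field_simp

lemma hasDerivAt_rW (h l : ℝ) : HasDerivAt (fun x => rW x l) (rWd h l) h :=
  ((hasDerivAt_sin h).mul_const _).add ((hasDerivAt_rC h).mul_const _)

lemma hasDerivAt_rN {h l : ℝ} (d : Dom h l) :
    HasDerivAt (fun x => rN x l)
      (sin h * cos h / rC h + 2 * sinh l * rWd h l / rW h l ^ 2) h := by
  have h2 := (hasDerivAt_rC h).sub
    ((hasDerivAt_const h (2 * sinh l)).div (hasDerivAt_rW h l) d.W0.ne')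
  refine h2.congr_deriv ?_
  ring

lemma hasDerivAt_rQ {h l : ℝ} (d : Dom h l) : HasDerivAt (fun x => rQ x l) (rQd h l) h := by
  have hy := d.y0
  have h2 := (hasDerivAt_rN d).div (hasDerivAt_cos h) hy.ne'
  refine h2.congr_deriv ?_
  unfold rQd
  field_simp
  ring

lemma Dom.rWd_pos {h l : ℝ} (d : Dom h l) : 0 < rWd h l := by
  have := d.x0
  have := d.y0
  have := d.p0
  have := cosh_pos l
  have := rC_pos h
  unfold rWd
  positivity

lemma Dom.rQd_pos {h l : ℝ} (d : Dom h l) : 0 < rQd h l := by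
  have := d.x0
  have := d.y0
  have := d.p0
  have := d.rWd_pos
  have := rC_pos h
  have := d.N0
  have := d.W0
  unfold rQd
  positivity

lemma hasDerivAt_rMd (h l : ℝ) : HasDerivAt (fun x => rMd x l)
    (-(2 * cosh l * sin (2 * h)) - 2 * sinh l * sin h ^ 2 * cos h * (3 + 2 * sin h ^ 2) /
      rC h ^ 3) h := by
  have hC := rC_pos h
  have h1 : HasDerivAt (fun x : ℝ => cos (2 * x)) (-sin (2 * h) * 2) h := by
    have := (hasDerivAt_cos (2 * h)).comp h ((hasDerivAt_id h).const_mul 2)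
    exact this.congr_deriv (by simp)
  have h2 := (h1.const_mul (cosh l)).sub ((((hasDerivAt_sin h).pow 3).const_mul (2 * sinh l)).div
    (hasDerivAt_rC h) hC.ne')
  refine h2.congr_deriv ?_
  norm_num
  field_simp
  have := rC_sq h
  rw [this]
  ring

lemma hasDerivAt_rW_mul_cos (h l : ℝ) :
    HasDerivAt (fun x => rW x l * cos x) (rMd h l) h := by
  have hC := rC_pos h
  have h2 := (hasDerivAt_rW h l).mul (hasDerivAt_cos h)
  refine h2.congr_deriv ?_
  unfold rMd rWd rW
  rw [cos_two_mul, cos_sq']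
  field_simp
  rw [cos_sq']
  linear_combination -(sin h * sinh l) * rC_sq h

/-- Differentiating `rQ` as `rC / cos - 2 sinh / (rW * cos)` gives a second form of its derivative,
whose parts are easier to differentiate again. -/
lemma rQd_eq {h l : ℝ} (d : Dom h l) :
    rQd h l = 2 * sin h / (rC h * cos h ^ 2) + 2 * sinh l * rMd h l / (rW h l * cos h) ^ 2 := by
  have hy := d.y0
  have hC := rC_pos h
  have hW := d.W0
  have h1 : HasDerivAt (fun x => rC x / cos x - 2 * sinh l / (rW x l * cos x))
      (2 * sin h / (rC h * cos h ^ 2) + 2 * sinh l * rMd h l / (rW h l * cos h) ^ 2) h := by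
    have h2 := ((hasDerivAt_rC h).div (hasDerivAt_cos h) hy.ne').sub
      ((hasDerivAt_const h (2 * sinh l)).div (hasDerivAt_rW_mul_cos h l) (by positivity))
    refine h2.congr_deriv ?_
    have : 2 * sin h / (rC h * cos h ^ 2) =
        (sin h * cos h / rC h * cos h - rC h * -sin h) / cos h ^ 2 := by
      field_simp
      rw [cos_sq', rC_sq]
      ring
    rw [this]
    ring
  refine (hasDerivAt_rQ d).unique (h1.congr_of_eventuallyEq ?_)
  have hc : ∀ᶠ x in 𝓝 h, cos x ≠ 0 := continuous_cos.continuousAt.eventually_ne hy.ne'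
  filter_upwards [hc] with x hx
  unfold rQ rN
  field_simp

/-- The part coming from `rC / cos` has second derivative at most `2 rC / cos^3`; the other part
contributes a nonpositive amount because `rMd` decreases and enters squared with a negative sign. -/
lemma exists_hasDerivAt_rQd {h l : ℝ} (d : Dom h l) :
    ∃ D ≤ 2 * rC h / cos h ^ 3, HasDerivAt (fun x => rQd x l) D h := by
  have hy := d.y0
  have hx := d.x0
  have hp := d.p0
  have hC := rC_pos h
  have hW := d.W0
  have hr := cosh_pos l
  have hs := sin_two_mul_pos d.h0 d.h1
  have h1 : HasDerivAt (fun x => rC x * cos x ^ 2)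
      (sin h * cos h / rC h * cos h ^ 2 - rC h * (2 * cos h * sin h)) h := by
    have := (hasDerivAt_rC h).mul ((hasDerivAt_cos h).pow 2)
    refine this.congr_deriv ?_
    simp only [Pi.pow_apply, Nat.cast_ofNat, Nat.add_one_sub_one, pow_one]
    ring
  have h2 := (((hasDerivAt_sin h).const_mul 2).div h1 (by positivity : rC h * cos h ^ 2 ≠ 0)).add
    (((hasDerivAt_rMd h l).const_mul (2 * sinh l)).div
      ((hasDerivAt_rW_mul_cos h l).pow 2) (by positivity : (rW h l * cos h) ^ 2 ≠ 0))
  refine ⟨_, ?_, h2.congr_of_eventuallyEq ?_⟩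
  · have e1 : (2 * cos h * (rC h * cos h ^ 2) - 2 * sin h *
        (sin h * cos h / rC h * cos h ^ 2 - rC h * (2 * cos h * sin h))) /
        (rC h * cos h ^ 2) ^ 2 ≤ 2 * rC h / cos h ^ 3 := by
      rw [div_le_div_iff₀ (by positivity) (by positivity)]
      have f1 : 0 ≤ 2 * sin h ^ 2 * cos h ^ 6 / rC h := by positivity
      have f2 : 2 * sin h * (sin h * cos h / rC h * cos h ^ 2) * cos h ^ 3 =
          2 * sin h ^ 2 * cos h ^ 6 / rC h := by ring
      have f3 : rC h ^ 2 = cos h ^ 2 + 2 * sin h ^ 2 := by rw [rC_sq, cos_sq']; ring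
      have f4 : 2 * rC h * (rC h * cos h ^ 2) ^ 2 =
          2 * rC h * cos h ^ 4 * (cos h ^ 2 + 2 * sin h ^ 2) := by rw [← f3]; ring
      linarith
    have e2 : (2 * sinh l * (-(2 * cosh l * sin (2 * h)) - 2 * sinh l * sin h ^ 2 * cos h *
        (3 + 2 * sin h ^ 2) / rC h ^ 3) * (rW h l * cos h) ^ 2 -
        2 * sinh l * rMd h l * ((2 : ℕ) * (rW h l * cos h) ^ (2 - 1) * rMd h l)) /
        ((rW h l * cos h) ^ 2) ^ 2 ≤ 0 := by
      apply div_nonpos_of_nonpos_of_nonneg _ (by positivity)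
      have f1 : 0 ≤ 2 * sinh l * (2 * cosh l * sin (2 * h) + 2 * sinh l * sin h ^ 2 * cos h *
        (3 + 2 * sin h ^ 2) / rC h ^ 3) * (rW h l * cos h) ^ 2 := by positivity
      have f2 : 0 ≤ 2 * sinh l * (2 * (rW h l * cos h)) * rMd h l ^ 2 := by positivity
      norm_num
      linarith
    exact (add_le_add e1 e2).trans_eq (add_zero _)
  · have hc : ∀ᶠ x in 𝓝 h, cos x ≠ 0 := continuous_cos.continuousAt.eventually_ne hy.ne'
    have hd : ∀ᶠ x in 𝓝 h, Dom x l := by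
      have a1 : ∀ᶠ x in 𝓝 h, 0 < x := lt_mem_nhds d.h0
      have a2 : ∀ᶠ x in 𝓝 h, x < π / 2 := gt_mem_nhds d.h1
      have a3 : ∀ᶠ x in 𝓝 h, sinh l < sin x :=
        continuous_sin.continuousAt.eventually (lt_mem_nhds d.lt)
      filter_upwards [a1, a2, a3] with x b1 b2 b3 using ⟨d.l0, b1, b2, b3⟩
    filter_upwards [hd] with x hx using rQd_eq hx

/-- The derivative of `cos u + rQ * sin u`, where `u = cc t - n * h`. -/
noncomputable def qd (t n h l : ℝ) : ℝ :=
  n * (sin (cc t - n * h) - rQ h l * cos (cc t - n * h)) + rQd h l * sin (cc t - n * h)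

lemma hasDerivAt_arg (t n h : ℝ) : HasDerivAt (fun x => cc t - n * x) (-n) h := by
  simpa using ((hasDerivAt_id h).const_mul n).const_sub (cc t)

lemma hasDerivAt_q {t n h l : ℝ} (d : Dom h l) :
    HasDerivAt (fun x => cos (cc t - n * x) + rQ x l * sin (cc t - n * x)) (qd t n h l) h := by
  have h1 := hasDerivAt_arg t n h
  have h2 := h1.cos.add ((hasDerivAt_rQ d).mul h1.sin)
  refine h2.congr_deriv ?_
  unfold qd
  ring

/-- The curvature of `rQ` is dominated by the `n^2` term of the sinusoid: `2 sinh l ≤ sin h` gives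
`rN ≥ rC / 3`, and `n ≥ 5` with `cos h ≥ 1/2` suffices. -/
lemma exists_hasDerivAt_qd {t n h l : ℝ} (d : Dom h l) (hn : 5 ≤ n) (hy : 1 / 2 ≤ cos h)
    (hp : 2 * sinh l ≤ sin h) (hs : 0 ≤ sin (cc t - n * h)) (hc : 0 < cos (cc t - n * h)) :
    ∃ D < 0, HasDerivAt (fun x => qd t n x l) D h := by
  obtain ⟨E, hE, dE⟩ := exists_hasDerivAt_rQd d
  have h1 := hasDerivAt_arg t n h
  have h2 := ((h1.sin.sub ((hasDerivAt_rQ d).mul h1.cos)).const_mul n).add (dE.mul h1.sin)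
  refine ⟨_, ?_, h2⟩
  have hC := one_le_rC h
  have hQ : 2 * rC h / cos h ^ 3 ≤ n ^ 2 * rQ h l := by
    have hW := d.W0
    have h3 : rC h / 3 ≤ rN h l := by
      unfold rN
      have : 2 * sinh l / rW h l ≤ 2 / 3 := by
        rw [div_le_iff₀ hW]
        linarith [d.le_W]
      linarith
    have y2 : 1 / 4 ≤ cos h ^ 2 := by nlinarith
    have h4 : 2 * rC h ≤ n ^ 2 * rN h l * cos h ^ 2 := by
      have : (25 : ℝ) ≤ n ^ 2 := by nlinarith
      have : 25 * (rC h / 3) ≤ n ^ 2 * rN h l :=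
        mul_le_mul this h3 (by linarith) (by positivity)
      nlinarith
    have hy0 := d.y0
    unfold rQ
    rw [div_le_iff₀ (by positivity)]
    calc 2 * rC h ≤ n ^ 2 * rN h l * cos h ^ 2 := h4
      _ = n ^ 2 * (rN h l / cos h) * cos h ^ 3 := by field_simp
  have h5 : E * sin (cc t - n * h) ≤ n ^ 2 * rQ h l * sin (cc t - n * h) :=
    mul_le_mul_of_nonneg_right (hE.trans hQ) hs
  have h6 : 0 < n ^ 2 * cos (cc t - n * h) := by positivity
  have h7 : 0 < n * rQd h l * cos (cc t - n * h) := by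
    have := d.rQd_pos
    positivity
  linarith

lemma Dom.eventually {h l : ℝ} (d : Dom h l) : ∀ᶠ x in 𝓝 h, Dom x l := by
  have a1 : ∀ᶠ x in 𝓝 h, 0 < x := lt_mem_nhds d.h0
  have a2 : ∀ᶠ x in 𝓝 h, x < π / 2 := gt_mem_nhds d.h1
  have a3 : ∀ᶠ x in 𝓝 h, sinh l < sin x :=
    continuous_sin.continuousAt.eventually (lt_mem_nhds d.lt)
  filter_upwards [a1, a2, a3] with x b1 b2 b3 using ⟨d.l0, b1, b2, b3⟩

/-! ### Optimality conditions at a top and its uniqueness. -/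

lemma IsTop.lob_le {t n h l h' : ℝ} (p : IsTop t n h l) (a : Adm t n) (d : Dom h' l)
    (hh : h' < h) : lob t n h' l ≤ exp (n * l) := by
  by_contra hc
  push Not at hc
  have hn := a.n0
  have h1 := p.pt.lt_cc
  obtain ⟨l', hl', h2, p2⟩ := exists_lobePt_gt a d (by nlinarith) hc (by
    refine lob_lt_exp_of_lt d p.pos a.t0 a.t1 (by linarith [a.five_le]) hh p.pt.dom.h1 ?_ p.pt.le
    rw [be_sub_two]
    have := neg_le_be p.pt.dom a h1 p.pt.eq.ge p.pt.le
    linarith [p.pt.dom.h0])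
  exact (p.max _ _ p2).not_gt hl'

lemma continuousAt_be_left {t n h l : ℝ} (d : Dom h l) : ContinuousAt (fun x => be t n x l) h :=
  ContinuousAt.sub (by fun_prop) (continuousAt_th_left d)

/-- Beyond a lobe point in front of the top of a lobe, the lobe function is larger. -/
lemma eventually_lt_lob {t n h l : ℝ} (a : Adm t n) (hl : 0 < l) (p : LobePt t n h l)
    (hb : 0 < be t n h l) :
    ∀ᶠ x in 𝓝[>] h, Dom x l ∧ n * x < cc t ∧ exp (n * l) < lob t n x l := by
  have e1 := p.dom.eventually
  have e2 : ∀ᶠ x in 𝓝 h, n * x < cc t :=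
    ContinuousAt.eventually_lt (by fun_prop) (by fun_prop) p.lt_cc
  have e3 : ∀ᶠ x in 𝓝 h, 0 < be t n x l :=
    (continuousAt_be_left p.dom).eventually (lt_mem_nhds hb)
  have e4 : ∀ᶠ x in 𝓝 h, 0 < lob t n x l :=
    (p.dom.continuousAt_lob_left a.t0 n).eventually (lt_mem_nhds (by simp only [p.eq]; exact exp_pos _))
  filter_upwards [(e1.and (e2.and (e3.and e4))).filter_mono nhdsWithin_le_nhds,
    self_mem_nhdsWithin] with x ⟨x1, x2, x3, x4⟩ x5
  refine ⟨x1, x2, ?_⟩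
  rw [← p.eq]
  exact lob_lt_lob p.dom a.t0 a.t1 a.n0.le x5 x1.h1 (arg_lt_pi p.dom hl a p.eq.ge) x3.le x4

/-- In front of the crest with the constraint at `n - 2` inactive, a small increase of `h` makes the
lobe exceed the exponential, and then `l` can be increased as well. -/
lemma IsTop.be_nonpos_or {t n h l : ℝ} (p : IsTop t n h l) (a : Adm t n) :
    be t n h l ≤ 0 ∨ lob t (n - 2) h l = exp ((n - 2) * l) := by
  by_contra hc
  push Not at hc
  obtain ⟨hb, hne⟩ := hc
  have hlt := lt_of_le_of_ne p.pt.le hne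
  have e1 := eventually_lt_lob a p.pos p.pt hb
  have e2 : ∀ᶠ x in 𝓝[>] h, lob t (n - 2) x l < exp ((n - 2) * l) :=
    (ContinuousAt.eventually_lt (p.pt.dom.continuousAt_lob_left a.t0 (n - 2))
      continuousAt_const hlt).filter_mono nhdsWithin_le_nhds
  obtain ⟨x, ⟨x1, x2, x3⟩, x4⟩ := (e1.and e2).exists
  obtain ⟨l', hl', h2, p2⟩ := exists_lobePt_gt a x1 x2 x3 x4
  exact (p.max _ _ p2).not_gt hl'

lemma deriv_nonneg_of_left {f : ℝ → ℝ} {D x : ℝ} (hf : HasDerivAt f D x)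
    (hx : ∀ᶠ y in 𝓝[<] x, f y ≤ f x) : 0 ≤ D := by
  have h1 : Tendsto (slope f x) (𝓝[<] x) (𝓝 D) :=
    (hasDerivAt_iff_tendsto_slope.1 hf).mono_left
      (nhdsWithin_mono x fun y (hy : y < x) => hy.ne)
  refine ge_of_tendsto h1 ?_
  filter_upwards [hx, self_mem_nhdsWithin] with y hy hlt
  have hlt : y < x := hlt
  rw [slope_def_field]
  exact div_nonneg_of_nonpos (by linarith) (by linarith)

lemma hasDerivAt_gw {t h l : ℝ} (d : Dom h l) (ht : 0 ≤ t) :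
    HasDerivAt (fun x => gw t x l) (2 * t * sinh l * cos h / (sin h + t * sinh l) ^ 2) h := by
  have h1 := d.x0
  have h2 := mul_nonneg ht d.p0
  have h3 := ((hasDerivAt_sin h).sub_const (t * sinh l)).div
    ((hasDerivAt_sin h).add_const (t * sinh l)) (by positivity)
  exact h3.congr_deriv (by ring)

lemma IsTop.deriv_nonneg {t n h l : ℝ} (p : IsTop t n h l) (a : Adm t n) :
    0 ≤ 2 * t * sinh l * cos h / (sin h + t * sinh l) ^ 2 *
      (cos (cc t - n * h) + rQ h l * sin (cc t - n * h)) + gw t h l * qd t n h l := by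
  have d := p.pt.dom
  have h1 := (hasDerivAt_gw d a.t0).mul (hasDerivAt_q (t := t) (n := n) d)
  refine deriv_nonneg_of_left h1 ?_
  filter_upwards [d.eventually.filter_mono nhdsWithin_le_nhds, self_mem_nhdsWithin] with x x1 x2
  have := p.lob_le a x1 x2
  rw [← p.pt.eq] at this
  exact this

lemma hasDerivAt_inv_gw {t h l : ℝ} (d : Dom h l) (ht1 : t ≤ 1) :
    HasDerivAt (fun x => (sin x + t * sinh l) / (sin x - t * sinh l))
      (-(2 * t * sinh l * cos h / (sin h - t * sinh l) ^ 2)) h := by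
  have h1 := d.lt
  have h2 : t * sinh l ≤ sinh l := by nlinarith [d.p0]
  have h3 := ((hasDerivAt_sin h).add_const (t * sinh l)).div
    ((hasDerivAt_sin h).sub_const (t * sinh l)) (by linarith)
  exact h3.congr_deriv (by ring)

/-- Dividing by `gw` leaves a strictly concave function of `h` on the interval between two tops. It
vanishes at both, so it is positive at the midpoint, against `IsTop.lob_le`. -/
lemma isTop_le {t n h1 h2 l : ℝ} (a : Adm t n) (p1 : IsTop t n h1 l) (p2 : IsTop t n h2 l) :
    h2 ≤ h1 := by
  by_contra hlt
  push Not at hlt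
  have hn := a.n0
  have hle : ∀ x ∈ Set.Icc h1 h2, lob t n x l ≤ exp (n * l) := by
    rintro x ⟨x1, x2⟩
    rcases x2.eq_or_lt with rfl | x2
    · exact p2.pt.eq.le
    · exact p2.lob_le a (p1.pt.dom.mono x1 (x2.trans p2.pt.dom.h1)) x2
  -- The left top lies at or beyond its crest, which puts the argument of the sinusoid in `(0, π/2)`
  -- on the whole interval, as concavity requires.
  have hb : be t n h1 l ≤ 0 := by
    by_contra hb
    push Not at hb
    have e1 := eventually_lt_lob a p1.pos p1.pt hb
    have e2 : ∀ᶠ x in 𝓝[>] h1, x < h2 := (gt_mem_nhds hlt).filter_mono nhdsWithin_le_nhds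
    obtain ⟨x, ⟨⟨-, -, x3⟩, x4⟩, x5⟩ := ((e1.and e2).and self_mem_nhdsWithin).exists
    have x5 : h1 < x := x5
    exact (hle x ⟨x5.le, x4.le⟩).not_gt x3
  have hx2 := p2.pt.lt_cc
  have h3 := a.h_lt hx2
  have hp := two_mul_sinh_lt p1.pt.dom a p1.pt.lt_cc p1.pt.eq.ge
  have dom : ∀ x ∈ Set.Icc h1 h2, Dom x l := fun x hx =>
    p1.pt.dom.mono hx.1 (hx.2.trans_lt p2.pt.dom.h1)
  have arg : ∀ x ∈ Set.Icc h1 h2, 0 < cc t - n * x ∧ cc t - n * x < π / 2 := by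
    intro x hx
    constructor
    · nlinarith [hx.2]
    · have := th_lt h1 l
      have : n * h1 ≤ n * x := mul_le_mul_of_nonneg_left hx.1 hn.le
      unfold be at hb
      linarith
  have hden : ∀ x ∈ Set.Icc h1 h2, 0 < sin x - t * sinh l := by
    intro x hx
    have h1 := (dom x hx).lt
    have h2 : t * sinh l ≤ sinh l := by nlinarith [(dom x hx).p0, a.t1]
    linarith
  let H : ℝ → ℝ := fun x => cos (cc t - n * x) + rQ x l * sin (cc t - n * x) -
    exp (n * l) * ((sin x + t * sinh l) / (sin x - t * sinh l))
  let H' : ℝ → ℝ := fun x => qd t n x l -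
    exp (n * l) * (-(2 * t * sinh l * cos x / (sin x - t * sinh l) ^ 2))
  have dH : ∀ x ∈ Set.Icc h1 h2, HasDerivAt H (H' x) x := fun x hx =>
    (hasDerivAt_q (dom x hx)).sub ((hasDerivAt_inv_gw (dom x hx) a.t1).const_mul _)
  have sH : ∀ x ∈ Set.Icc h1 h2, gw t x l * H x = lob t n x l - exp (n * l) := by
    intro x hx
    have := hden x hx
    have h0 := (dom x hx).x0
    have h4 := mul_nonneg a.t0 (dom x hx).p0
    simp only [H, lob, gw]
    field_simp
  have key : ∀ x ∈ Set.Icc h1 h2, ∃ D < 0, HasDerivAt (fun x => qd t n x l) D x := by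
    intro x hx
    obtain ⟨u0, u1⟩ := arg x hx
    refine exists_hasDerivAt_qd (dom x hx) a.five_le
      (half_lt_cos (dom x hx).h0.le (hx.2.trans_lt h3)).le ?_
      (sin_pos_of_pos_of_lt_pi u0 (by linarith [pi_pos])).le
      (cos_pos_of_mem_Ioo ⟨by linarith, u1⟩)
    have := sin_le_sin_of_le_of_le_pi_div_two (by linarith [p1.pt.dom.h0, pi_pos])
      (dom x hx).h1.le hx.1
    linarith
  have antiq : StrictAntiOn (fun x => qd t n x l) (Set.Icc h1 h2) := by
    apply strictAntiOn_of_deriv_neg (convex_Icc _ _)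
    · intro x hx
      obtain ⟨D, -, hD⟩ := key x hx
      exact hD.continuousAt.continuousWithinAt
    · intro x hx
      obtain ⟨D, h0, hD⟩ := key x (interior_subset hx)
      rw [hD.deriv]; exact h0
  have anti : StrictAntiOn H' (Set.Icc h1 h2) := by
    intro x hx y hy hxy
    have f1 := antiq hx hy hxy
    have f2 : 2 * t * sinh l * cos y / (sin y - t * sinh l) ^ 2 ≤
        2 * t * sinh l * cos x / (sin x - t * sinh l) ^ 2 := by
      have c1 : cos y ≤ cos x := cos_le_cos_of_nonneg_of_le_pi (dom x hx).h0.le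
        (by linarith [(dom y hy).h1, pi_pos]) hxy.le
      have s1 := sin_le_sin_of_le_of_le_pi_div_two (by linarith [(dom x hx).h0, pi_pos])
        (dom y hy).h1.le hxy.le
      have := hden x hx
      have := (dom x hx).y0
      have := mul_nonneg (mul_nonneg zero_le_two a.t0) (dom x hx).p0
      gcongr
    have f3 := mul_le_mul_of_nonneg_left f2 (exp_pos (n * l)).le
    simp only [H']
    simp only at f1
    linarith
  have conc : StrictConcaveOn ℝ (Set.Icc h1 h2) H := by
    apply StrictAntiOn.strictConcaveOn_of_deriv (convex_Icc _ _)
    · exact fun x hx => (dH x hx).continuousAt.continuousWithinAt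
    · exact (anti.mono interior_subset).congr fun x hx => (dH x (interior_subset hx)).deriv.symm
  have i1 : h1 ∈ Set.Icc h1 h2 := ⟨le_rfl, hlt.le⟩
  have i2 : h2 ∈ Set.Icc h1 h2 := ⟨hlt.le, le_rfl⟩
  have z : ∀ x ∈ Set.Icc h1 h2, lob t n x l = exp (n * l) → H x = 0 := by
    intro x hx e
    have := sH x hx
    rw [e, sub_self] at this
    exact (mul_eq_zero.1 this).resolve_left ((dom x hx).gw_pos a.t0 a.t1).ne'
  have m := conc.2 i1 i2 hlt.ne (by norm_num : (0 : ℝ) < 1 / 2) (by norm_num : (0 : ℝ) < 1 / 2)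
    (by norm_num)
  rw [z h1 i1 p1.pt.eq, z h2 i2 p2.pt.eq] at m
  simp only [smul_eq_mul, mul_zero, add_zero] at m
  have im : 1 / 2 * h1 + 1 / 2 * h2 ∈ Set.Icc h1 h2 := ⟨by linarith, by linarith⟩
  have := sH _ im
  have := hle _ im
  have := mul_pos ((dom _ im).gw_pos a.t0 a.t1) m
  linarith

lemma IsTop.unique {t n h1 l1 h2 l2 : ℝ} (a : Adm t n) (p1 : IsTop t n h1 l1)
    (p2 : IsTop t n h2 l2) : h1 = h2 ∧ l1 = l2 := by
  obtain rfl : l1 = l2 := le_antisymm (p2.max _ _ p1.pt) (p1.max _ _ p2.pt)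
  exact ⟨le_antisymm (isTop_le a p2 p1) (isTop_le a p1 p2), rfl⟩

/-! ### Elementary bounds for trigonometric functions. -/

lemma le_of_hasDerivAt_le {f g f' g' : ℝ → ℝ} (hf : ∀ x, HasDerivAt f (f' x) x)
    (hg : ∀ x, HasDerivAt g (g' x) x) (h0 : f 0 ≤ g 0) (hle : ∀ x, 0 < x → f' x ≤ g' x)
    {x : ℝ} (hx : 0 ≤ x) : f x ≤ g x := by
  have : MonotoneOn (fun x => g x - f x) (Set.Ici 0) := by
    apply monotoneOn_of_deriv_nonneg (convex_Ici 0)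
    · exact fun y _ => ((hg y).sub (hf y)).continuousAt.continuousWithinAt
    · exact fun y _ => ((hg y).sub (hf y)).differentiableAt.differentiableWithinAt
    · intro y hy
      rw [interior_Ici] at hy
      rw [((hg y).fun_sub (hf y)).deriv]
      linarith [hle y hy]
  have := this (Set.mem_Ici.2 le_rfl) (Set.mem_Ici.2 hx) hx
  simp only at this
  linarith

lemma cos_le_quartic {x : ℝ} (hx : 0 ≤ x) : cos x ≤ 1 - x ^ 2 / 2 + x ^ 4 / 24 := by
  refine le_of_hasDerivAt_le (f := cos) (g := fun x => 1 - x ^ 2 / 2 + x ^ 4 / 24)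
    (g' := fun x => -x + x ^ 3 / 6) hasDerivAt_cos (fun x => ?_) (by simp) (fun x hx => ?_) hx
  · have := (((hasDerivAt_pow 2 x).div_const 2).const_sub 1).add ((hasDerivAt_pow 4 x).div_const 24)
    exact this.congr_deriv (by norm_num; ring)
  · have := sin_ge_sub_cube hx.le
    linarith

lemma sin_le_quintic {x : ℝ} (hx : 0 ≤ x) : sin x ≤ x - x ^ 3 / 6 + x ^ 5 / 120 := by
  refine le_of_hasDerivAt_le (f := sin) (g := fun x => x - x ^ 3 / 6 + x ^ 5 / 120)
    (g' := fun x => 1 - x ^ 2 / 2 + x ^ 4 / 24) hasDerivAt_sin (fun x => ?_) (by simp)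
    (fun x hx => cos_le_quartic hx.le) hx
  have := ((hasDerivAt_id x).sub ((hasDerivAt_pow 3 x).div_const 6)).add
    ((hasDerivAt_pow 5 x).div_const 120)
  exact this.congr_deriv (by norm_num; ring)

lemma sextic_le_cos {x : ℝ} (hx : 0 ≤ x) :
    1 - x ^ 2 / 2 + x ^ 4 / 24 - x ^ 6 / 720 ≤ cos x := by
  refine le_of_hasDerivAt_le (g := cos) (f := fun x => 1 - x ^ 2 / 2 + x ^ 4 / 24 - x ^ 6 / 720)
    (f' := fun x => -x + x ^ 3 / 6 - x ^ 5 / 120) (fun x => ?_) hasDerivAt_cos (by simp)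
    (fun x hx => ?_) hx
  · have := ((((hasDerivAt_pow 2 x).div_const 2).const_sub 1).add
      ((hasDerivAt_pow 4 x).div_const 24)).sub ((hasDerivAt_pow 6 x).div_const 720)
    exact this.congr_deriv (by norm_num; ring)
  · have := sin_le_quintic hx.le
    linarith

lemma mul_cos_le_sin {x : ℝ} (h0 : 0 ≤ x) (h1 : x < π / 2) : x * cos x ≤ sin x := by
  have := le_tan h0 h1
  have hc : 0 < cos x := cos_pos_of_mem_Ioo ⟨by linarith, h1⟩
  rw [tan_eq_sin_div_cos, le_div_iff₀ hc] at this
  exact this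

/-- Since `z cos z ≤ sin z`, the product `cos z * exp (z^2 / 2)` decreases from 1. -/
lemma cos_le_exp {x : ℝ} (h : |x| < π / 2) : cos x ≤ exp (-(x ^ 2 / 2)) := by
  rw [← cos_abs, ← sq_abs]
  obtain ⟨y, hy⟩ : ∃ y, y = |x| := ⟨_, rfl⟩
  have h0 : 0 ≤ y := by rw [hy]; exact abs_nonneg x
  rw [← hy] at h ⊢
  have d : ∀ z, HasDerivAt (fun z => cos z * exp (z ^ 2 / 2))
      (exp (z ^ 2 / 2) * (z * cos z - sin z)) z := by
    intro z
    have := (hasDerivAt_cos z).mul (((hasDerivAt_pow 2 z).div_const 2).exp)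
    exact this.congr_deriv (by norm_num; ring)
  have anti : AntitoneOn (fun z => cos z * exp (z ^ 2 / 2)) (Set.Ico 0 (π / 2)) := by
    apply antitoneOn_of_deriv_nonpos (convex_Ico _ _)
    · exact fun z _ => (d z).continuousAt.continuousWithinAt
    · exact fun z _ => (d z).differentiableAt.differentiableWithinAt
    · intro z hz
      rw [interior_Ico] at hz
      rw [(d z).deriv]
      have := mul_cos_le_sin hz.1.le hz.2
      exact mul_nonpos_of_nonneg_of_nonpos (exp_pos _).le (by linarith)
  have := anti ⟨le_rfl, by linarith [pi_pos]⟩ ⟨h0, h⟩ h0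
  simp only [cos_zero] at this
  norm_num at this
  rw [exp_neg, ← one_div, le_div_iff₀ (exp_pos _)]
  exact this

lemma tan_le_of_le {h b T : ℝ} (h0 : 0 ≤ h) (hb : h ≤ b) (hb1 : b ≤ 1)
    (hT : b - b ^ 3 / 6 + b ^ 5 / 120 ≤ T * (1 - b ^ 2 / 2 + b ^ 4 / 24 - b ^ 6 / 720))
    (hT0 : 0 ≤ T) : tan h ≤ T := by
  have hp := pi_gt_three
  have b0 : 0 ≤ b := h0.trans hb
  have hc : 0 < cos b := cos_pos_of_mem_Ioo ⟨by linarith, by linarith⟩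
  have h1 : tan h ≤ tan b := by
    rcases hb.eq_or_lt with rfl | hb
    · rfl
    · exact (tan_lt_tan_of_lt_of_lt_pi_div_two (by linarith) (by linarith) hb).le
  refine h1.trans ?_
  rw [tan_eq_sin_div_cos, div_le_iff₀ hc]
  have := mul_le_mul_of_nonneg_left (sextic_le_cos b0) hT0
  linarith [sin_le_quintic b0]

lemma sin_le_mul_of_le {h h0 : ℝ} (hh0 : 0 ≤ h0) (hh : h0 ≤ h) (h1 : h ≤ 2) :
    sin h ≤ (1 - h0 ^ 2 / 6 + h0 ^ 4 / 120) * h := by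
  have hp : 0 ≤ h := hh0.trans hh
  have := sin_le_quintic hp
  have e : (1 - h0 ^ 2 / 6 + h0 ^ 4 / 120) * h - (h - h ^ 3 / 6 + h ^ 5 / 120) =
      h * ((h ^ 2 - h0 ^ 2) * (20 - h0 ^ 2 - h ^ 2)) / 120 := by ring
  have : 0 ≤ h * ((h ^ 2 - h0 ^ 2) * (20 - h0 ^ 2 - h ^ 2)) / 120 := by
    have : 0 ≤ h ^ 2 - h0 ^ 2 := by nlinarith
    have : 0 ≤ 20 - h0 ^ 2 - h ^ 2 := by nlinarith
    positivity
  linarith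

/-! ### Earlier times of the same parity. -/

/-- Downward propagation of the ratio of two consecutive values of a lobe. -/
lemma cos_add_le_of_le {β β' κ v : ℝ} (h0 : -(π / 2) < β) (h1 : β ≤ β') (h2 : β' < π / 2)
    (hv0 : 0 ≤ v) (hv1 : v ≤ π) (h : cos (β + v) ≤ κ * cos β) : cos (β' + v) ≤ κ * cos β' := by
  have c1 : 0 < cos β := cos_pos_of_mem_Ioo ⟨h0, by linarith⟩
  have c2 : 0 < cos β' := cos_pos_of_mem_Ioo ⟨by linarith, h2⟩
  have s1 : 0 ≤ sin (β' - β) := sin_nonneg_of_nonneg_of_le_pi (by linarith) (by linarith)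
  have s2 : 0 ≤ sin v := sin_nonneg_of_nonneg_of_le_pi hv0 hv1
  have e : cos (β' + v) * cos β = cos (β + v) * cos β' - sin v * sin (β' - β) := by
    rw [cos_add, cos_add, sin_sub]; ring
  have h3 : cos (β' + v) * cos β ≤ κ * cos β' * cos β := by
    rw [e]; nlinarith [mul_nonneg s2 s1]
  exact le_of_mul_le_mul_right h3 c1

/-- At a lobe point no earlier time of the same parity violates the sign conditions. -/
lemma LobePt.same_parity {t n h l : ℝ} (a : Adm t n) (hl : 0 < l) (p : LobePt t n h l) (j : ℕ)
    (hj : 2 * ((j : ℝ) + 1) ≤ n) :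
    lob t (n - 2 * (j + 1)) h l ≤ exp ((n - 2 * (j + 1)) * l) := by
  have d := p.dom
  have hpi := pi_pos
  have h3 := a.h_lt p.lt_cc
  induction j with
  | zero => simpa using p.le
  | succ j ih =>
    push_cast at hj ⊢
    have ih := ih (by linarith)
    obtain ⟨m, hm⟩ : ∃ m, m = n - 2 * ((j : ℝ) + 1) := ⟨_, rfl⟩
    rw [← hm] at ih
    rw [show n - 2 * ((j : ℝ) + 1 + 1) = m - 2 by rw [hm]; ring]
    have hm0 : 0 ≤ m - 2 := by rw [hm]; linarith
    by_cases hu : cc t - (m - 2) * h < π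
    · have hb : be t (m - 2) h l < π := by
        have := d.th_pos
        unfold be; linarith
      rw [lob_sub_two, ← be_sub_two]
      have hg := d.gR_pos a.t0 a.t1
      by_cases hb2 : be t (m - 2) h l < π / 2
      · have e1 := cos_be_add_le d a p.eq.ge p.le
        have hbm : be t n h l ≤ be t m h l := by
          have : m * h ≤ n * h := by
            apply mul_le_mul_of_nonneg_right _ d.h0.le
            rw [hm]; have : (0 : ℝ) ≤ j := j.cast_nonneg
            linarith
          unfold be; linarith
        rw [be_sub_two] at hb2 ⊢
        have e2 := cos_add_le_of_le (neg_pi_div_two_lt_be p.lt_cc) hbm (by linarith [d.h0])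
          (by linarith [d.h0]) (by linarith) e1
        rw [lob_eq] at ih
        have e3 : exp ((m - 2) * l) = exp (-2 * l) * exp (m * l) := by rw [← exp_add]; ring_nf
        rw [e3]
        calc gw t h l * rR h l * cos (be t m h l + 2 * h)
            ≤ gw t h l * rR h l * (exp (-2 * l) * cos (be t m h l)) :=
              mul_le_mul_of_nonneg_left e2 hg.le
          _ = exp (-2 * l) * (gw t h l * rR h l * cos (be t m h l)) := by ring
          _ ≤ _ := mul_le_mul_of_nonneg_left ih (exp_pos _).le
      · have : cos (be t (m - 2) h l) ≤ 0 :=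
          cos_nonpos_of_pi_div_two_le_of_le (not_lt.1 hb2) (by linarith)
        exact (mul_nonpos_of_nonneg_of_nonpos hg.le this).trans (exp_pos _).le
    -- Time 0 is separated because there the exponential equals 1 and the strict estimate
    -- `lob_lt_of_nonpos` does not apply.
    · rcases hm0.eq_or_lt with h0 | h0
      · rw [← h0, zero_mul, exp_zero]
        unfold lob
        rw [zero_mul, sub_zero]
        rw [← h0, zero_mul, sub_zero] at hu
        have s1 := sin_nonpos_of_mem (not_lt.1 hu) (cc_le a.t0)
        have := mul_nonpos_of_nonneg_of_nonpos d.Q0.le s1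
        have := cos_le_one (cc t)
        have := d.gw_le_one a.t0
        have := d.gw_pos a.t0 a.t1
        nlinarith
      · refine (lob_lt_of_nonpos d a.t0 a.t1 (by positivity)
          (sin_nonpos_of_mem (not_lt.1 hu) ?_)).le
        have := mul_pos h0 d.h0
        linarith [cc_le a.t0]

/-! ### Consequences of stationarity beyond the crest. -/

lemma rMd_eq (h l : ℝ) : rMd h l = rWd h l * cos h - rW h l * sin h := by
  refine (hasDerivAt_rW_mul_cos h l).unique ?_
  exact ((hasDerivAt_rW h l).mul (hasDerivAt_cos h)).congr_deriv (by ring)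

lemma one_add_rQ_sq {h l : ℝ} (d : Dom h l) :
    1 + rQ h l ^ 2 = 2 * (sin h ^ 2 + sinh l ^ 2) / (rW h l * cos h) ^ 2 := by
  have := d.S_sq
  have hy := d.y0
  have hW := d.W0
  field_simp at this ⊢
  linarith

/-- Logarithmic differentiation of the amplitude identity `one_add_rQ_sq`. -/
lemma rQ_mul_rQd {h l : ℝ} (d : Dom h l) :
    rQ h l * rQd h l = (1 + rQ h l ^ 2) *
      (sin h * cos h / (sin h ^ 2 + sinh l ^ 2) - rMd h l / (rW h l * cos h)) := by
  have hx := d.x0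
  have hy := d.y0
  have hW := d.W0
  have h1 : HasDerivAt (fun x => 1 + rQ x l ^ 2) (2 * (rQ h l * rQd h l)) h := by
    have := ((hasDerivAt_rQ d).pow 2).const_add 1
    exact this.congr_deriv (by norm_num; ring)
  have h2 : HasDerivAt (fun x => 2 * (sin x ^ 2 + sinh l ^ 2) / (rW x l * cos x) ^ 2)
      (2 * ((1 + rQ h l ^ 2) *
        (sin h * cos h / (sin h ^ 2 + sinh l ^ 2) - rMd h l / (rW h l * cos h)))) h := by
    have := ((((hasDerivAt_sin h).pow 2).add_const (sinh l ^ 2)).const_mul 2).div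
      ((hasDerivAt_rW_mul_cos h l).pow 2) (by positivity : (rW h l * cos h) ^ 2 ≠ 0)
    refine this.congr_deriv ?_
    rw [one_add_rQ_sq d]
    simp only [Pi.pow_apply]
    field_simp
    norm_num
    ring
  have h3 := h1.unique (h2.congr_of_eventuallyEq
    (d.eventually.mono fun x hx => one_add_rQ_sq hx))
  linarith

/-- An upper bound for the logarithmic derivative of the amplitude. -/
lemma mul_rQ_mul_rQd_le {h l : ℝ} (d : Dom h l) :
    h * (rQ h l * rQd h l) ≤ (1 + rQ h l ^ 2) * (h * tan h + sinh l / sin h) := by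
  have hx := d.x0
  have hy := d.y0
  have hW := d.W0
  have hp := d.p0
  have hh := d.h0
  have hC := one_le_rC h
  have hC0 := rC_pos h
  rw [rQ_mul_rQd d, mul_left_comm]
  apply mul_le_mul_of_nonneg_left _ (by positivity)
  have e1 : sin h * cos h / (sin h ^ 2 + sinh l ^ 2) ≤ cos h / sin h := by
    rw [div_le_div_iff₀ (by positivity) hx]
    nlinarith [mul_nonneg hy.le (sq_nonneg (sinh l))]
  have e2 : cos h / sin h - rMd h l / (rW h l * cos h) =
      tan h + cos h * sinh l / (rC h * sin h * rW h l) := by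
    rw [rMd_eq, tan_eq_sin_div_cos]
    field_simp
    unfold rWd rW
    field_simp
    linear_combination (cos h ^ 2 * sinh l) * rC_sq h
  have e3 : h * (cos h * sinh l / (rC h * sin h * rW h l)) ≤ sinh l / sin h := by
    have f1 : h * cos h ≤ rW h l := by
      have := mul_cos_le_sin hh.le d.h1
      linarith [d.le_W]
    rw [mul_div_assoc', div_le_div_iff₀ (by positivity) hx]
    have f2 : h * cos h ≤ rC h * rW h l := by nlinarith
    have : 0 ≤ sinh l * sin h := by positivity
    nlinarith
  calc h * (sin h * cos h / (sin h ^ 2 + sinh l ^ 2) - rMd h l / (rW h l * cos h))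
      ≤ h * (cos h / sin h - rMd h l / (rW h l * cos h)) := by
        apply mul_le_mul_of_nonneg_left _ hh.le; linarith
    _ = h * tan h + h * (cos h * sinh l / (rC h * sin h * rW h l)) := by rw [e2]; ring
    _ ≤ _ := by linarith

/-- The inequality obtained from the stationarity of the lobe function at a top beyond the
crest. -/
lemma mul_tan_neg_be_le {t n h l : ℝ} (d : Dom h l)
    (hb : be t n h l ≤ 0) (hb1 : -(π / 2) < be t n h l) {e : ℝ} (he : 0 ≤ e * rR h l ^ 2 + n *
      (rR h l ^ 2 * tan (be t n h l)) + rQd h l * (tan (be t n h l) + rQ h l)) :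
    n * h * tan (-be t n h l) ≤ h * tan h + sinh l / sin h + h * e := by
  have hR := rR_pos h l
  have hk : 0 ≤ tan (-be t n h l) :=
    tan_nonneg_of_nonneg_of_le_pi_div_two (by linarith) (by linarith)
  have hd := d.rQd_pos
  rw [show tan (be t n h l) = -tan (-be t n h l) by rw [tan_neg, neg_neg]] at he
  have h1 := mul_rQ_mul_rQd_le d
  rw [← rR_sq] at h1
  have h2 : n * h * tan (-be t n h l) * rR h l ^ 2 ≤
      (h * tan h + sinh l / sin h + h * e) * rR h l ^ 2 := by
    have := mul_nonneg d.h0.le he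
    have := mul_nonneg d.h0.le (mul_nonneg hd.le hk)
    nlinarith
  exact le_of_mul_le_mul_right h2 (by positivity)

lemma qd_eq {t n h l : ℝ} (hc : 0 < cos (be t n h l)) :
    rR h l * qd t n h l = cos (be t n h l) * (n * (rR h l ^ 2 * tan (be t n h l)) +
      rQd h l * (tan (be t n h l) + rQ h l)) := by
  have e1 : sin (cc t - n * h) - rQ h l * cos (cc t - n * h) = rR h l * sin (be t n h l) := by
    rw [be, sin_sub (cc t - n * h)]
    linear_combination -sin (cc t - n * h) * cos_th h l + cos (cc t - n * h) * sin_th h l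
  have e2 : rR h l * sin (cc t - n * h) =
      sin (be t n h l) + rQ h l * cos (be t n h l) := by
    rw [show cc t - n * h = be t n h l + th h l by unfold be; ring, sin_add]
    linear_combination sin (be t n h l) * cos_th h l + cos (be t n h l) * sin_th h l
  rw [qd, e1, mul_add, show rR h l * (rQd h l * sin (cc t - n * h)) =
    rQd h l * (rR h l * sin (cc t - n * h)) by ring, e2, tan_eq_sin_div_cos]
  field_simp

/-- The left derivative condition at a top, divided by weight and cosine, bounds the overshoot past
the crest; the last term is `h` times the logarithmic derivative of `gw` and vanishes for `t = 0`.
-/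
lemma IsTop.mul_tan_le {t n h l : ℝ} (p : IsTop t n h l) (a : Adm t n) (hb : be t n h l ≤ 0) :
    n * h * tan (-be t n h l) ≤ h * tan h + sinh l / sin h +
      h * (2 * t * sinh l * cos h / ((sin h + t * sinh l) * (sin h - t * sinh l))) := by
  have d := p.pt.dom
  have hc := cos_be_pos d a p.pt.eq.ge
  have hg := d.gw_pos a.t0 a.t1
  have hR := rR_pos h l
  have h1 : 0 < sin h + t * sinh l := by
    have := d.x0
    have := mul_nonneg a.t0 d.p0
    linarith
  have h2 : 0 < sin h - t * sinh l := by
    have := d.lt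
    have : t * sinh l ≤ sinh l := by nlinarith [d.p0, a.t1]
    linarith
  refine mul_tan_neg_be_le d hb (neg_pi_div_two_lt_be p.pt.lt_cc) ?_
  have h3 := p.deriv_nonneg a
  rw [← rR_mul_cos_sub_th, show cc t - n * h - th h l = be t n h l from rfl] at h3
  have h4 : 2 * t * sinh l * cos h / (sin h + t * sinh l) ^ 2 = gw t h l *
      (2 * t * sinh l * cos h / ((sin h + t * sinh l) * (sin h - t * sinh l))) := by
    unfold gw
    field_simp
  rw [h4, mul_assoc, ← mul_add, mul_nonneg_iff_of_pos_left hg] at h3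
  have h5 := mul_nonneg hR.le h3
  rw [mul_add, qd_eq hc] at h5
  have h6 : 0 ≤ cos (be t n h l) * (2 * t * sinh l * cos h /
      ((sin h + t * sinh l) * (sin h - t * sinh l)) * rR h l ^ 2 +
      n * (rR h l ^ 2 * tan (be t n h l)) + rQd h l * (tan (be t n h l) + rQ h l)) := by
    linarith
  exact nonneg_of_mul_nonneg_right h6 hc

lemma gw_zero {h l : ℝ} (d : Dom h l) : gw 0 h l = 1 := by
  unfold gw
  rw [zero_mul, sub_zero, add_zero, div_self d.x0.ne']

lemma exp_le_rR_of_le {t n h l : ℝ} (d : Dom h l) (a : Adm t n)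
    (he : exp (n * l) ≤ lob t n h l) : exp (n * l) ≤ rR h l := by
  rw [lob_eq] at he
  have h1 := d.gw_le_one a.t0
  have h2 := d.gw_pos a.t0 a.t1
  have h3 := rR_pos h l
  have h4 := cos_le_one (be t n h l)
  have h5 := mul_le_of_le_one_left h3.le h1
  have h6 := d.gR_pos a.t0 a.t1
  nlinarith

lemma rR_mul_cos_sq_le {h l : ℝ} (d : Dom h l) : (rR h l * cos h) ^ 2 ≤ 2 := by
  rw [mul_pow, rR_sq, mul_comm]
  exact d.S_sq_le

/-- The exponential is at most the amplitude, which is at most `√2 / cos h < 2√2 < exp 1.05`. -/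
lemma mul_le_of_exp_le {t n h l : ℝ} (d : Dom h l) (a : Adm t n) (hh : n * h < cc t)
    (he : exp (n * l) ≤ lob t n h l) : n * l ≤ 105 / 100 := by
  have h1 := exp_le_rR_of_le d a he
  have h2 := rR_mul_cos_sq_le d
  have h3 := half_lt_cos d.h0.le (a.h_lt hh)
  have h4 := rR_pos h l
  have h5 : rR h l < 285 / 100 := by
    by_contra hc
    push Not at hc
    have : 285 / 200 < rR h l * cos h := by nlinarith
    nlinarith
  by_contra hc
  push Not at hc
  have e1 : exp (105 / 100) < exp (n * l) := exp_lt_exp.2 hc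
  have e2 : exp (105 / 100) = exp 1 * exp (5 / 100) := by rw [← exp_add]; norm_num
  have e3 := Real.add_one_le_exp (5 / 100 : ℝ)
  have e4 := Real.exp_one_gt_d9
  nlinarith [exp_pos (5 / 100)]

/-! ### The numerical inequality at even tops. -/

lemma sqrt_three_bounds : √3 < 1.7321 := by
  rw [Real.sqrt_lt' (by norm_num)]; norm_num

lemma tan_lt_of_lt_pi_div_three {h : ℝ} (h0 : 0 ≤ h) (h1 : h < π / 3) : tan h < 1.7321 := by
  have hp := pi_pos
  have := tan_lt_tan_of_lt_of_lt_pi_div_two (by linarith) (by linarith) h1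
  rw [tan_pi_div_three] at this
  exact this.trans sqrt_three_bounds

/-- The numerical core: a lower bound for `σ` makes the linear term dominate. -/
lemma sq_le_of_bounds {ρ a b s0 σ κ ν N0 c : ℝ} (hρ : 0 ≤ ρ) (ha : 0 ≤ a) (hb : 0 ≤ b)
    (hκ : κ ≤ a + b * σ) (hκ0 : 0 ≤ κ) (hσ : 0 < σ) (hσ1 : σ ≤ 35 / 100) (hs0 : 0 < s0)
    (hN0 : 0 ≤ N0) (hν : ν ≤ N0 + κ)
    (H : 6931 / 10000 + c ≤ 2 * ν * σ * ρ + κ ^ 2 + σ ^ 2 + 2 * (14143 / 10000) * σ)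
    (low : 2 * (N0 + (a + b * s0)) * s0 * ρ + (a + b * s0) ^ 2 + s0 ^ 2 +
      2 * (14143 / 10000) * s0 < 6931 / 10000 + c)
    (e0 : (a + b * s0) ^ 2 ≤
      s0 * (4 - ρ * (31416 / 10000 + 2 * (a + b * s0)) - s0 * ρ ^ 2))
    (e1 : (a + b * (35 / 100)) ^ 2 ≤
      35 / 100 * (4 - ρ * (31416 / 10000 + 2 * (a + b * (35 / 100))) - 35 / 100 * ρ ^ 2)) :
    κ ^ 2 ≤ σ * (4 - ρ * (31416 / 10000 + 2 * κ) - σ * ρ ^ 2) := by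
  -- For `σ < s0` the right side of `H` would be too small, by `low`.
  have hs : s0 ≤ σ := by
    by_contra hc
    push Not at hc
    have k1 : κ ≤ a + b * s0 := by nlinarith
    have f1 : κ ^ 2 ≤ (a + b * s0) ^ 2 := pow_le_pow_left₀ hκ0 k1 2
    have f2 : σ ^ 2 ≤ s0 ^ 2 := pow_le_pow_left₀ hσ.le hc.le 2
    have f3 : 2 * ν * σ * ρ ≤ 2 * (N0 + (a + b * s0)) * s0 * ρ := by
      apply mul_le_mul_of_nonneg_right _ hρ
      have : ν * σ ≤ (N0 + (a + b * s0)) * s0 :=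
        (mul_le_mul_of_nonneg_right (by linarith) hσ.le).trans
          (mul_le_mul_of_nonneg_left hc.le (by positivity))
      linarith
    linarith
  have g1 : κ ^ 2 ≤ (a + b * σ) ^ 2 := pow_le_pow_left₀ hκ0 hκ 2
  have g2 : σ * (4 - ρ * (31416 / 10000 + 2 * (a + b * σ)) - σ * ρ ^ 2) ≤
      σ * (4 - ρ * (31416 / 10000 + 2 * κ) - σ * ρ ^ 2) := by
    apply mul_le_mul_of_nonneg_left _ hσ.le
    nlinarith
  refine g1.trans (le_trans ?_ g2)
  obtain ⟨F, hF⟩ : ∃ F : ℝ → ℝ, F = fun x => x * (4 - ρ * (31416 / 10000 + 2 * (a + b * x)) -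
    x * ρ ^ 2) - (a + b * x) ^ 2 := ⟨_, rfl⟩
  -- Chord identity for a concave quadratic: `F` has leading coefficient `-(2ρb + ρ^2 + b^2)`, so
  -- nonnegativity at `s0` and `35/100` gives it in between.
  have c1 : (35 / 100 - s0) * F σ = (35 / 100 - σ) * F s0 + (σ - s0) * F (35 / 100) +
      (35 / 100 - s0) * (σ - s0) * (35 / 100 - σ) * (2 * ρ * b + ρ ^ 2 + b ^ 2) := by
    rw [hF]; ring
  have F0 : 0 ≤ F s0 := by rw [hF]; simpa using e0
  have F1 : 0 ≤ F (35 / 100) := by rw [hF]; simpa using e1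
  rcases hs.eq_or_lt with rfl | hs
  · rw [hF] at F0; simp only at F0; linarith
  have c2 : 0 < 35 / 100 - s0 := by linarith
  have d1 : 0 ≤ σ - s0 := by linarith
  have d2 : 0 ≤ 35 / 100 - σ := by linarith
  have c3 : 0 ≤ (35 / 100 - s0) * F σ := by rw [c1]; positivity
  have c4 := nonneg_of_mul_nonneg_right c3 c2
  rw [hF] at c4
  simp only at c4
  linarith

lemma rC_lt_of_dom {h l : ℝ} (d : Dom h l) : rC h ≤ 14143 / 10000 := by
  unfold rC
  rw [Real.sqrt_le_left (by norm_num)]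
  nlinarith [d.x1, d.x0]

lemma rW_le {h l : ℝ} (d : Dom h l) :
    rW h l ≤ sin h * exp (sinh l ^ 2 / 2 + rC h * (sinh l / sin h)) := by
  have hx := d.x0
  have hp := d.p0
  have hC := rC_pos h
  have h1 : cosh l ≤ exp (sinh l ^ 2 / 2) := by
    refine (cosh_le_exp_half_sq l).trans (exp_le_exp.2 ?_)
    have := Real.self_le_sinh_iff.2 d.l0
    have := pow_le_pow_left₀ d.l0 this 2
    linarith
  have h2 : 1 ≤ exp (sinh l ^ 2 / 2) := Real.one_le_exp (by positivity)
  have h3 := Real.add_one_le_exp (rC h * (sinh l / sin h))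
  have h4 : 0 ≤ rC h * (sinh l / sin h) := by positivity
  have h5 : rW h l = sin h * (cosh l + rC h * (sinh l / sin h)) := by
    unfold rW; field_simp
  rw [h5, exp_add]
  apply mul_le_mul_of_nonneg_left _ hx.le
  nlinarith

/-- Logarithm of the equality `exp (n l) = rR * cos be`, with the amplitude identity, `cos h ≤ exp
(-h^2/2)` and `rW_le`. Since the left side is at least `log 2`, the ratio `sinh l / sin h` cannot be
too small. -/
lemma log_two_add_sq_le {n h l : ℝ} (a : Adm 0 n) (p : LobePt 0 n h l) :
    log 2 + h ^ 2 ≤ 2 * (n * l) + tan (be 0 n h l) ^ 2 + (sinh l / sin h) ^ 2 +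
      2 * (14143 / 10000) * (sinh l / sin h) := by
  have d := p.dom
  have hx := d.x0
  have hy := d.y0
  have hW := d.W0
  have hp := d.p0
  have hcos := cos_be_pos d a p.eq.ge
  have h1 := p.eq
  rw [lob_eq, gw_zero d, one_mul] at h1
  have h2 := one_add_rQ_sq d
  rw [← rR_sq] at h2
  have h3 : rR h l ^ 2 = exp (2 * (n * l)) * (1 + tan (be 0 n h l) ^ 2) := by
    have : exp (2 * (n * l)) = (rR h l * cos (be 0 n h l)) ^ 2 := by
      rw [h1, ← Real.exp_nat_mul]; norm_num
    rw [this, tan_eq_sin_div_cos]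
    field_simp
    rw [cos_sq_add_sin_sq, mul_one]
  have h4 : 2 * sin h ^ 2 ≤ rR h l ^ 2 * (rW h l * cos h) ^ 2 := by
    rw [h2]
    field_simp
    nlinarith [sq_nonneg (sinh l)]
  have h5 := Real.add_one_le_exp (tan (be 0 n h l) ^ 2)
  have h6 : cos h ^ 2 ≤ exp (-h ^ 2) := by
    have := cos_le_exp (x := h) (by rw [abs_of_pos d.h0]; exact d.h1)
    have := pow_le_pow_left₀ hy.le this 2
    rw [← Real.exp_nat_mul] at this
    rwa [show ((2 : ℕ) : ℝ) * -(h ^ 2 / 2) = -h ^ 2 by push_cast; ring] at this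
  have h7 : rW h l ^ 2 ≤ sin h ^ 2 *
      exp (sinh l ^ 2 + 2 * (rC h * (sinh l / sin h))) := by
    have := pow_le_pow_left₀ hW.le (rW_le d) 2
    rw [mul_pow, ← Real.exp_nat_mul] at this
    rwa [show ((2 : ℕ) : ℝ) * (sinh l ^ 2 / 2 + rC h * (sinh l / sin h)) =
      sinh l ^ 2 + 2 * (rC h * (sinh l / sin h)) by push_cast; ring] at this
  have h8 : 2 ≤ exp (2 * (n * l) + tan (be 0 n h l) ^ 2 + (-h ^ 2) +
      (sinh l ^ 2 + 2 * (rC h * (sinh l / sin h)))) := by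
    rw [exp_add, exp_add, exp_add]
    have c1 : rR h l ^ 2 ≤ exp (2 * (n * l)) * exp (tan (be 0 n h l) ^ 2) := by
      rw [h3]
      apply mul_le_mul_of_nonneg_left _ (exp_pos _).le
      linarith
    have c2 : rR h l ^ 2 * (rW h l * cos h) ^ 2 ≤
        (exp (2 * (n * l)) * exp (tan (be 0 n h l) ^ 2)) * ((sin h ^ 2 *
          exp (sinh l ^ 2 + 2 * (rC h * (sinh l / sin h)))) * exp (-h ^ 2)) := by
      rw [mul_pow]
      gcongr
    have c3 := h4.trans c2
    have : 0 < sin h ^ 2 := by positivity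
    refine le_of_mul_le_mul_right (c3.trans_eq ?_) this
    ring
  have h9 := (Real.log_le_iff_le_exp zero_lt_two).2 h8
  have h10 : sinh l ^ 2 ≤ (sinh l / sin h) ^ 2 := by
    apply pow_le_pow_left₀ hp
    rw [le_div_iff₀ hx]
    nlinarith [d.x1]
  have h11 : rC h * (sinh l / sin h) ≤ 14143 / 10000 * (sinh l / sin h) :=
    mul_le_mul_of_nonneg_right (rC_lt_of_dom d) (by positivity)
  linarith

lemma sinh_div_sin_le {n h l : ℝ} (d : Dom h l) (hh : h < π / 3) (hnl : n * l ≤ 105 / 100)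
    (hn : 3 * π / 2 ≤ n * h) : sinh l / sin h ≤ 35 / 100 := by
  have hp := pi_gt_d2
  have hp2 := pi_lt_d2
  have h0 := d.h0
  have hn0 : 0 < n := by
    by_contra hc
    push Not at hc
    nlinarith
  have h1 : 471 / 100 * l ≤ 105 / 100 * h := by
    have : n * (471 / 100 * l) ≤ n * (105 / 100 * h) := by nlinarith
    exact le_of_mul_le_mul_left this hn0
  have h2 := sinh_le_of_le d.l0 (by linarith)
  have h3 := sin_ge_sub_cube h0.le
  have h4 : h ^ 2 ≤ 1103 / 1000 := by nlinarith
  have h5 : h ^ 3 ≤ 1103 / 1000 * h := by nlinarith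
  rw [div_le_iff₀ d.x0]
  linarith

lemma pi_div_four_le_th {h l : ℝ} (d : Dom h l) (hh : 85 / 100 ≤ h)
    (hσ : sinh l / sin h ≤ 35 / 100) : π / 4 ≤ th h l := by
  rw [← arctan_one]
  apply arctan_strictMono.monotone
  have hx := d.x0
  have hy := d.y0
  have hp := d.p0
  have hW := d.W0
  have hp2 := pi_gt_three
  have s1 : 747 / 1000 ≤ sin h := by
    have e1 := sin_ge_sub_cube (x := 85 / 100) (by norm_num)
    have := sin_le_sin_of_le_of_le_pi_div_two (by linarith) d.h1.le hh
    norm_num at e1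
    linarith
  have c1 : cos h ≤ 665 / 1000 := by nlinarith [sin_sq_add_cos_sq h]
  have c2 : 1248 / 1000 ≤ rC h := by
    have := rC_sq h
    nlinarith [rC_pos h]
  rw [div_le_iff₀ hx] at hσ
  have e : 2 * sinh l / rW h l ≤ 49 / 100 := by
    rw [div_le_iff₀ hW]
    unfold rW
    have f1 := mul_le_mul_of_nonneg_left (one_le_cosh l) hx.le
    have f2 := mul_le_mul_of_nonneg_right c2 hp
    linarith
  unfold rQ rN
  rw [le_div_iff₀ hy, one_mul]
  linarith

lemma div_le_sinh_div_sin {h l : ℝ} (d : Dom h l) : l / h ≤ sinh l / sin h * (sin h / h) := by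
  have hx := d.x0
  have hh := d.h0
  have h1 := Real.self_le_sinh_iff.2 d.l0
  rw [div_mul_div_cancel₀ hx.ne']
  exact div_le_div_of_nonneg_right h1 hh.le

/-- Equality at both `n` and `n - 2` determines the phase: `tan be = (cos 2h - exp (-2l)) / sin 2h`,
which is then estimated. -/
lemma tan_be_le_of_eq {t n h l : ℝ} (d : Dom h l) (a : Adm t n) (hh : h < π / 3)
    (h2p : 2 * sinh l < sin h) (hc : 0 < cos (be t n h l)) (he : lob t n h l = exp (n * l))
    (he2 : lob t (n - 2) h l = exp ((n - 2) * l)) : tan (be t n h l) ≤ l / h := by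
  have hx := d.x0
  have hy := d.y0
  have h0 := d.h0
  have hg := d.gR_pos a.t0 a.t1
  have hs2 := sin_two_mul_pos d.h0 d.h1
  rw [lob_eq] at he
  rw [lob_sub_two] at he2
  have e : exp ((n - 2) * l) = exp (-2 * l) * exp (n * l) := by rw [← exp_add]; ring_nf
  rw [e, ← he] at he2
  have e1 : cos (be t n h l + 2 * h) = exp (-2 * l) * cos (be t n h l) := by
    apply mul_left_cancel₀ hg.ne'
    linarith
  have e2 : tan (be t n h l) = (cos (2 * h) - exp (-2 * l)) / sin (2 * h) := by
    rw [cos_add] at e1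
    rw [tan_eq_sin_div_cos, div_eq_div_iff hc.ne' hs2.ne']
    linarith
  rw [e2, div_le_div_iff₀ hs2 h0]
  have e3 := Real.add_one_le_exp (-2 * l)
  have e4 := Real.self_le_sinh_iff.2 d.l0
  have e5 := sin_ge_sub_cube (x := 2 * h) (by linarith)
  have hp := pi_lt_d2
  have e6 := sin_ge_sub_cube h0.le
  have e7 : h ^ 2 ≤ 1103 / 1000 := by nlinarith
  have e8 : h ^ 3 ≤ 1103 / 1000 * h := by nlinarith
  have e9 : 4 / 5 * h ≤ sin h := by linarith
  rw [cos_two_mul, cos_sq']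
  have f1 : (2 * (1 - sin h ^ 2) - 1 - exp (-2 * l)) * h ≤ (2 * l - 2 * sin h ^ 2) * h :=
    mul_le_mul_of_nonneg_right (by linarith) h0.le
  have f2 : l * (2 * h - sin (2 * h)) ≤ 2 * sin h ^ 2 * h := by
    have g1 : 2 * h - sin (2 * h) ≤ 4 / 3 * (h * h ^ 2) := by linarith
    have g2 : 0 ≤ 2 * h - sin (2 * h) := by
      have := sin_le (x := 2 * h) (by linarith)
      linarith
    have g3 : l * (2 * h - sin (2 * h)) ≤ sin h / 2 * (4 / 3 * (h * h ^ 2)) :=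
      mul_le_mul (by linarith) g1 g2 (by positivity)
    have g4 : h ^ 2 ≤ 3 * sin h := by nlinarith
    have g5 : sin h * h * h ^ 2 ≤ sin h * h * (3 * sin h) :=
      mul_le_mul_of_nonneg_left g4 (by positivity)
    linarith
  linarith

lemma IsTop.sq_tan_le {n h l : ℝ} (p : IsTop 0 n h l) (a : Adm 0 n) (hb : be 0 n h l < 0) :
    tan (-be 0 n h l) ^ 2 ≤ sinh l / sin h *
      (4 - sin h / h * (31416 / 10000 + 2 * tan (-be 0 n h l)) -
        sinh l / sin h * (sin h / h) ^ 2) := by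
  have d := p.pt.dom
  have hx := d.x0
  have h0 := d.h0
  have hh := a.h_lt p.pt.lt_cc
  have hp1 := pi_gt_d4
  have hp2 := pi_lt_d4
  have hn0 := a.n0
  have hn6 : 6 ≤ n := by rcases a with ⟨-, h⟩ | ⟨h, -⟩ <;> linarith
  have hbe : n * h = 2 * π - th h l - be 0 n h l := by unfold be cc; ring
  have hth := th_lt h l
  have hth0 := d.th_pos
  have hnl := mul_le_of_exp_le d a p.pt.lt_cc p.pt.eq.ge
  have hν : 3 * π / 2 ≤ n * h := by linarith
  have hσ1 := sinh_div_sin_le d hh hnl hν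
  have hth4 : 85 / 100 ≤ h → π / 4 ≤ th h l := fun h1 => pi_div_four_le_th d h1 hσ1
  have hb1 := neg_pi_div_two_lt_be (l := l) p.pt.lt_cc
  have hκβ : -be 0 n h l ≤ tan (-be 0 n h l) := le_tan (by linarith) (by linarith)
  have hK := p.mul_tan_le a hb.le
  have hL := log_two_add_sq_le a p.pt
  have hlog := Real.log_two_gt_d9
  have hs := div_le_sinh_div_sin d
  have hnl2 : n * l = n * h * (l / h) := by field_simp
  rw [mul_zero, zero_mul, zero_mul, zero_div, mul_zero, add_zero] at hK
  rw [show tan (be 0 n h l) ^ 2 = tan (-be 0 n h l) ^ 2 by rw [tan_neg, neg_sq]] at hL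
  have hσ0 : 0 < sinh l / sin h := div_pos (Real.sinh_pos_iff.2 p.pos) hx
  have hκ0 : 0 ≤ tan (-be 0 n h l) := by linarith
  generalize tan (-be 0 n h l) = κ at *
  generalize sinh l / sin h = σ at *
  have hρ0 : 0 < sin h / h := by positivity
  have red : ∀ ρ, sin h / h ≤ ρ → κ ^ 2 ≤ σ * (4 - ρ * (31416 / 10000 + 2 * κ) - σ * ρ ^ 2) →
      κ ^ 2 ≤ σ * (4 - sin h / h * (31416 / 10000 + 2 * κ) - σ * (sin h / h) ^ 2) := by
    intro ρ h1 h2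
    refine h2.trans (mul_le_mul_of_nonneg_left ?_ hσ0.le)
    have := pow_le_pow_left₀ hρ0.le h1 2
    have := mul_le_mul_of_nonneg_left this hσ0.le
    have := mul_le_mul_of_nonneg_right h1 (by linarith : 0 ≤ 31416 / 10000 + 2 * κ)
    linarith
  have hH : ∀ ρ c, sin h / h ≤ ρ → c ≤ h ^ 2 →
      6931 / 10000 + c ≤ 2 * (n * h) * σ * ρ + κ ^ 2 + σ ^ 2 + 2 * (14143 / 10000) * σ := by
    intro ρ c h1 h2
    have f1 : l / h ≤ σ * ρ := hs.trans (mul_le_mul_of_nonneg_left h1 hσ0.le)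
    have f2 : n * h * (l / h) ≤ n * h * (σ * ρ) := mul_le_mul_of_nonneg_left f1 (by positivity)
    linarith
  have hρ : ∀ h1, 0 ≤ h1 → h1 ≤ h → sin h / h ≤ 1 - h1 ^ 2 / 6 + h1 ^ 4 / 120 := by
    intro h1 e1 e2
    rw [div_le_iff₀ h0]
    exact sin_le_mul_of_le e1 e2 (by linarith)
  have early : ∀ b T, h ≤ b → b ≤ 1 → 0 ≤ T →
      b - b ^ 3 / 6 + b ^ 5 / 120 ≤ T * (1 - b ^ 2 / 2 + b ^ 4 / 24 - b ^ 6 / 720) →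
      κ ≤ b * T / (471 / 100) + 1 / (471 / 100) * σ := by
    intro b T e1 e2 e3 e4
    have f1 := tan_le_of_le h0.le e1 e2 e4 e3
    have f2 : h * tan h ≤ b * T :=
      mul_le_mul e1 f1 (by linarith [le_tan h0.le d.h1]) (by linarith)
    have f3 : 471 / 100 * κ ≤ n * h * κ := mul_le_mul_of_nonneg_right (by linarith) hκ0
    linarith
  have late : ∀ h1 T, 0 < h1 → h1 ≤ h → tan h ≤ T → κ ≤ T / 6 + 1 / (6 * h1) * σ := by
    intro h1 T e0 e1 f1
    have f3 : h * (6 * κ) ≤ h * (T + σ / h) := by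
      have : h * (T + σ / h) = h * T + σ := by field_simp
      rw [this]
      have := mul_le_mul_of_nonneg_left f1 h0.le
      have := mul_le_mul_of_nonneg_right hn6 (mul_nonneg h0.le hκ0)
      linarith
    have f4 := le_of_mul_le_mul_left f3 h0
    have f5 : σ / h ≤ σ / h1 := div_le_div_of_nonneg_left hσ0.le e0 e1
    have f6 : 1 / (6 * h1) * σ = σ / h1 / 6 := by field_simp
    rw [f6]
    linarith
  have hN1 : n * h ≤ 62832 / 10000 + κ := by linarith
  have hN2 : 85 / 100 ≤ h → n * h ≤ 54979 / 10000 + κ := by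
    intro h1
    have := hth4 h1
    linarith
  -- Larger angles contradict `6 h ≤ n h`, as `n h` is at most `7π/4` plus the overshoot.
  have hmax : h ≤ 975 / 1000 := by
    by_contra hc
    push Not at hc
    have f1 := late (975 / 1000) 1.7321 (by norm_num) hc.le (tan_lt_of_lt_pi_div_three h0.le hh).le
    have f2 := hN2 (by linarith)
    have f3 : 6 * h ≤ n * h := mul_le_mul_of_nonneg_right hn6 h0.le
    norm_num at f1
    linarith
  -- Five ranges of `h`. In each, the left end bounds `sin h / h` above and `h^2` below, the right
  -- end bounds `tan h`, and `s0` is the resulting lower bound for `σ`.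
  rcases le_total h (6 / 10) with g1 | g1
  · have k := early (6 / 10) (685 / 1000) g1 (by norm_num) (by norm_num) (by norm_num)
    refine red _ (hρ 0 le_rfl h0.le) (sq_le_of_bounds (by norm_num) ?_ ?_ k hκ0 hσ0 hσ1
      (s0 := 4 / 100) ?_ ?_ hN1 (hH _ 0 (hρ 0 le_rfl h0.le) (sq_nonneg h)) ?_ ?_ ?_) <;> norm_num
  have sq : ∀ h1, 0 ≤ h1 → h1 ≤ h → h1 ^ 2 ≤ h ^ 2 := fun h1 e1 e2 => pow_le_pow_left₀ e1 e2 2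
  rcases le_total h (75 / 100) with g2 | g2
  · have k := early (75 / 100) (932 / 1000) g2 (by norm_num) (by norm_num) (by norm_num)
    have r := hρ (6 / 10) (by norm_num) g1
    refine red _ r (sq_le_of_bounds (by norm_num) ?_ ?_ k hκ0 hσ0 hσ1
      (s0 := 65 / 1000) ?_ ?_ hN1 (hH _ _ r (sq _ (by norm_num) g1)) ?_ ?_ ?_) <;> norm_num
  rcases le_total h (85 / 100) with g3 | g3
  · have k := late (75 / 100) (1139 / 1000) (by norm_num) g2
      (tan_le_of_le h0.le g3 (by norm_num) (by norm_num) (by norm_num))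
    have r := hρ (75 / 100) (by norm_num) g2
    refine red _ r (sq_le_of_bounds (by norm_num) ?_ ?_ k hκ0 hσ0 hσ1
      (s0 := 8 / 100) ?_ ?_ hN1 (hH _ _ r (sq _ (by norm_num) g2)) ?_ ?_ ?_) <;> norm_num
  rcases le_total h (91 / 100) with g4 | g4
  · have k := late (85 / 100) (1287 / 1000) (by norm_num) g3
      (tan_le_of_le h0.le g4 (by norm_num) (by norm_num) (by norm_num))
    have r := hρ (85 / 100) (by norm_num) g3
    refine red _ r (sq_le_of_bounds (by norm_num) ?_ ?_ k hκ0 hσ0 hσ1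
      (s0 := 1 / 10) ?_ ?_ (hN2 g3) (hH _ _ r (sq _ (by norm_num) g3)) ?_ ?_ ?_) <;> norm_num
  · have k := late (91 / 100) (1476 / 1000) (by norm_num) g4
      (tan_le_of_le h0.le hmax (by norm_num) (by norm_num) (by norm_num))
    have r := hρ (91 / 100) (by norm_num) g4
    refine red _ r (sq_le_of_bounds (by norm_num) ?_ ?_ k hκ0 hσ0 hσ1
      (s0 := 11 / 100) ?_ ?_ (hN2 g3) (hH _ _ r (sq _ (by norm_num) g4)) ?_ ?_ ?_) <;> norm_num

/-- This is what the Gaussian comparison in `IsTop.lob_one_le` consumes. Past the crest it follows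
from `IsTop.sq_tan_le`; before it, the constraint at `n - 2` is active and `tan be ≤ l / h` is
small. -/
lemma IsTop.slope_bound {n h l : ℝ} (p : IsTop 0 n h l) (a : Adm 0 n) :
    l / h * (π / 2 - be 0 n h l) + (l / h) ^ 2 / 2 + tan (be 0 n h l) ^ 2 / 2 ≤
      2 * (sinh l / sin h) := by
  have d := p.pt.dom
  have hx := d.x0
  have h0 := d.h0
  have hs := div_le_sinh_div_sin d
  have hs0 : 0 ≤ l / h := div_nonneg d.l0 h0.le
  have hρ0 : 0 < sin h / h := by positivity
  have hρ1 : sin h / h ≤ 1 := by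
    rw [div_le_one h0]; exact sin_le h0.le
  have hσ0 : 0 ≤ sinh l / sin h := div_nonneg d.p0 hx.le
  have hpi := pi_lt_d4
  have hpi2 := pi_gt_d4
  have hc := cos_be_pos d a p.pt.eq.ge
  rcases lt_or_ge (be 0 n h l) 0 with hb | hb
  · have h1 := p.sq_tan_le a hb
    have hb1 := neg_pi_div_two_lt_be (l := l) p.pt.lt_cc
    have hκβ : -be 0 n h l ≤ tan (-be 0 n h l) := le_tan (by linarith) (by linarith)
    rw [show tan (be 0 n h l) ^ 2 = tan (-be 0 n h l) ^ 2 by rw [tan_neg, neg_sq]]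
    generalize tan (-be 0 n h l) = κ at *
    generalize sinh l / sin h = σ at *
    generalize sin h / h = ρ at *
    have f1 : l / h * (π / 2 - be 0 n h l) ≤ σ * ρ * (31416 / 20000 + κ) :=
      mul_le_mul hs (by linarith) (by linarith) (by positivity)
    have f2 : (l / h) ^ 2 ≤ (σ * ρ) ^ 2 := pow_le_pow_left₀ hs0 hs 2
    linarith
  · have ht : tan (be 0 n h l) ≤ l / h := by
      rcases hb.eq_or_lt with h2 | h2
      · rw [← h2, tan_zero]; exact hs0
      · exact tan_be_le_of_eq d a (a.h_lt p.pt.lt_cc)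
          (two_mul_sinh_lt d a p.pt.lt_cc p.pt.eq.ge) hc p.pt.eq
          ((p.be_nonpos_or a).resolve_left (not_le.2 h2))
    have ht0 : 0 ≤ tan (be 0 n h l) := tan_nonneg_of_nonneg_of_le_pi_div_two hb
      (be_lt_pi_div_two d p.pos a p.pt.eq.ge).le
    have hnl := mul_le_of_exp_le d a p.pt.lt_cc p.pt.eq.ge
    have hu := arg_lt_pi d p.pos a p.pt.eq.ge
    have hnl2 : n * l = n * h * (l / h) := by field_simp
    have hs1 : l / h ≤ 42 / 100 := by
      unfold cc at hu
      nlinarith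
    have f1 : l / h ≤ sinh l / sin h := hs.trans (mul_le_of_le_one_right hσ0 hρ1)
    have f2 := pow_le_pow_left₀ ht0 ht 2
    nlinarith

/-! ### Earlier times of the opposite parity. -/

lemma div_le_exp_neg_two_mul {σ : ℝ} (h : 0 ≤ σ) : (1 - σ) / (1 + σ) ≤ exp (-(2 * σ)) := by
  rw [div_le_iff₀ (by linarith)]
  refine le_of_hasDerivAt_le (f := fun x => 1 - x) (g := fun x => exp (-(2 * x)) * (1 + x))
    (f' := fun _ => -1) (g' := fun x => -(exp (-(2 * x)) * (1 + 2 * x)))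
    (fun x => ?_) (fun x => ?_) (by simp) (fun x hx => ?_) h
  · exact (hasDerivAt_id x).const_sub 1
  · have h1 : HasDerivAt (fun x : ℝ => -(2 * x)) (-2) x := by
      have := ((hasDerivAt_id x).const_mul 2).neg
      exact this.congr_deriv (by ring)
    have := h1.exp.mul ((hasDerivAt_id x).const_add 1)
    exact this.congr_deriv (by simp; ring)
  · have h1 := Real.add_one_le_exp (2 * x)
    have h2 : exp (-(2 * x)) * exp (2 * x) = 1 := by rw [← exp_add]; simp
    nlinarith [exp_pos (-(2 * x))]

/-- Equivalent to `1 + tan^2 ≤ exp (tan^2)`, as `1 + tan^2 = 1 / cos^2`. -/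
lemma exp_le_cos {β : ℝ} (h : 0 < cos β) : exp (-(tan β ^ 2 / 2)) ≤ cos β := by
  have h1 := Real.add_one_le_exp (tan β ^ 2)
  have h2 : (tan β ^ 2 + 1) * cos β ^ 2 = 1 := by
    rw [tan_eq_sin_div_cos]; field_simp; rw [sin_sq_add_cos_sq]
  have h3 : exp (-(tan β ^ 2 / 2)) ^ 2 * exp (tan β ^ 2) = 1 := by
    rw [← Real.exp_nat_mul, ← exp_add]
    simp; ring_nf
  refine le_of_sq_le_sq ?_ h.le
  have h4 := exp_pos (tan β ^ 2)
  refine le_of_mul_le_mul_right ?_ h4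
  rw [h3, ← h2, mul_comm (cos β ^ 2)]
  exact mul_le_mul_of_nonneg_right h1 (sq_nonneg _)

/-- A violation at `m` is compared with equality at `n`: the amplitude cancels, the odd weight costs
`exp (-2 sinh l / sin h)`, and the cosines are replaced by Gaussian-type bounds. The exponents then
contradict `IsTop.slope_bound`. -/
lemma IsTop.lob_one_le {n h l : ℝ} (p : IsTop 0 n h l) (a : Adm 0 n) {m : ℝ} (hm0 : 0 ≤ m)
    (hm : m ≤ n - 1) : lob 1 m h l ≤ exp (m * l) := by
  have d := p.pt.dom
  have hx := d.x0
  have h0 := d.h0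
  have hlow := neg_le_be d a p.pt.lt_cc p.pt.eq.ge p.pt.le
  have hS := p.slope_bound a
  have hc := cos_be_pos d a p.pt.eq.ge
  by_contra hcon
  push Not at hcon
  obtain ⟨v, hv⟩ : ∃ v, v = be 1 m h l := ⟨_, rfl⟩
  have hv2 : v = be 0 n h l - π / 2 + (n - m) * h := by rw [hv]; unfold be cc; ring
  have hg := d.gR_pos zero_le_one le_rfl
  have hR := rR_pos h l
  rw [lob_eq, ← hv] at hcon
  have hcv : 0 < cos v := pos_of_mul_pos_right ((exp_pos _).trans hcon) hg.le
  have hmh : h ≤ (n - m) * h := by nlinarith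
  have hv3 : -(π / 2) ≤ v := by rw [hv2]; linarith
  have hv4 : v < π / 2 := by
    by_contra hc2
    push Not at hc2
    have : cos v ≤ 0 := cos_nonpos_of_pi_div_two_le_of_le hc2 (by
      have := d.th_pos
      have := mul_nonneg hm0 h0.le
      rw [hv]; unfold be cc; linarith)
    linarith
  have hv5 : |v| < π / 2 := by
    rw [abs_lt]
    refine ⟨lt_of_le_of_ne hv3 fun e => ?_, hv4⟩
    rw [← e, cos_neg, cos_pi_div_two] at hcv
    exact lt_irrefl _ hcv
  have e1 := p.pt.eq
  rw [lob_eq, gw_zero d, one_mul] at e1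
  have e2 : exp (m * l) = exp (-((n - m) * l)) * (rR h l * cos (be 0 n h l)) := by
    rw [e1, ← exp_add]; ring_nf
  have e3 : exp (-((n - m) * l)) * cos (be 0 n h l) < gw 1 h l * cos v := by
    rw [e2] at hcon
    refine lt_of_mul_lt_mul_left ?_ hR.le
    linarith
  have e4 : gw 1 h l ≤ exp (-(2 * (sinh l / sin h))) := by
    refine le_trans (le_of_eq ?_) (div_le_exp_neg_two_mul (div_nonneg d.p0 hx.le))
    unfold gw; field_simp
  have e5 := mul_le_mul e4 (cos_le_exp hv5) hcv.le (exp_pos _).le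
  have e6 := mul_le_mul_of_nonneg_left (exp_le_cos hc) (exp_pos (-((n - m) * l))).le
  rw [← exp_add] at e5 e6
  have e7 := exp_lt_exp.1 (e6.trans_lt (e3.trans_le e5))
  have e8 : (n - m) * l = l / h * (v + π / 2 - be 0 n h l) := by
    rw [hv2]; field_simp; ring
  -- Completing the square in the unknown phase `v` produces the term `(l / h)^2 / 2` of
  -- `IsTop.slope_bound`.
  nlinarith [sq_nonneg (l / h - v)]

/-- The even lobe's phase at `m ≤ n - 1` exceeds the odd one's at `n` by at least `π/2 + h`; since
the latter is at least `-h`, the even lobe is nonpositive or has nonpositive sine. -/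
lemma LobePt.lob_zero_le {n h l : ℝ} (p : LobePt 1 n h l) (a : Adm 1 n) {m : ℝ} (hm0 : 0 ≤ m)
    (hm : m ≤ n - 1) : lob 0 m h l ≤ exp (m * l) := by
  have d := p.dom
  have h0 := d.h0
  have hlow := neg_le_be d a p.lt_cc p.eq.ge p.le
  have hmh : m * h ≤ (n - 1) * h := mul_le_mul_of_nonneg_right hm h0.le
  have hm1 := mul_nonneg hm0 h0.le
  have hb : π / 2 ≤ be 0 m h l := by
    unfold be cc at *; linarith
  by_cases hu : cc 0 - m * h < π
  · rw [lob_eq]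
    refine (mul_nonpos_of_nonneg_of_nonpos (d.gR_pos le_rfl zero_le_one).le
      (cos_nonpos_of_pi_div_two_le_of_le hb ?_)).trans (exp_pos _).le
    have := d.th_pos
    unfold be; linarith [pi_pos]
  · have hs := sin_nonpos_of_mem (not_lt.1 hu) (by linarith [cc_le le_rfl])
    have h1 := mul_nonpos_of_nonneg_of_nonpos d.Q0.le hs
    have h2 := cos_le_one (cc 0 - m * h)
    have h3 : 1 ≤ exp (m * l) := Real.one_le_exp (mul_nonneg hm0 d.l0)
    unfold lob
    rw [gw_zero d]
    linarith

/-! ### Tops are the lowest points. -/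

lemma adm_par {k : ℕ} (hk : 4 ≤ k) : Adm (par (k + 1)) ((k + 1 : ℕ) : ℝ) := by
  rcases Nat.even_or_odd (k + 1) with h | h
  · left
    refine ⟨par_of_even h, ?_⟩
    have : 6 ≤ k + 1 := by obtain ⟨j, hj⟩ := h; omega
    exact_mod_cast this
  · right
    refine ⟨par_of_odd h, ?_⟩
    have : 5 ≤ k + 1 := by omega
    exact_mod_cast this

lemma IsTop.mem_curveC {k : ℕ} (hk : 4 ≤ k) {h l : ℝ}
    (p : IsTop (par (k + 1)) ((k + 1 : ℕ) : ℝ) h l) :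
    (2 * exp (-l) * sin h, exp (-2 * l)) ∈ curveC k := by
  have a := adm_par hk
  rw [mem_curveC_iff p.pt.dom]
  refine ⟨fun m hm1 hmk => ?_, p.pt.eq⟩
  have hm' : (m : ℝ) ≤ ((k + 1 : ℕ) : ℝ) - 1 := by
    push_cast
    have : (m : ℝ) ≤ k := by exact_mod_cast hmk
    linarith
  by_cases hp : par m = par (k + 1)
  · have : ∃ j, k + 1 = m + 2 * (j + 1) := by
      have h2 : (k + 1 - m) % 2 = 0 := by
        unfold par at hp
        by_cases c1 : Even m <;> by_cases c2 : Even (k + 1) <;> simp only [c1, c2, if_true,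
          if_false] at hp
        · rw [Nat.even_iff] at c1 c2; omega
        · norm_num at hp
        · norm_num at hp
        · rw [Nat.not_even_iff] at c1 c2; omega
      exact ⟨(k + 1 - m) / 2 - 1, by omega⟩
    obtain ⟨j, hj⟩ := this
    have hj' : ((k + 1 : ℕ) : ℝ) = m + 2 * (j + 1) := by rw [hj]; push_cast; ring
    have := p.pt.same_parity a p.pos j (by rw [hj']; linarith [(m.cast_nonneg : (0 : ℝ) ≤ m)])
    rw [hj'] at this
    rw [hp]
    convert this using 2 <;> ring
  · rcases Nat.even_or_odd (k + 1) with c | c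
    · have c2 : Odd m := by
        rw [← Nat.not_even_iff_odd]
        exact fun c3 => hp (by rw [par_of_even c, par_of_even c3])
      rw [par_of_even c] at p a
      rw [par_of_odd c2]
      exact p.lob_one_le a m.cast_nonneg hm'
    · have c2 : Even m := by
        rw [← Nat.not_odd_iff_even]
        exact fun c3 => hp (by rw [par_of_odd c, par_of_odd c3])
      rw [par_of_odd c] at p a
      rw [par_of_even c2]
      exact p.pt.lob_zero_le a m.cast_nonneg hm'

/-- The constraint at `n - 2` is the sign condition at index `k - 1`. Index 0, needed by
`first_lobe` but absent from `mem_curveC_iff`, holds with equality. -/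
lemma lobePt_of_mem_curveC {k : ℕ} (hk : 4 ≤ k) {h l : ℝ} (d : Dom h l) (hl : 0 < l)
    (hm : (2 * exp (-l) * sin h, exp (-2 * l)) ∈ curveC k) :
    LobePt (par (k + 1)) ((k + 1 : ℕ) : ℝ) h l := by
  rw [mem_curveC_iff d] at hm
  obtain ⟨H, he⟩ := hm
  refine ⟨d, ?_, he, ?_⟩
  · refine first_lobe d hl (by omega) (fun m hm => ?_) he
    rcases Nat.eq_zero_or_pos m with rfl | hm0
    · have : par 0 = 0 := par_of_even (by simp)
      rw [this, lob_zero _ _ _ d.x0.ne']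
      simp
    · exact H m hm0 (by omega)
  · have := H (k - 1) (by omega) (by omega)
    have e : par (k + 1) = par (k - 1) := by
      rw [← par_add_two (k - 1)]; congr 1; omega
    rw [e]
    have e2 : ((k + 1 : ℕ) : ℝ) - 2 = ((k - 1 : ℕ) : ℝ) := by
      rw [Nat.cast_sub (by omega)]; push_cast; ring
    rw [e2]
    exact this

/-- The lowest point of `curveC k` corresponds to the unique top. -/
lemma isLowestPoint_iff {k : ℕ} (hk : 4 ≤ k) (q : ℝ × ℝ) : IsLowestPoint (curveC k) q ↔
    ∃ h l, IsTop (par (k + 1)) ((k + 1 : ℕ) : ℝ) h l ∧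
      q = (2 * exp (-l) * sin h, exp (-2 * l)) := by
  have a := adm_par hk
  constructor
  · rintro ⟨hq, hmin⟩
    obtain ⟨h0, l0, p0⟩ := exists_isTop a
    obtain ⟨x, y⟩ := q
    obtain ⟨h, l, d, rfl, rfl⟩ := exists_of_mem_curveC hk hq
    have h1 := hmin (p0.mem_curveC hk)
    have hl : l0 ≤ l := by
      have : exp (-2 * l) ≤ exp (-2 * l0) := h1
      rw [exp_le_exp] at this
      linarith
    have hl0 := p0.pos
    have p := lobePt_of_mem_curveC hk d (by linarith) hq
    exact ⟨h, l, ⟨p, by linarith, fun h' l' p' => (p0.max h' l' p').trans hl⟩, rfl⟩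
  · rintro ⟨h, l, p, rfl⟩
    refine ⟨p.mem_curveC hk, ?_⟩
    rintro ⟨x, y⟩ hq
    obtain ⟨h', l', d, rfl, rfl⟩ := exists_of_mem_curveC hk hq
    change exp (-2 * l) ≤ exp (-2 * l')
    rw [exp_le_exp]
    rcases d.l0.eq_or_lt with hl | hl
    · rw [← hl]; linarith [p.pos]
    · linarith [p.max h' l' (lobePt_of_mem_curveC hk d hl hq)]

lemma existsUnique_isLowestPoint {k : ℕ} (hk : 4 ≤ k) :
    ∃! p : ℝ × ℝ, IsLowestPoint (curveC k) p := by
  have a := adm_par hk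
  obtain ⟨h, l, p⟩ := exists_isTop a
  refine ⟨_, (isLowestPoint_iff hk _).2 ⟨h, l, p, rfl⟩, fun q hq => ?_⟩
  obtain ⟨h', l', p', rfl⟩ := (isLowestPoint_iff hk q).1 hq
  obtain ⟨rfl, rfl⟩ := p.unique a p'
  rfl

/-! ### Monotonicity of `b` and the limit. -/

lemma exists_lobePt_of_add_two {t n h l : ℝ} (a : Adm t n) (a2 : Adm t (n + 2)) (hl : 0 < l)
    (p : LobePt t (n + 2) h l) : ∃ h', LobePt t n h' l := by
  have d := p.dom
  have h0 := d.h0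
  have hn := a.n0
  have hpi := pi_pos
  have hcc := a.cc_le_mul
  have hlt := p.lt_cc
  have hle := p.le
  rw [show n + 2 - 2 = n by ring] at hle
  have hb3 : cc t / n ≤ π / 3 := by rw [div_le_iff₀ hn]; linarith
  have hb1 : h ≤ cc t / n := by rw [le_div_iff₀ hn]; linarith
  have dom : ∀ x, h ≤ x → x ≤ cc t / n → Dom x l := fun x h1 h2 => d.mono h1 (by linarith)
  have hcn : n * (cc t / n) = cc t := by field_simp
  -- At `h1` time `n` has the same phase as time `n + 2` at `h`, but a larger amplitude. At `h`
  -- itself the lobe for `n` is at most the exponential, by the constraint of the given point, so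
  -- equality occurs in between.
  obtain ⟨h1, ⟨i1, i2⟩, e1⟩ : ∃ h1 ∈ Set.Icc h (cc t / n),
      n * h1 + th h1 l = (n + 2) * h + th h l := by
    have cont : ContinuousOn (fun x => n * x + th x l) (Set.Icc h (cc t / n)) := fun x hx =>
      (ContinuousAt.add (by fun_prop)
        (continuousAt_th_left (dom x hx.1 hx.2))).continuousWithinAt
    have hth := d.th_le hb1 (by linarith)
    exact intermediate_value_Icc hb1 cont ⟨by linarith, by linarith⟩
  have d1 := dom h1 i1 i2
  have hbe : be t n h1 l = be t (n + 2) h l := by unfold be; linarith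
  have hlt1 : h < h1 := by
    rcases i1.eq_or_lt with e | e
    · rw [← e] at e1; linarith
    · exact e
  have big : exp (n * l) ≤ lob t n h1 l := by
    have e2 := p.eq
    have hc := cos_be_pos d a2 p.eq.ge
    rw [lob_eq] at e2 ⊢
    rw [hbe]
    have f1 := mul_lt_mul_of_pos_right (d.gR_lt a.t0 a.t1 hlt1 d1.h1) hc
    rw [e2] at f1
    have f2 : exp (n * l) ≤ exp ((n + 2) * l) := exp_le_exp.2 (by linarith)
    linarith
  obtain ⟨x, ⟨x1, x2⟩, ex⟩ : ∃ x ∈ Set.Icc h h1, lob t n x l = exp (n * l) :=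
    intermediate_value_Icc hlt1.le (fun x hx =>
      ((dom x hx.1 (hx.2.trans i2)).continuousAt_lob_left a.t0 n).continuousWithinAt) ⟨hle, big⟩
  have dx := dom x x1 (x2.trans i2)
  have hxc : n * x < cc t := by
    have := dx.th_le x2 d1.h1
    have := d.th_le x1 dx.h1
    have h3 : n * x ≤ n * h1 := mul_le_mul_of_nonneg_left x2 hn.le
    rcases x2.eq_or_lt with rfl | x2
    · have := d.th_mono hlt1 d1.h1
      linarith
    · have : n * x < n * (cc t / n) := mul_lt_mul_of_pos_left (x2.trans_le i2) hn
      linarith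
  refine ⟨x, dx, hxc, ex, ?_⟩
  have hbx : be t (n + 2) h l ≤ be t n x l := by
    rw [← hbe]
    rcases x2.eq_or_lt with rfl | x2
    · rfl
    · exact (dx.be_lt hn.le x2 d1.h1).le
  have hg := dx.gR_pos a.t0 a.t1
  have c1 := cos_be_add_le d a2 p.eq.ge p.le
  have c2 := neg_le_be d a2 p.lt_cc p.eq.ge p.le
  have hbx2 := be_lt_pi_div_two dx hl a ex.ge
  have hx3 := a.h_lt hxc
  have c3 := cos_add_le_of_le (neg_pi_div_two_lt_be p.lt_cc) hbx hbx2 (by linarith)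
    (by linarith) c1
  have c4 : cos (be t n x l + 2 * x) ≤ exp (-2 * l) * cos (be t n x l) := by
    by_cases hq : be t n x l + 2 * x ≤ π / 2
    · exact (cos_le_cos_of_nonneg_of_le_pi (by linarith) (by linarith) (by linarith)).trans c3
    · have f1 : cos (be t n x l + 2 * x) ≤ 0 :=
        cos_nonpos_of_pi_div_two_le_of_le (by linarith) (by linarith)
      have f2 := mul_pos (exp_pos (-2 * l)) (cos_be_pos dx a ex.ge)
      linarith
  have e3 : exp ((n - 2) * l) = exp (-2 * l) * exp (n * l) := by rw [← exp_add]; ring_nf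
  rw [lob_sub_two, e3, ← ex, lob_eq]
  calc gw t x l * rR x l * cos (be t n x l + 2 * x)
      ≤ gw t x l * rR x l * (exp (-2 * l) * cos (be t n x l)) :=
        mul_le_mul_of_nonneg_left c4 hg.le
    _ = _ := by ring

lemma Adm.add_two {t n : ℝ} (a : Adm t n) : Adm t (n + 2) := by
  rcases a with ⟨h, h2⟩ | ⟨h, h2⟩
  · exact Or.inl ⟨h, by linarith⟩
  · exact Or.inr ⟨h, by linarith⟩

lemma IsTop.le_of_add_two {t n h l h' l' : ℝ} (a : Adm t n) (p : IsTop t n h l)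
    (p' : IsTop t (n + 2) h' l') : l' ≤ l := by
  obtain ⟨x, hx⟩ := exists_lobePt_of_add_two a a.add_two p'.pos p'.pt
  exact p.max _ _ hx

lemma IsTop.bounds {k : ℕ} (hk : 4 ≤ k) {h l : ℝ}
    (p : IsTop (par (k + 1)) ((k + 1 : ℕ) : ℝ) h l) :
    h ≤ 2 * π / ((k + 1 : ℕ) : ℝ) ∧ l ≤ 2 * π / ((k + 1 : ℕ) : ℝ) := by
  have a := adm_par hk
  have h1 : h ≤ 2 * π / ((k + 1 : ℕ) : ℝ) := by
    rw [le_div_iff₀ a.n0]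
    linarith [p.pt.lt_cc, cc_le a.t0]
  have h2 := Real.self_le_sinh_iff.2 p.pt.dom.l0
  have h3 := p.pt.dom.lt
  have h4 := sin_le p.pt.dom.h0.le
  exact ⟨h1, by linarith⟩

lemma tendsto_of_isLowestPoint {a b : ℕ → ℝ}
    (H : ∀ k : ℕ, 4 ≤ k → IsLowestPoint (curveC k) (a k, b k)) :
    Tendsto (fun k : ℕ => (a k, b k)) atTop (𝓝 ((0 : ℝ), (1 : ℝ))) := by
  have hlim : Tendsto (fun k : ℕ => 2 * π / ((k + 1 : ℕ) : ℝ)) atTop (𝓝 0) :=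
    (tendsto_const_div_atTop_nhds_zero_nat (2 * π)).comp (tendsto_add_atTop_nat 1)
  have key : ∀ k : ℕ, 4 ≤ k → (0 ≤ a k ∧ a k ≤ 2 * (2 * π / ((k + 1 : ℕ) : ℝ))) ∧
      (1 - 2 * (2 * π / ((k + 1 : ℕ) : ℝ)) ≤ b k ∧ b k ≤ 1) := by
    intro k hk
    obtain ⟨h, l, p, e⟩ := (isLowestPoint_iff hk _).1 (H k hk)
    obtain ⟨e1, e2⟩ := Prod.mk.inj e
    obtain ⟨b1, b2⟩ := p.bounds hk
    have d := p.pt.dom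
    have h4 := sin_le d.h0.le
    have h5 := exp_pos (-l)
    have h6 : exp (-l) ≤ 1 := Real.exp_le_one_iff.2 (by linarith [d.l0])
    have h7 : exp (-2 * l) ≤ 1 := Real.exp_le_one_iff.2 (by linarith [d.l0])
    have h8 := Real.add_one_le_exp (-2 * l)
    have hx := d.x0
    rw [e1, e2]
    refine ⟨⟨by positivity, ?_⟩, by linarith, h7⟩
    nlinarith
  refine Tendsto.prodMk_nhds ?_ ?_
  · have h1 : Tendsto (fun k : ℕ => 2 * (2 * π / ((k + 1 : ℕ) : ℝ))) atTop (𝓝 0) := by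
      simpa using hlim.const_mul 2
    exact tendsto_of_tendsto_of_tendsto_of_le_of_le' tendsto_const_nhds h1
      (eventually_atTop.2 ⟨4, fun k hk => (key k hk).1.1⟩)
      (eventually_atTop.2 ⟨4, fun k hk => (key k hk).1.2⟩)
  · have h1 : Tendsto (fun k : ℕ => 1 - 2 * (2 * π / ((k + 1 : ℕ) : ℝ))) atTop (𝓝 1) := by
      simpa using (hlim.const_mul 2).const_sub 1
    exact tendsto_of_tendsto_of_tendsto_of_le_of_le' h1 tendsto_const_nhds
      (eventually_atTop.2 ⟨4, fun k hk => (key k hk).2.1⟩)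
      (eventually_atTop.2 ⟨4, fun k hk => (key k hk).2.2⟩)

/-! ### Monotonicity of `a` for late times. -/

lemma sinh_le_mul {l : ℝ} (h0 : 0 ≤ l) (h1 : l ≤ 1 / 10) : sinh l ≤ 106 / 100 * l := by
  have e1 := Real.add_one_le_exp (-l)
  have e2 : exp l ≤ 1 / (1 - l) := by
    rw [le_div_iff₀ (by linarith)]
    have : exp l * exp (-l) = 1 := by rw [← exp_add]; simp
    nlinarith [exp_pos l]
  have e3 : 1 / (1 - l) ≤ 1 - l + 212 / 100 * l := by
    rw [div_le_iff₀ (by linarith)]; nlinarith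
  rw [Real.sinh_eq]
  linarith

/-- The sign of the derivative of `rQ` along a curve of constant `a`, with `x, y` for sine and
cosine, `p, r` for the hyperbolic pair. Both sides are compared with `2.441 x y`. -/
lemma path_bound {x y C p r W : ℝ} (hx : 0 < x) (hx1 : x ^ 2 ≤ 1 / 2) (hy : 0 < y)
    (hy2 : y ^ 2 = 1 - x ^ 2) (hC : 0 < C) (hC2 : C ^ 2 = 1 + x ^ 2) (hp : 0 ≤ p)
    (hp1 : p ≤ 106 / 1000) (hr : 0 < r) (hr2 : r ^ 2 = 1 + p ^ 2) (hW : 0 < W)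
    (hWe : W = x * r + C * p) :
    x ^ 2 / C * y + C * x ^ 2 / y ≤ 2 * (x * (1 - p * r - x * p ^ 2 / C)) / W ^ 2 * y := by
  have x1 : x ≤ 7072 / 10000 := by nlinarith
  have C1 : C ≤ 12249 / 10000 := by nlinarith
  have C0 : 1 ≤ C := by nlinarith
  have r1 : r ≤ 10057 / 10000 := by nlinarith
  have y1 : 1 / 2 ≤ y ^ 2 := by linarith
  have W1 : W ≤ 8411 / 10000 := by
    have : x * r ≤ 7072 / 10000 * (10057 / 10000) := mul_le_mul x1 r1 hr.le (by norm_num)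
    have : C * p ≤ 12249 / 10000 * (106 / 1000) := mul_le_mul C1 hp1 hp (by norm_num)
    rw [hWe]; linarith
  have W2 : W ^ 2 ≤ 7075 / 10000 := by nlinarith
  have t1 : p * r ≤ 106 / 1000 * (10057 / 10000) := mul_le_mul hp1 r1 hr.le (by norm_num)
  have t2 : x * p ^ 2 / C ≤ 8 / 1000 := by
    rw [div_le_iff₀ hC]
    have : p ^ 2 ≤ (106 / 1000) ^ 2 := pow_le_pow_left₀ hp hp1 2
    have : x * p ^ 2 ≤ 7072 / 10000 * (106 / 1000) ^ 2 :=
      mul_le_mul x1 this (sq_nonneg p) (by norm_num)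
    linarith
  have hxy : 0 < x * y := by positivity
  have f1 : x ^ 2 / C * y ≤ x * y * (7072 / 10000) := by
    have : x ^ 2 / C ≤ x ^ 2 := div_le_self (sq_nonneg x) C0
    nlinarith
  have f2 : C * x ^ 2 / y ≤ x * y * (1733 / 1000) := by
    rw [div_le_iff₀ hy]
    have : C * x ≤ 12249 / 10000 * (7072 / 10000) := mul_le_mul C1 x1 hx.le (by norm_num)
    have : C * x ≤ 1733 / 1000 * y ^ 2 := by linarith
    nlinarith
  have f3 : x * y * (244 / 100 + 1 / 1000) ≤
      2 * (x * (1 - p * r - x * p ^ 2 / C)) / W ^ 2 * y := by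
    have : 244 / 100 + 1 / 1000 ≤ 2 * (1 - p * r - x * p ^ 2 / C) / W ^ 2 := by
      rw [le_div_iff₀ (by positivity)]
      linarith
    calc x * y * (244 / 100 + 1 / 1000) ≤ x * y * (2 * (1 - p * r - x * p ^ 2 / C) / W ^ 2) :=
          mul_le_mul_of_nonneg_left this hxy.le
      _ = _ := by ring
  linarith

/-- Along the curves on which `a` is constant, `rQ` decreases with the contraction rate. -/
lemma rQ_le_rQ_of_path {A h h' l l' : ℝ} (hA : 0 < A) (hl' : 0 ≤ l') (hll : l' ≤ l)
    (hl : l ≤ 1 / 10) (dh : 0 < cos h) (dh' : 0 < cos h') (e : sin h = A * exp l)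
    (e' : sin h' = A * exp l') (h45 : sin h ^ 2 ≤ 1 / 2) : rQ h l ≤ rQ h' l' := by
  let X : ℝ → ℝ := fun s => A * exp s
  let Cf : ℝ → ℝ := fun s => √(1 + X s ^ 2)
  let Y : ℝ → ℝ := fun s => √(1 - X s ^ 2)
  let W : ℝ → ℝ := fun s => X s * cosh s + Cf s * sinh s
  let F : ℝ → ℝ := fun s => (Cf s - 2 * sinh s / W s) / Y s
  have eF : ∀ g s, 0 < cos g → sin g = A * exp s → rQ g s = F s := by
    intro g s hg es
    have : cos g = Y s := by
      simp only [Y, X]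
      rw [← es, ← cos_sq', Real.sqrt_sq hg.le]
    simp only [F, W, Cf, X]
    unfold rQ rN rW rC
    rw [this, es]
  rw [eF h l dh e, eF h' l' dh' e']
  have key : ∀ s ∈ Set.Icc l' l, ∃ D ≤ 0, HasDerivAt F D s := by
    rintro s ⟨s1, s2⟩
    have hX : 0 < X s := by positivity
    have hX2 : X s ^ 2 ≤ 1 / 2 := by
      refine le_trans ?_ h45
      rw [e]
      exact pow_le_pow_left₀ hX.le (mul_le_mul_of_nonneg_left (exp_le_exp.2 s2) hA.le) 2
    have hC : 0 < Cf s := Real.sqrt_pos.2 (by positivity)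
    have hC2 : Cf s ^ 2 = 1 + X s ^ 2 := Real.sq_sqrt (by positivity)
    have hY : 0 < Y s := Real.sqrt_pos.2 (by linarith)
    have hY2 : Y s ^ 2 = 1 - X s ^ 2 := Real.sq_sqrt (by linarith)
    have hs : 0 ≤ s := hl'.trans s1
    have hp : 0 ≤ sinh s := Real.sinh_nonneg_iff.2 hs
    have hp1 : sinh s ≤ 106 / 1000 := by
      have := sinh_le_mul hs (s2.trans hl)
      linarith
    have hr := cosh_pos s
    have hr2 := cosh_sq_eq s
    have hW : 0 < W s := by
      have : 0 ≤ Cf s * sinh s := by positivity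
      have : 0 < X s * cosh s := by positivity
      simp only [W]; linarith
    have dX : HasDerivAt X (X s) s := (Real.hasDerivAt_exp s).const_mul A
    have dX2 : HasDerivAt (fun s => X s ^ 2) (2 * X s ^ 2) s :=
      (dX.pow 2).congr_deriv (by norm_num; ring)
    have dC : HasDerivAt Cf (X s ^ 2 / Cf s) s := by
      refine ((dX2.const_add 1).sqrt (by positivity)).congr_deriv ?_
      change 2 * X s ^ 2 / (2 * Cf s) = _
      field_simp
    have dY : HasDerivAt Y (-(X s ^ 2 / Y s)) s := by
      refine ((dX2.const_sub 1).sqrt (by linarith)).congr_deriv ?_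
      change -(2 * X s ^ 2) / (2 * Y s) = _
      field_simp
    have dW := (dX.mul (Real.hasDerivAt_cosh s)).add (dC.mul (Real.hasDerivAt_sinh s))
    have dF := (dC.sub (((Real.hasDerivAt_sinh s).const_mul 2).div dW hW.ne')).div dY hY.ne'
    refine ⟨_, ?_, dF⟩
    apply div_nonpos_of_nonpos_of_nonneg _ (sq_nonneg _)
    have hb := path_bound hX hX2 hY hY2 hC hC2 hp hp1 hr hr2 hW rfl
    change (X s ^ 2 / Cf s - (2 * cosh s * W s - 2 * sinh s * (X s * cosh s + X s * sinh s +
      (X s ^ 2 / Cf s * sinh s + Cf s * cosh s))) / W s ^ 2) * Y s -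
      (Cf s - 2 * sinh s / W s) * -(X s ^ 2 / Y s) ≤ 0
    have g1 : 2 * cosh s * W s - 2 * sinh s * (X s * cosh s + X s * sinh s +
      (X s ^ 2 / Cf s * sinh s + Cf s * cosh s)) =
        2 * (X s * (1 - sinh s * cosh s - X s * sinh s ^ 2 / Cf s)) := by
      change 2 * cosh s * (X s * cosh s + Cf s * sinh s) - _ = _
      field_simp
      linear_combination (Cf s * X s) * hr2
    rw [g1]
    have g2 : 0 ≤ 2 * sinh s / W s * (X s ^ 2 / Y s) := by positivity
    have g3 : Cf s * X s ^ 2 / Y s = Cf s * (X s ^ 2 / Y s) := by ring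
    linarith
  have anti : AntitoneOn F (Set.Icc l' l) := by
    apply antitoneOn_of_deriv_nonpos (convex_Icc _ _)
    · intro s hs
      obtain ⟨D, -, hD⟩ := key s hs
      exact hD.continuousAt.continuousWithinAt
    · intro s hs
      obtain ⟨D, -, hD⟩ := key s (interior_subset hs)
      exact hD.differentiableAt.differentiableWithinAt
    · intro s hs
      obtain ⟨D, h0, hD⟩ := key s (interior_subset hs)
      rw [hD.deriv]; exact h0
  exact anti ⟨le_rfl, hll⟩ ⟨hll, le_rfl⟩ hll

lemma half_le_th {h l : ℝ} (d : Dom h l) (hh : 7 / 10 ≤ h) (h2 : 2 * sinh l < sin h) :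
    1 / 2 ≤ th h l := by
  have hx := d.x0
  have hy := d.y0
  have hp := d.p0
  have hW := d.W0
  have hpi := pi_gt_three
  have s1 : 6428 / 10000 ≤ sin h := by
    have e1 := sin_ge_sub_cube (x := 7 / 10) (by norm_num)
    have := sin_le_sin_of_le_of_le_pi_div_two (by linarith) d.h1.le hh
    norm_num at e1
    linarith
  have c1 : cos h ≤ 767 / 1000 := by nlinarith [sin_sq_add_cos_sq h]
  have c2 : 118 / 100 ≤ rC h := by
    have := rC_sq h
    nlinarith [rC_pos h]
  have e : 2 * sinh l / rW h l ≤ 64 / 100 := by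
    rw [div_le_iff₀ hW]
    unfold rW
    have f1 := mul_le_mul_of_nonneg_left (one_le_cosh l) hx.le
    have f2 := mul_le_mul_of_nonneg_right c2 hp
    linarith
  have hQ : 547 / 1000 ≤ rQ h l := by
    unfold rQ rN
    rw [le_div_iff₀ hy]
    linarith
  have ht : tan (1 / 2) ≤ 547 / 1000 :=
    tan_le_of_le (b := 1 / 2) (by norm_num) le_rfl (by norm_num) (by norm_num) (by norm_num)
  rw [← arctan_tan (x := 1 / 2) (by linarith) (by linarith)]
  exact arctan_strictMono.monotone (ht.trans hQ)

lemma half_lt_cos_sq {h : ℝ} (h0 : 0 ≤ h) (h1 : h < π / 4) : 1 / 2 < cos h ^ 2 := by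
  have : 0 < cos (2 * h) := cos_pos_of_mem_Ioo ⟨by linarith, by linarith⟩
  rw [cos_two_mul] at this
  linarith

lemma mul_lt_of_lt_pi_div_four {t n h l : ℝ} (d : Dom h l) (a : Adm t n) (hh : h < π / 4)
    (he : exp (n * l) ≤ lob t n h l) : n * l < 6932 / 10000 := by
  have h1 := exp_le_rR_of_le d a he
  have h2 := rR_mul_cos_sq_le d
  have h3 := half_lt_cos_sq d.h0.le hh
  have h4 := rR_pos h l
  rw [mul_pow] at h2
  have h5 : rR h l < 2 := by
    by_contra hc
    push Not at hc
    have : (2 : ℝ) ^ 2 ≤ rR h l ^ 2 := pow_le_pow_left₀ (by norm_num) hc 2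
    nlinarith
  have h6 : n * l < log 2 := by
    rw [Real.lt_log_iff_exp_lt zero_lt_two]; linarith
  linarith [Real.log_two_lt_d9]

/-- The second bound ensures that the phase stays in range while a top is moved along a curve of
constant `a`. Past the crest `n l < log 2` suffices; before it, the active constraint bounds `be` by
`l / h`. -/
lemma IsTop.apriori {t n h l : ℝ} (p : IsTop t n h l) (a : Adm t n)
    (hn : t = 1 ∧ 7 ≤ n ∨ t = 0 ∧ 8 ≤ n) :
    h < π / 4 ∧ be t n h l + n * l * tan h + h ≤ π / 2 := by
  have d := p.pt.dom
  have h0 := d.h0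
  have hn0 := a.n0
  have hpi := pi_gt_d4
  have hpi2 := pi_lt_d4
  have hlt := p.pt.lt_cc
  have hh : h < π / 4 := by
    rcases hn with ⟨rfl, hn⟩ | ⟨rfl, hn⟩ <;> unfold cc at hlt <;> nlinarith
  refine ⟨hh, ?_⟩
  have hnl := mul_lt_of_lt_pi_div_four d a hh p.pt.eq.ge
  have hnl0 : 0 < n * l := mul_pos hn0 p.pos
  have ht0 := (le_tan h0.le d.h1)
  have hth := th_lt h l
  have hbe : n * h = cc t - th h l - be t n h l := by unfold be; ring
  have hu := arg_lt_pi d p.pos a p.pt.eq.ge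
  have step : ∀ T, tan h ≤ T → n * l * tan h ≤ 6932 / 10000 * T := fun T hT =>
    mul_le_mul hnl.le hT (by linarith) (by norm_num)
  have hnl2 : n * l = n * h * (l / h) := by field_simp
  have hs0 : 0 ≤ l / h := div_nonneg d.l0 h0.le
  rcases le_or_gt (be t n h l) 0 with hb | hb
  · have h1 : tan h ≤ 1 := by
      rw [← tan_pi_div_four]
      exact (tan_lt_tan_of_lt_of_lt_pi_div_two (by linarith) (by linarith) hh).le
    have := step 1 h1
    linarith
  · have h2p := two_mul_sinh_lt d a hlt p.pt.eq.ge
    have hbs : be t n h l ≤ l / h :=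
      (le_tan hb.le (be_lt_pi_div_two d p.pos a p.pt.eq.ge)).trans
        (tan_be_le_of_eq d a (a.h_lt hlt) h2p (cos_be_pos d a p.pt.eq.ge) p.pt.eq
          ((p.be_nonpos_or a).resolve_left (not_le.2 hb)))
    rcases hn with ⟨rfl, hn⟩ | ⟨rfl, hn⟩ <;> unfold cc at hlt hu hbe
    · have s1 : l / h ≤ 45 / 100 := by nlinarith
      have s2 : l / h ≤ 27 / 100 := by nlinarith
      have h3 : h ≤ 6733 / 10000 := by nlinarith
      have := step _ (tan_le_of_le (T := 8 / 10) h0.le h3 (by norm_num) (by norm_num)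
        (by norm_num))
      linarith
    · have s1 : l / h ≤ 23 / 100 := by nlinarith
      have s2 : l / h ≤ 16 / 100 := by nlinarith
      have h3 : h ≤ 723 / 1000 := by
        by_contra hc
        push Not at hc
        have := half_le_th d (by linarith) h2p
        nlinarith
      have := step _ (tan_le_of_le (T := 89 / 100) h0.le h3 (by norm_num) (by norm_num)
        (by norm_num))
      linarith

lemma sub_mul_cos_le {x y : ℝ} (hx : 0 ≤ x) (hxy : x ≤ y) (hy : y ≤ π) :
    (y - x) * cos y ≤ sin y - sin x := by
  have hm : MonotoneOn (fun z => sin z - z * cos y) (Set.Icc x y) := by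
    have dd : ∀ z, HasDerivAt (fun z => sin z - z * cos y) (cos z - cos y) z := fun z =>
      ((hasDerivAt_sin z).sub ((hasDerivAt_id z).mul_const (cos y))).congr_deriv (by ring)
    apply monotoneOn_of_deriv_nonneg (convex_Icc _ _)
    · exact fun z _ => (dd z).continuousAt.continuousWithinAt
    · exact fun z _ => (dd z).differentiableAt.differentiableWithinAt
    · intro z hz
      rw [interior_Icc] at hz
      rw [(dd z).deriv]
      have := cos_le_cos_of_nonneg_of_le_pi (by linarith [hz.1]) hy hz.2.le
      linarith
  have := hm ⟨le_rfl, hxy⟩ ⟨hxy, le_rfl⟩ hxy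
  simp only at this
  linarith

/-- On a curve of constant `a`, `l` is `log (sin z)` up to a constant, so this tracks lobe over
exponential with phase and amplitude frozen. The derivative has the sign of `-cos (c - n z + z)`. -/
lemma log_cos_sub_le {c n x y : ℝ} (hn : 1 ≤ n) (hx : 0 < x) (hxy : x ≤ y) (hy : y < π / 2)
    (h1 : -(π / 2) < c - n * y) (h2 : c - n * x + x ≤ π / 2) :
    log (cos (c - n * y)) - n * log (sin y) ≤ log (cos (c - n * x)) - n * log (sin x) := by
  have dd : ∀ z ∈ Set.Icc x y, ∃ D ≤ 0,
      HasDerivAt (fun z => log (cos (c - n * z)) - n * log (sin z)) D z := by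
    rintro z ⟨z1, z2⟩
    have hnz2 : n * z ≤ n * y := mul_le_mul_of_nonneg_left z2 (by linarith)
    have hs : 0 < sin z := sin_pos_of_pos_of_lt_pi (by linarith) (by linarith)
    have hB : c - n * z + z ≤ π / 2 := by nlinarith
    have hcos : 0 < cos (c - n * z) := cos_pos_of_mem_Ioo ⟨by linarith, by linarith⟩
    have hcs : 0 ≤ cos (c - n * z + z) :=
      cos_nonneg_of_mem_Icc ⟨by linarith, hB⟩
    have d1 : HasDerivAt (fun z => c - n * z) (-n) z := by
      simpa using ((hasDerivAt_id z).const_mul n).const_sub c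
    have d2 := (d1.cos.log hcos.ne').sub (((hasDerivAt_sin z).log hs.ne').const_mul n)
    refine ⟨-(n * cos (c - n * z + z) / (cos (c - n * z) * sin z)), ?_, d2.congr_deriv ?_⟩
    · have : 0 ≤ n := by linarith
      have : 0 ≤ n * cos (c - n * z + z) / (cos (c - n * z) * sin z) := by positivity
      linarith
    · rw [cos_add]
      field_simp
      ring
  have anti : AntitoneOn (fun z => log (cos (c - n * z)) - n * log (sin z)) (Set.Icc x y) := by
    apply antitoneOn_of_deriv_nonpos (convex_Icc _ _)
    · intro s hs
      obtain ⟨D, -, hD⟩ := dd s hs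
      exact hD.continuousAt.continuousWithinAt
    · intro s hs
      obtain ⟨D, -, hD⟩ := dd s (interior_subset hs)
      exact hD.differentiableAt.differentiableWithinAt
    · intro s hs
      obtain ⟨D, h0, hD⟩ := dd s (interior_subset hs)
      rw [hD.deriv]; exact h0
  exact anti ⟨le_rfl, hxy⟩ ⟨hxy, le_rfl⟩ hxy

lemma exp_mul_sinh_le {l l' : ℝ} (h : l' ≤ l) : exp l * sinh l' ≤ exp l' * sinh l := by
  have h1 : 0 ≤ sinh (l - l') := Real.sinh_nonneg_iff.2 (by linarith)
  have e : exp l' * sinh l - exp l * sinh l' = sinh (l - l') := by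
    rw [Real.sinh_sub, exp_eq, exp_eq]; ring
  linarith

/-- The first coordinate of the tops decreases, for late times. -/
lemma IsTop.exp_mul_sin_le {t n h l h' l' : ℝ} (p : IsTop t n h l) (a : Adm t n)
    (hn : t = 1 ∧ 7 ≤ n ∨ t = 0 ∧ 8 ≤ n) (p' : IsTop t (n + 2) h' l') :
    exp (-l') * sin h' ≤ exp (-l) * sin h := by
  by_contra hcon
  push Not at hcon
  have d := p.pt.dom
  have d' := p'.pt.dom
  have hx := d.x0
  have hpi := pi_pos
  have hn0 := a.n0
  have hn5 := a.five_le
  have hll := p.le_of_add_two a p'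
  obtain ⟨hh4, hap⟩ := p.apriori a hn
  have hnl := mul_lt_of_lt_pi_div_four d a hh4 p.pt.eq.ge
  have hl1 : l ≤ 1 / 10 := by
    have : 7 ≤ n := by rcases hn with ⟨-, h⟩ | ⟨-, h⟩ <;> linarith
    nlinarith [p.pos]
  obtain ⟨A, hA⟩ : ∃ A, A = exp (-l) * sin h := ⟨_, rfl⟩
  have hA0 : 0 < A := by rw [hA]; positivity
  have ee : ∀ s : ℝ, exp s * exp (-s) = 1 := fun s => by rw [← exp_add]; simp
  have hsin : sin h = A * exp l := by rw [hA]; linear_combination -(sin h) * ee l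
  have hsle : A * exp l' ≤ sin h := by
    rw [hsin]; exact mul_le_mul_of_nonneg_left (exp_le_exp.2 hll) hA0.le
  -- The point `(g, l')` has the same `a` as the top `(h, l)` and the contraction rate of the next
  -- top. Under the contrary assumption `g < h'`, so the lobe lies below the exponential there.
  obtain ⟨g, hg⟩ : ∃ g, g = arcsin (A * exp l') := ⟨_, rfl⟩
  have hs0 : 0 < A * exp l' := by positivity
  have hx1 := d.x1
  have hsg : sin g = A * exp l' := by rw [hg]; exact sin_arcsin (by linarith) (by linarith)
  have hg0 : 0 < g := by rw [hg]; exact arcsin_pos.2 hs0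
  have hg2 : g < π / 2 := by rw [hg]; exact arcsin_lt_pi_div_two.2 (by linarith)
  have hgh : g ≤ h := by
    by_contra hc
    push Not at hc
    have := sin_lt_sin_of_lt_of_le_pi_div_two (by linarith [d.h0]) hg2.le hc
    linarith
  have hgh' : g < h' := by
    by_contra hc
    push Not at hc
    have h1 := sin_le_sin_of_le_of_le_pi_div_two (by linarith [d'.h0]) hg2.le hc
    rw [hsg] at h1
    rw [← hA] at hcon
    have h2 := mul_le_mul_of_nonneg_left h1 (exp_pos (-l')).le
    have h3 : exp (-l') * (A * exp l') = A := by linear_combination A * ee l'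
    linarith
  have dg : Dom g l' := by
    refine ⟨d'.l0, hg0, hg2, ?_⟩
    rw [← one_sub_lt_iff]
    have h1 := (one_sub_lt_iff h l).2 d.lt
    have h2 : exp (-2 * l) ≤ exp (-2 * l') := exp_le_exp.2 (by linarith)
    have h3 : 2 * exp (-l') * sin g = 2 * A := by
      rw [hsg]; linear_combination 2 * A * ee l'
    have h4 : 2 * exp (-l) * sin h = 2 * A := by rw [hA]; ring
    linarith
  have upper : lob t n g l' < exp (n * l') := by
    have hle := p'.pt.le
    rw [show n + 2 - 2 = n by ring] at hle
    refine lob_lt_exp_of_lt dg p'.pos a.t0 a.t1 hn0 hgh' d'.h1 ?_ hle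
    have h1 := be_sub_two t (n + 2) h' l'
    rw [show n + 2 - 2 = n by ring] at h1
    have := neg_le_be d' a.add_two p'.pt.lt_cc p'.pt.eq.ge p'.pt.le
    linarith [d'.h0]
  have hdist : h - g ≤ (l - l') * tan h := by
    have h1 := sub_mul_cos_le hg0.le hgh (by linarith [d.h1])
    have h2 : sin h - sin g ≤ (l - l') * sin h := by
      have h3 : sin g = exp (-(l - l')) * sin h := by
        rw [hsg, hsin]
        rw [show A * exp l' = A * exp (-(l - l') + l) by congr 2; ring, exp_add]; ring
      have h4 := Real.add_one_le_exp (-(l - l'))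
      rw [h3]
      nlinarith
    rw [tan_eq_sin_div_cos, mul_div_assoc', le_div_iff₀ d.y0]
    linarith
  have htan : 0 ≤ tan h := d.h0.le.trans (le_tan d.h0.le d.h1)
  have hBg : cc t - th h l - n * g + g ≤ π / 2 := by
    have h1 : n * (h - g) ≤ n * l * tan h := by
      have := p'.pos
      have h2 : n * (h - g) ≤ n * ((l - l') * tan h) := mul_le_mul_of_nonneg_left hdist hn0.le
      have h3 : (l - l') * tan h ≤ l * tan h := mul_le_mul_of_nonneg_right (by linarith) htan
      have h4 := mul_le_mul_of_nonneg_left h3 hn0.le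
      linarith
    unfold be at hap
    linarith
  have hBh : cc t - th h l - n * h = be t n h l := by unfold be; ring
  have hb1 := neg_pi_div_two_lt_be (l := l) p.pt.lt_cc
  have hlog := log_cos_sub_le (c := cc t - th h l) (n := n) (by linarith) hg0 hgh d.h1
    (by rw [hBh]; exact hb1) hBg
  rw [hBh] at hlog
  have hng : n * g ≤ n * h := mul_le_mul_of_nonneg_left hgh hn0.le
  have hth := th_lt h l
  have hcg : 0 < cos (cc t - th h l - n * g) := cos_pos_of_mem_Ioo ⟨by linarith, by linarith⟩
  have hug : 0 ≤ sin (cc t - n * g) :=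
    sin_nonneg_of_nonneg_of_le_pi (by linarith [p.pt.lt_cc]) (by linarith)
  have hQ : rQ h l ≤ rQ g l' := by
    refine rQ_le_rQ_of_path hA0 d'.l0 hll hl1 d.y0 dg.y0 hsin hsg ?_
    have := half_lt_cos_sq d.h0.le hh4
    rw [cos_sq'] at this
    linarith
  have hgw : gw t h l ≤ gw t g l' := by
    have h1 := mul_nonneg a.t0 d.p0
    have h2 := mul_nonneg a.t0 d'.p0
    unfold gw
    rw [div_le_div_iff₀ (by linarith) (by linarith [dg.x0])]
    have h3 : sin h * sinh l' ≤ sin g * sinh l := by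
      rw [hsin, hsg]
      have := mul_le_mul_of_nonneg_left (exp_mul_sinh_le hll) hA0.le
      linarith
    have := mul_le_mul_of_nonneg_left h3 a.t0
    linarith
  have hR := rR_pos h l
  have hgp := d.gw_pos a.t0 a.t1
  -- Along the path weight and `rQ` do not decrease towards `(g, l')`, so the lobe there is bounded
  -- below using the phase and amplitude of the original top.
  have lower : gw t h l * rR h l * cos (cc t - th h l - n * g) ≤ lob t n g l' := by
    have h1 : rR h l * cos (cc t - th h l - n * g) =
        cos (cc t - n * g) + rQ h l * sin (cc t - n * g) := by
      rw [← rR_mul_cos_sub_th]; congr 2; ring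
    have h2 := mul_le_mul_of_nonneg_right hQ hug
    unfold lob
    rw [mul_assoc]
    refine mul_le_mul hgw (by linarith) (by positivity) (hgp.le.trans hgw)
  have hcb := cos_be_pos d a p.pt.eq.ge
  have e1 := p.pt.eq
  rw [lob_eq] at e1
  have e2 := congrArg log e1
  rw [log_exp, Real.log_mul (by positivity) hcb.ne'] at e2
  have e3 : log (sin g) = log (sin h) - (l - l') := by
    rw [hsin, hsg, Real.log_mul hA0.ne' (exp_pos _).ne', Real.log_mul hA0.ne' (exp_pos _).ne',
      log_exp, log_exp]
    ring
  rw [e3] at hlog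
  have e4 : n * l' ≤ log (gw t h l * rR h l * cos (cc t - th h l - n * g)) := by
    rw [Real.log_mul (by positivity) hcg.ne']
    linarith
  rw [Real.le_log_iff_exp_le (by positivity)] at e4
  linarith

/-! ### Monotonicity of `a` for the times 5 and 6. -/

lemma pi_div_four_le_th_of_le {h l : ℝ} (d : Dom h l) (hh : 61 / 100 ≤ h)
    (hl : l ≤ 991 / 10000) : π / 4 ≤ th h l := by
  have hx := d.x0
  have hy := d.y0
  have hp := d.p0
  have hW := d.W0
  have hpi := pi_gt_three
  have s1 : 5721 / 10000 ≤ sin h := by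
    have e1 := sin_ge_sub_cube (x := 61 / 100) (by norm_num)
    have := sin_le_sin_of_le_of_le_pi_div_two (by linarith) d.h1.le hh
    norm_num at e1
    linarith
  have c1 : cos h ≤ 8203 / 10000 := by nlinarith [sin_sq_add_cos_sq h]
  have c2 : 1152 / 1000 ≤ rC h := by
    have := rC_sq h
    nlinarith [rC_pos h]
  have hs := sinh_le_mul d.l0 (by linarith)
  have e : 2 * sinh l / rW h l ≤ 331 / 1000 := by
    rw [div_le_iff₀ hW]
    unfold rW
    have f1 := mul_le_mul_of_nonneg_left (one_le_cosh l) hx.le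
    have f2 := mul_le_mul_of_nonneg_right c2 hp
    linarith
  have hQ : 1 ≤ rQ h l := by
    unfold rQ rN
    rw [le_div_iff₀ hy]
    linarith
  rw [← arctan_one]
  exact arctan_strictMono.monotone hQ

lemma th_le_of_le {h l : ℝ} (d : Dom h l) (hh : h ≤ 85 / 100) :
    th h l ≤ π / 2 - 45 / 100 := by
  have hy := d.y0
  have hx := d.x0
  have hpi := pi_gt_three
  have s1 : sin h ≤ 752 / 1000 := by
    have e1 := sin_le_quintic (x := 85 / 100) (by norm_num)
    have := sin_le_sin_of_le_of_le_pi_div_two (by linarith [d.h0]) (by linarith) hh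
    norm_num at e1
    linarith
  have hQ : rQ h l ≤ 19 / 10 := by
    have : rC h ≤ 19 / 10 * cos h := by
      have := rC_sq h
      have := sin_sq_add_cos_sq h
      refine abs_le_of_sq_le_sq' ?_ (by positivity) |>.2
      nlinarith
    unfold rQ
    rw [div_le_iff₀ hy]
    linarith [d.N_le]
  have hT : tan (45 / 100) ≤ 10 / 19 :=
    tan_le_of_le (b := 45 / 100) (by norm_num) le_rfl (by norm_num) (by norm_num) (by norm_num)
  have h1 := arctan_strictMono.monotone hT
  rw [arctan_tan (by linarith) (by linarith), show (10 / 19 : ℝ) = (19 / 10)⁻¹ by norm_num,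
    arctan_inv_of_pos (by norm_num)] at h1
  have h2 := arctan_strictMono.monotone hQ
  unfold th
  linarith

/-- Before the crest both equalities would hold, but for these times `l ≤ 0.21` and `h ≥ 0.49` give
`cos 2h < exp (-2l)`, so the lobe drops too fast between `n` and `n - 2`. -/
lemma IsTop.be_nonpos_of_le_six {t n h l : ℝ} (p : IsTop t n h l) (a : Adm t n)
    (hn : t = 1 ∧ n = 5 ∨ t = 0 ∧ n = 6) : be t n h l ≤ 0 := by
  have d := p.pt.dom
  have h0 := d.h0
  have hpi := pi_gt_d4
  refine (p.be_nonpos_or a).elim id fun eq2 => ?_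
  by_contra hb
  push Not at hb
  have hnl := mul_le_of_exp_le d a p.pt.lt_cc p.pt.eq.ge
  have hu := arg_lt_pi d p.pos a p.pt.eq.ge
  have hc := cos_be_pos d a p.pt.eq.ge
  have hth := th_lt h l
  have hbs : be t n h l ≤ l / h :=
    (le_tan hb.le (be_lt_pi_div_two d p.pos a p.pt.eq.ge)).trans
      (tan_be_le_of_eq d a (a.h_lt p.pt.lt_cc) (two_mul_sinh_lt d a p.pt.lt_cc p.pt.eq.ge) hc
        p.pt.eq eq2)
  have key : 49 / 100 ≤ h ∧ l ≤ 21 / 100 := by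
    rcases hn with ⟨rfl, rfl⟩ | ⟨rfl, rfl⟩ <;> unfold cc at hu
    · have hl : l ≤ 21 / 100 := by linarith
      have : l / h ≤ 67 / 100 := by rw [div_le_iff₀ h0]; linarith
      refine ⟨?_, hl⟩
      unfold be cc at hbs
      linarith
    · constructor <;> linarith
  have h2 := a.h_lt p.pt.lt_cc
  have hs : 0 < sin (2 * h) := sin_two_mul_pos h0 d.h1
  have hsb : 0 < sin (be t n h l) := sin_pos_of_pos_of_lt_pi hb
    (by linarith [be_lt_pi_div_two d p.pos a p.pt.eq.ge])
  have e1 : cos (be t n h l + 2 * h) = exp (-2 * l) * cos (be t n h l) := by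
    have e := p.pt.eq
    rw [lob_sub_two, show (n - 2) * l = -2 * l + n * l by ring, exp_add, ← e, lob_eq] at eq2
    have := d.gR_pos a.t0 a.t1
    apply mul_left_cancel₀ this.ne'
    linarith
  have e2 := add_one_le_exp (-2 * l)
  have c1 : cos (2 * h) ≤ 56 / 100 := by
    have f1 := cos_le_quartic (x := 98 / 100) (by norm_num)
    have := cos_le_cos_of_nonneg_of_le_pi (x := 98 / 100) (y := 2 * h) (by norm_num)
      (by linarith) (by linarith)
    norm_num at f1
    linarith
  rw [cos_add] at e1
  nlinarith [mul_pos hsb hs]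

lemma IsTop.mul_le_of_pi_div_four_le {t n h l : ℝ} (p : IsTop t n h l) (a : Adm t n)
    (hθ : π / 4 ≤ th h l) {A : ℝ} (hA : 0 ≤ A)
    (h1 : h * tan h + sinh l / sin h +
      h * (2 * t * sinh l * cos h / ((sin h + t * sinh l) * (sin h - t * sinh l))) ≤
        n * h * A) : n * h ≤ cc t - π / 4 + A := by
  have e : n * h = cc t - th h l - be t n h l := by unfold be; ring
  rcases le_or_gt (be t n h l) 0 with hb | hb
  · have h2 := (p.mul_tan_le a hb).trans h1
    have h3 := le_of_mul_le_mul_left h2 (mul_pos a.n0 p.pt.dom.h0)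
    have h4 := le_tan (x := -be t n h l) (by linarith)
      (by linarith [neg_pi_div_two_lt_be (l := l) p.pt.lt_cc])
    linarith
  · linarith

lemma IsTop.le_of_seven {h l : ℝ} (p : IsTop 1 7 h l) : h ≤ 61 / 100 := by
  by_contra hc
  push Not at hc
  have a : Adm 1 7 := Or.inr ⟨rfl, by norm_num⟩
  have d := p.pt.dom
  have hpi := pi_gt_d4
  have hpi2 := pi_lt_d4
  have hlt := p.pt.lt_cc
  have hh : h ≤ 6733 / 10000 := by unfold cc at hlt; linarith
  have hl : l ≤ 991 / 10000 := by
    have := mul_lt_of_lt_pi_div_four d a (by linarith) p.pt.eq.ge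
    linarith
  have hθ := pi_div_four_le_th_of_le d hc.le hl
  have hx : 572 / 1000 ≤ sin h := by
    have e1 := sin_ge_sub_cube (x := 61 / 100) (by norm_num)
    have := sin_le_sin_of_le_of_le_pi_div_two (by linarith) d.h1.le hc.le
    norm_num at e1
    linarith
  have hp0 := d.p0
  have hp : sinh l ≤ 1051 / 10000 := by
    have := sinh_le_mul d.l0 (by linarith)
    linarith
  have hy := d.y0
  have hy1 : cos h ≤ 821 / 1000 := by nlinarith [sin_sq_add_cos_sq h]
  have ht := tan_le_of_le (T := 8 / 10) d.h0.le hh (by norm_num) (by norm_num) (by norm_num)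
  have b1 : h * tan h ≤ h * (8 / 10) := mul_le_mul_of_nonneg_left ht d.h0.le
  have b2 : sinh l / sin h ≤ 184 / 1000 := by
    rw [div_le_iff₀ d.x0]; linarith
  have b3 : 2 * 1 * sinh l * cos h / ((sin h + 1 * sinh l) * (sin h - 1 * sinh l)) ≤
      548 / 1000 := by
    have : 316 / 1000 ≤ (sin h + 1 * sinh l) * (sin h - 1 * sinh l) := by nlinarith
    rw [div_le_iff₀ (by linarith)]
    nlinarith [mul_le_mul hp hy1 hy.le (by norm_num)]
  have b4 := mul_le_mul_of_nonneg_left b3 d.h0.le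
  have := p.mul_le_of_pi_div_four_le a hθ (A := 26 / 100) (by norm_num) (by linarith)
  unfold cc at this
  linarith

lemma IsTop.le_of_eight {h l : ℝ} (p : IsTop 0 8 h l) : h ≤ 71 / 100 := by
  by_contra hc
  push Not at hc
  have a : Adm 0 8 := Or.inl ⟨rfl, by norm_num⟩
  have d := p.pt.dom
  have hpi := pi_gt_d4
  have hpi2 := pi_lt_d4
  have hlt := p.pt.lt_cc
  have hh : h < π / 4 := by unfold cc at hlt; linarith
  have hl : l ≤ 867 / 10000 := by
    have := mul_lt_of_lt_pi_div_four d a hh p.pt.eq.ge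
    linarith
  have hθ := pi_div_four_le_th_of_le d (by linarith) (by linarith)
  have hx : 65 / 100 ≤ sin h := by
    have e1 := sin_ge_sub_cube (x := 71 / 100) (by norm_num)
    have := sin_le_sin_of_le_of_le_pi_div_two (by linarith) d.h1.le hc.le
    norm_num at e1
    linarith
  have hp : sinh l ≤ 92 / 1000 := by
    have := sinh_le_mul d.l0 (by linarith)
    linarith
  have ht : tan h ≤ 1 := by
    rw [← tan_pi_div_four]
    exact (tan_lt_tan_of_lt_of_lt_pi_div_two (by linarith) (by linarith) hh).le
  have b1 : h * tan h ≤ h * 1 := mul_le_mul_of_nonneg_left ht d.h0.le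
  have b2 : sinh l / sin h ≤ 142 / 1000 := by
    rw [div_le_iff₀ d.x0]; linarith
  have := p.mul_le_of_pi_div_four_le a hθ (A := 165 / 1000) (by norm_num) (by
    simp only [mul_zero, zero_mul, zero_div]
    linarith)
  unfold cc at this
  linarith

/-- From `exp (n l) ≤ rR` and `rR * cos h ≤ √2`, a lower bound for `a / 2` in terms of `sin h`
alone. -/
lemma sin_sq_pow_mul_le {n : ℕ} {t h l : ℝ} (d : Dom h l) (a : Adm t n)
    (he : exp (n * l) ≤ lob t n h l) :
    (sin h ^ 2) ^ n * (1 - sin h ^ 2) ≤ 2 * (exp (-l) * sin h) ^ (2 * n) := by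
  have h1 := exp_le_rR_of_le d a he
  have h2 := rR_mul_cos_sq_le d
  have h3 : exp (n * l) ^ 2 * cos h ^ 2 ≤ 2 := by
    rw [← mul_pow]
    refine (pow_le_pow_left₀ (mul_nonneg (exp_pos _).le d.y0.le) ?_ 2).trans h2
    exact mul_le_mul_of_nonneg_right h1 d.y0.le
  have e1 : (sin h ^ 2) ^ n = exp (n * l) ^ 2 * (exp (-l) * sin h) ^ (2 * n) := by
    rw [mul_pow, ← exp_nat_mul, ← exp_nat_mul, ← mul_assoc, ← exp_add, ← pow_mul]
    push_cast
    rw [show 2 * (n * l) + 2 * n * -l = 0 by ring, exp_zero, one_mul]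
  rw [e1, ← cos_sq']
  nlinarith [pow_nonneg (mul_nonneg (exp_pos (-l)).le d.x0.le) (2 * n)]

lemma exp_mul_sin_le_of_pow_le {n : ℕ} {h l h' l' s c : ℝ} (hn : n ≠ 0) (hl' : 0 ≤ l')
    (hs' : 0 ≤ sin h') (hs : 0 ≤ sin h) (h1 : sin h' ≤ s) (h2 : 2 * s ^ (2 * n) ≤ c)
    (h3 : c ≤ 2 * (exp (-l) * sin h) ^ (2 * n)) :
    exp (-l') * sin h' ≤ exp (-l) * sin h := by
  have e : exp (-l') * sin h' ≤ s :=
    (mul_le_of_le_one_left hs' (exp_le_one_iff.2 (by linarith))).trans h1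
  refine e.trans ?_
  refine le_of_pow_le_pow_left₀ (n := 2 * n) (by omega) (mul_nonneg (exp_pos _).le hs) ?_
  linarith

/-- The estimate `IsTop.apriori` needs later times. Here `sin h'` is bounded above by
`IsTop.le_of_seven`, while `be ≤ 0` confines `h` to an interval on which `sin_sq_pow_mul_le` bounds
`a / 2` below. -/
lemma IsTop.exp_mul_sin_le_of_five {h l h' l' : ℝ} (p : IsTop 1 5 h l) (p' : IsTop 1 7 h' l') :
    exp (-l') * sin h' ≤ exp (-l) * sin h := by
  have a : Adm 1 5 := Or.inr ⟨rfl, by norm_num⟩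
  have d := p.pt.dom
  have d' := p'.pt.dom
  have hpi := pi_gt_d4
  have hpi2 := pi_lt_d4
  have hb := p.be_nonpos_of_le_six a (Or.inl ⟨rfl, rfl⟩)
  have hlt := p.pt.lt_cc
  have hh : 718 / 1000 ≤ h := by
    by_contra hc
    push Not at hc
    have := th_le_of_le d (by linarith)
    unfold be cc at hb
    linarith
  have x1 : 656 / 1000 ≤ sin h := by
    have e1 := sin_ge_sub_cube (x := 718 / 1000) (by norm_num)
    have := sin_le_sin_of_le_of_le_pi_div_two (by linarith) d.h1.le hh
    norm_num at e1
    linarith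
  have x2 : sin h ≤ 81 / 100 := by
    have e1 := sin_le_quintic (x := 943 / 1000) (by norm_num)
    have : h ≤ 943 / 1000 := by unfold cc at hlt; linarith
    have := sin_le_sin_of_le_of_le_pi_div_two (by linarith) (by linarith) this
    norm_num at e1
    linarith
  have s1 : sin h' ≤ 573 / 1000 := by
    have e1 := sin_le_quintic (x := 61 / 100) (by norm_num)
    have := sin_le_sin_of_le_of_le_pi_div_two (by linarith [d'.h0]) (by linarith) p'.le_of_seven
    norm_num at e1
    linarith
  have key := sin_sq_pow_mul_le (n := 5) (t := 1) d (by exact_mod_cast a)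
    (by exact_mod_cast p.pt.eq.ge)
  refine exp_mul_sin_le_of_pow_le (n := 5) (s := 573 / 1000) (by norm_num) d'.l0 d'.x0.le d.x0.le
    s1 (c := 77 / 10000) (by norm_num) (le_trans ?_ key)
  have X1 : 4303 / 10000 ≤ sin h ^ 2 := by nlinarith
  have X2 : sin h ^ 2 ≤ 66 / 100 := by nlinarith
  have step : ∀ u v : ℝ, 0 ≤ u → v ≤ 1 → u ≤ sin h ^ 2 → sin h ^ 2 ≤ v →
      u ^ 5 * (1 - v) ≤ (sin h ^ 2) ^ 5 * (1 - sin h ^ 2) := fun u v hu hv h1 h2 =>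
    mul_le_mul (pow_le_pow_left₀ hu h1 5) (by linarith) (by linarith) (by positivity)
  -- The product `X^5 (1 - X)` is bounded below on three subintervals by taking the left end in the
  -- first factor and the right end in the second.
  rcases le_total (sin h ^ 2) (45 / 100) with h1 | h1
  · exact le_trans (by norm_num) (step _ _ (by norm_num) (by norm_num) X1 h1)
  rcases le_total (sin h ^ 2) (1 / 2) with h2 | h2
  · exact le_trans (by norm_num) (step _ _ (by norm_num) (by norm_num) h1 h2)
  · exact le_trans (by norm_num) (step _ _ (by norm_num) (by norm_num) h2 X2)

lemma IsTop.exp_mul_sin_le_of_six {h l h' l' : ℝ} (p : IsTop 0 6 h l) (p' : IsTop 0 8 h' l') :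
    exp (-l') * sin h' ≤ exp (-l) * sin h := by
  have a : Adm 0 6 := Or.inl ⟨rfl, by norm_num⟩
  have d := p.pt.dom
  have d' := p'.pt.dom
  have hpi := pi_gt_d4
  have hb := p.be_nonpos_of_le_six a (Or.inr ⟨rfl, rfl⟩)
  have hh : 85 / 100 ≤ h := by
    by_contra hc
    push Not at hc
    have := th_le_of_le d (by linarith)
    unfold be cc at hb
    linarith
  have x1 : 7476 / 10000 ≤ sin h := by
    have e1 := sin_ge_sub_cube (x := 85 / 100) (by norm_num)
    have := sin_le_sin_of_le_of_le_pi_div_two (by linarith) d.h1.le hh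
    norm_num at e1
    linarith
  have x2 : sin h ^ 2 ≤ 75 / 100 := by
    have := half_lt_cos d.h0.le (a.h_lt p.pt.lt_cc)
    nlinarith [sin_sq_add_cos_sq h]
  have s1 : sin h' ≤ 652 / 1000 := by
    have e1 := sin_le_quintic (x := 71 / 100) (by norm_num)
    have := sin_le_sin_of_le_of_le_pi_div_two (by linarith [d'.h0]) (by linarith) p'.le_of_eight
    norm_num at e1
    linarith
  have key := sin_sq_pow_mul_le (n := 6) (t := 0) d (by exact_mod_cast a)
    (by exact_mod_cast p.pt.eq.ge)
  refine exp_mul_sin_le_of_pow_le (n := 6) (s := 652 / 1000) (by norm_num) d'.l0 d'.x0.le d.x0.le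
    s1 (c := 12 / 1000) (by norm_num) (le_trans ?_ key)
  have X1 : 5589 / 10000 ≤ sin h ^ 2 := by nlinarith
  have step : ∀ u v : ℝ, 0 ≤ u → v ≤ 1 → u ≤ sin h ^ 2 → sin h ^ 2 ≤ v →
      u ^ 6 * (1 - v) ≤ (sin h ^ 2) ^ 6 * (1 - sin h ^ 2) := fun u v hu hv h1 h2 =>
    mul_le_mul (pow_le_pow_left₀ hu h1 6) (by linarith) (by linarith) (by positivity)
  rcases le_total (sin h ^ 2) (6 / 10) with h1 | h1
  · exact le_trans (by norm_num) (step _ _ (by norm_num) (by norm_num) X1 h1)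
  rcases le_total (sin h ^ 2) (67 / 100) with h2 | h2
  · exact le_trans (by norm_num) (step _ _ (by norm_num) (by norm_num) h1 h2)
  · exact le_trans (by norm_num) (step _ _ (by norm_num) (by norm_num) h2 x2)

lemma IsTop.exp_mul_sin_le_add_two {k : ℕ} (hk : 4 ≤ k) {h l h' l' : ℝ}
    (p : IsTop (par (k + 1)) ((k + 1 : ℕ) : ℝ) h l)
    (p' : IsTop (par (k + 1)) (((k + 1 : ℕ) : ℝ) + 2) h' l') :
    exp (-l') * sin h' ≤ exp (-l) * sin h := by
  have a := adm_par hk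
  rcases Nat.lt_or_ge k 6 with h6 | h6
  · interval_cases k
    · rw [par_of_odd (by decide)] at p p'
      norm_num at p p'
      exact p.exp_mul_sin_le_of_five p'
    · rw [par_of_even (by decide)] at p p'
      norm_num at p p'
      exact p.exp_mul_sin_le_of_six p'
  · refine p.exp_mul_sin_le a ?_ p'
    rcases Nat.even_or_odd (k + 1) with he | ho
    · refine Or.inr ⟨par_of_even he, ?_⟩
      have : 8 ≤ k + 1 := by
        obtain ⟨m, hm⟩ := he
        omega
      exact_mod_cast this
    · refine Or.inl ⟨par_of_odd ho, ?_⟩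
      exact_mod_cast (by omega : 7 ≤ k + 1)

lemma IsLowestPoint.monotone {k : ℕ} (hk : 4 ≤ k) {q q' : ℝ × ℝ}
    (hq : IsLowestPoint (curveC k) q) (hq' : IsLowestPoint (curveC (k + 2)) q') :
    q.2 ≤ q'.2 ∧ q'.1 ≤ q.1 := by
  obtain ⟨h, l, p, rfl⟩ := (isLowestPoint_iff hk q).1 hq
  obtain ⟨h', l', p', rfl⟩ := (isLowestPoint_iff (by omega) q').1 hq'
  rw [show k + 2 + 1 = k + 1 + 2 by ring, par_add_two] at p'
  have e : ((k + 1 + 2 : ℕ) : ℝ) = ((k + 1 : ℕ) : ℝ) + 2 := by push_cast; ring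
  rw [e] at p'
  have h1 := p.le_of_add_two (adm_par hk) p'
  have h2 := p.exp_mul_sin_le_add_two hk p'
  exact ⟨exp_le_exp.2 (by linarith), by dsimp only; linarith⟩

end Lozi

theorem mainTheorem4 :
    (∀ k : ℕ, 4 ≤ k → ∃! p : ℝ × ℝ, Lozi.IsLowestPoint (Lozi.curveC k) p) ∧
    ∀ a b : ℕ → ℝ,
      (∀ k : ℕ, 4 ≤ k → Lozi.IsLowestPoint (Lozi.curveC k) (a k, b k)) →
      (∀ k : ℕ, 4 ≤ k → b k ≤ b (k + 2) ∧ a (k + 2) ≤ a k) ∧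
      Filter.Tendsto (fun k : ℕ => (a k, b k)) Filter.atTop (nhds ((0 : ℝ), (1 : ℝ))) :=
  ⟨fun _ hk => Lozi.existsUnique_isLowestPoint hk, fun _ _ H =>
    ⟨fun k hk => (H k hk).monotone hk (H (k + 2) (by omega)), Lozi.tendsto_of_isLowestPoint H⟩⟩
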